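/- **Setting.** Let $\mathscr{D}=(D_1,D_2,D_3)$ be a triple of open disks in $\mathbb{C}$ such that $\#(\overline{D_j}\cap\overline{D_k})=1$ for $j\neq k$. Let $\{q_j(\mathscr{D})\}=\overline{D_k}\cap\overline{D_l}$ for $\{j,k,l\}=\{1,2,3\}$, let $V_0(\mathscr{D})=\{q_1(\mathscr{D}),q_2(\mathscr{D}),q_3(\mathscr{D})\}$, and assume that $q_1(\mathscr{D}),q_2(\mathscr{D}),q_3(\mathscr{D})$ are in counterclockwise order. Let $T(\mathscr{D})$ be the unique bounded connected component of $\mathbb{C}\setminus\bigcup_j\overline{D_j}$, let $\triangle(\mathscr{D})$ be the open triangle whose vertices are the centers of $D_1,D_2,D_3$, and let $D_{\mathrm{in}}(\mathscr{D})$ be the unique open disk contained in $T(\mathscr{D})$ whose closure meets each $\overline{D_j}$ in exactly one point. Let $\Phi_j(\mathscr{D})$ be $\mathscr{D}$ with $D_j$ replaced by $D_{\mathrm{in}}(\mathscr{D})$; for a word $w=w_1\dots w_m\in W_m:=\{1,2,3\}^m$ put $\mathscr{D}_w=\Phi_{w_m}\circ\cdots\circ\Phi_{w_1}(\mathscr{D})$,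 and put $W_*=\bigcup_{m\ge0}W_m$. Let $V_m=\bigcup_{w\in W_m}V_0(\mathscr{D}_w)$ and $V_*=\bigcup_{m\ge 0}V_m$. Let $\mathscr{A}_{\mathscr{D}}=\{\overline{T(\mathscr{D})}\cap\partial D_j\mid j=1,2,3\}\cup\{\partial D_{\mathrm{in}}(\mathscr{D}_w)\mid w\in W_*\}$ (a family of circular arcs) and $K^0=\bigcup_{C\in\mathscr{A}_{\mathscr{D}}}C$. For $C\in\mathscr{A}_{\mathscr{D}}$ let $\mathrm{rad}(C)$ be the radius of the circle containing $C$, $\mathscr{H}^1_C$ the length measure on $C$ and $\nabla_C$ the gradient along $C$; let $W^{1,2}(C)$ be the set of absolutely continuous $u:C\to\mathbb{R}$ with $|\nabla_C u|\in L^2(C,\mathscr{H}^1_C)$. *Arc-energy form.* Let $\mathcal{F}_{\mathscr{D}}$ be the linear space of all $u:K^0\to\mathbb{R}$ such that $u|_C\in W^{1,2}(C)$ for every $C\in\mathscr{A}_{\mathscr{D}}$ and $\sum_{C}\int_C|\nabla_C(u|_C)|^2\,\mathrm{rad}(C)\,d\mathscr{H}^1_C<\infty$, and for $u,v\in\mathcal{F}_{\mathscr{D}}$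 set $$\mathcal{E}^{\mathscr{D}}(u,v)=\sum_{C\in\mathscr{A}_{\mathscr{D}}}\int_C\langle\nabla_C(u|_C),\nabla_C(v|_C)\rangle\,\mathrm{rad}(C)\,d\mathscr{H}^1_C .$$ *Discrete forms.* Let $h_1(z)=\mathrm{Re}\,z$ and $h_2(z)=\mathrm{Im}\,z$. Consider sequences $(\mathcal{E}_m)_{m\ge0}$ such that for every $m\geq 0$: 1. $\mathcal{E}_m$ is a symmetric Dirichlet form on $\ell^2(V_m)$ (a symmetric nonnegative definite bilinear form on $\mathbb{R}^{V_m}$ with $\mathcal{E}_m(u^+\wedge1,u^+\wedge1)\le\mathcal{E}_m(u,u)$), and $\mathcal{E}_m(\mathbf{1}_x,\mathbf{1}_y)=0=\mathcal{E}_m(\mathbf{1}_x,\mathbf{1})$ whenever $x,y\in V_m$ do not both belong to $V_0(\mathscr{D}_w)$ for some $w\in W_m$; 2. for $i=1,2$, $\mathcal{E}_m(h_i|_{V_m},v)=0$ for all $v\in\mathbb{R}^{V_m}$ with $v|_{V_0(\mathscr{D})}=0$; 3. $\mathcal{E}_m(u,u)=\min\{\mathcal{E}_{m+1}(v,v)\mid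 v\in\mathbb{R}^{V_{m+1}},\ v|_{V_m}=u\}$ for all $u\in\mathbb{R}^{V_m}$; 4. $\sum_{i=1}^2\mathcal{E}_m(h_i|_{V_m},h_i|_{V_m})=2\,\mathrm{vol}_2(\triangle(\mathscr{D}))$. **Theorem.** There is exactly one such sequence $(\mathcal{E}_m)_{m\ge 0}$, and $V_*\subset K^0$. Let $$\mathcal{F}'_{\mathscr{D}}=\Bigl\{u\in\mathbb{R}^{V_*}\Bigm|\lim_{m\to\infty}\mathcal{E}_m(u|_{V_m},u|_{V_m})<\infty\Bigr\},\qquad \mathcal{E}'^{\mathscr{D}}(u,v)=\lim_{m\to\infty}\mathcal{E}_m(u|_{V_m},v|_{V_m})\quad(u,v\in\mathcal{F}'_{\mathscr{D}}),$$ where the second limit exists in $\mathbb{R}$. Then $\mathcal{F}'_{\mathscr{D}}=\{u|_{V_*}\mid u\in\mathcal{F}_{\mathscr{D}}\}$, the map $\mathcal{F}_{\mathscr{D}}\ni u\mapsto u|_{V_*}\in\mathcal{F}'_{\mathscr{D}}$ is a linear isomorphism, and for all $u,v\in\mathcal{F}_{\mathscr{D}}$ the series defining $\mathcal{E}^{\mathscr{D}}(u,v)$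 converges absolutely and $$\mathcal{E}'^{\mathscr{D}}(u|_{V_*},v|_{V_*})=\mathcal{E}^{\mathscr{D}}(u,v).$$ -/

import Mathlib

open MeasureTheory Filter Topology

noncomputable section

namespace Apollonian

/-! ### Tangential disk triples -/

/-- A (non-degenerate) disk in the plane, given by its centre and its radius. -/
structure Disk where
  center : ℂ
  radius : ℝ
  radius_pos : 0 < radius

instance : Inhabited Disk := ⟨⟨0, 1, one_pos⟩⟩

/-- The open disk as a set. -/
def Disk.toSet (D : Disk) : Set ℂ := Metric.ball D.center D.radius

/-- The point of tangency `q_j` of the two disks with indices `≠ j`: it divides the segment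
between the two centres in the ratio of the radii. -/
def q (T : Fin 3 → Disk) (j : Fin 3) : ℂ :=
  AffineMap.lineMap (T (j + 1)).center (T (j + 2)).center
    ((T (j + 1)).radius / ((T (j + 1)).radius + (T (j + 2)).radius))

/-- `V_0`, the set of the three points of tangency. -/
def V0 (T : Fin 3 → Disk) : Set ℂ := Set.range (q T)

/-- A positively oriented tangential disk triple consisting of three disks: any two of the closed
disks have exactly one common point, and `q_1, q_2, q_3` are in counterclockwise order. -/
structure IsTDT (T : Fin 3 → Disk) : Prop where
  tangent : ∀ j k : Fin 3, j ≠ k → (closure (T j).toSet ∩ closure (T k).toSet).ncard = 1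
  oriented : 0 < ((starRingEnd ℂ) (q T 1 - q T 0) * (q T 2 - q T 0)).im

/-- The ideal triangle: the bounded connected component of the complement of the closed disks. -/
def idealTriangle (T : Fin 3 → Disk) : Set ℂ :=
  {z | z ∈ (⋃ j, closure (T j).toSet)ᶜ ∧
    Bornology.IsBounded (connectedComponentIn (⋃ j, closure (T j).toSet)ᶜ z)}

/-- The open triangle whose vertices are the centres of the disks. -/
def centerTriangle (T : Fin 3 → Disk) : Set ℂ :=
  interior (convexHull ℝ (Set.range fun j => (T j).center))

/-- `D` is inscribed in the ideal triangle: it is contained in it and touches the three disks. -/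
def IsInscribed (T : Fin 3 → Disk) (D : Disk) : Prop :=
  D.toSet ⊆ idealTriangle T ∧ ∀ j, (closure D.toSet ∩ closure (T j).toSet).ncard = 1

/-- The inscribed disk `D_in` (for a tangential disk triple there is exactly one). -/
def inDisk (T : Fin 3 → Disk) : Disk := Classical.epsilon (IsInscribed T)

/-- The map `Φ_j`: replace the `j`-th disk by the inscribed disk. -/
def Phi (T : Fin 3 → Disk) (j : Fin 3) : Fin 3 → Disk := Function.update T j (inDisk T)

/-- The triple `Φ_{w_m} ∘ ⋯ ∘ Φ_{w_1}` applied to `T`, for the word `w = w_1 … w_m`. -/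
def cell (T : Fin 3 → Disk) (w : List (Fin 3)) : Fin 3 → Disk := w.foldl Phi T

/-! ### Vertices and arcs -/

/-- `V_m`, the union of the `V_0`'s of the cells of level `m`. -/
def V (T : Fin 3 → Disk) (m : ℕ) : Set ℂ :=
  {x | ∃ w : List (Fin 3), w.length = m ∧ x ∈ V0 (cell T w)}

/-- `V_*`, the union of all `V_m`. -/
def VStar (T : Fin 3 → Disk) : Set ℂ := ⋃ m, V T m

/-- The arcs are indexed by the three outer disks and by the words: they are the three sides of the
ideal triangle and the boundary circles of the inscribed disks of all cells. Distinct indices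
give distinct arcs. -/
abbrev ArcIndex := Fin 3 ⊕ List (Fin 3)

/-- The disk on whose boundary the arc lies. -/
def arcDisk (T : Fin 3 → Disk) : ArcIndex → Disk
  | Sum.inl j => T j
  | Sum.inr w => inDisk (cell T w)

/-- The arcs themselves. -/
def arc (T : Fin 3 → Disk) : ArcIndex → Set ℂ
  | Sum.inl j => closure (idealTriangle T) ∩ frontier (T j).toSet
  | Sum.inr w => frontier (inDisk (cell T w)).toSet

/-- `K^0`, the union of all the arcs. -/
def K0 (T : Fin 3 → Disk) : Set ℂ := ⋃ i, arc T i

/-! ### Calculus on circular arcs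

Points of the circle bounding a disk `D` are written as
`circleMap D.center D.radius θ = D.center + D.radius * exp (θ * I)`. -/

/-- Absolute continuity of `f` along a subset `C` of the circle bounding `D`: it is absolutely
continuous in the angle, on every compact interval of angles that is mapped into `C`. -/
def IsACOn (D : Disk) (C : Set ℂ) (f : ℂ → ℝ) : Prop :=
  ∀ a b : ℝ, a ≤ b → circleMap D.center D.radius '' Set.Icc a b ⊆ C →
    AbsolutelyContinuousOnInterval (fun θ => f (circleMap D.center D.radius θ)) a b

/-- The length measure of the arc `C` on the circle bounding `D`, read in the angle
`θ ∈ (0, 2π]`: it is `radius * dθ` on the set of angles of points of `C`. (Only angles interior to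
this set are kept; for an arc this leaves out at most its end points.) -/
def arcLength (D : Disk) (C : Set ℂ) : Measure ℝ :=
  ENNReal.ofReal D.radius • volume.restrict
    (interior {θ : ℝ | circleMap D.center D.radius θ ∈ C} ∩ Set.Ioc 0 (2 * Real.pi))

/-- The gradient vector of `f` along the circle bounding `D`, at the point of angle `θ`: the
derivative with respect to arc length times the unit tangent vector. -/
def arcGrad (D : Disk) (f : ℂ → ℝ) (θ : ℝ) : ℂ :=
  (deriv (fun t => f (circleMap D.center D.radius t)) θ / D.radius) •
    (Complex.exp (θ * Complex.I) * Complex.I)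

/-- A function on a subset of the plane, extended by `0`. -/
def extend {A : Set ℂ} (u : A → ℝ) : ℂ → ℝ := Function.extend Subtype.val u 0

/-- The restriction of functions to a smaller set, as a linear map. -/
def restr {A B : Set ℂ} (h : B ⊆ A) : (A → ℝ) →ₗ[ℝ] (B → ℝ) :=
  LinearMap.funLeft ℝ ℝ (Set.inclusion h)

/-- The gradient of `u` along the arc with index `i`, as a function of the angle. -/
def grad (T : Fin 3 → Disk) (u : K0 T → ℝ) (i : ArcIndex) : ℝ → ℂ :=
  arcGrad (arcDisk T i) (extend u)

/-- The length measure on the arc with index `i`, read in the angle. -/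
def len (T : Fin 3 → Disk) (i : ArcIndex) : Measure ℝ := arcLength (arcDisk T i) (arc T i)

/-! ### Facts needed for `F_D` to be a linear subspace -/

lemma extend_add {A : Set ℂ} (u v : A → ℝ) : extend (u + v) = extend u + extend v := by
  have := Function.extend_add (Subtype.val : A → ℂ) u v 0 0
  simpa [extend] using this

lemma extend_smul {A : Set ℂ} (c : ℝ) (u : A → ℝ) : extend (c • u) = c • extend u := by
  have := Function.extend_smul c (Subtype.val : A → ℂ) u 0
  simpa [extend] using this

lemma IsACOn.ae_differentiableAt {D : Disk} {C : Set ℂ} {f : ℂ → ℝ} (hf : IsACOn D C f) :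
    ∀ᵐ θ ∂(arcLength D C),
      DifferentiableAt ℝ (fun t => f (circleMap D.center D.radius t)) θ := by
  unfold arcLength
  apply Measure.ae_smul_measure
  rw [ae_restrict_iff' (isOpen_interior.measurableSet.inter measurableSet_Ioc), ae_iff]
  apply measure_null_of_locally_null
  intro θ hθ
  simp only [Set.mem_ofPred_eq, Classical.not_imp] at hθ
  obtain ⟨ε, hε, hball⟩ := Metric.isOpen_iff.1 isOpen_interior θ hθ.1.1
  have hsub : circleMap D.center D.radius '' Set.Icc (θ - ε / 2) (θ + ε / 2) ⊆ C := by
    rintro _ ⟨t, ht, rfl⟩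
    have hmem : t ∈ {θ : ℝ | circleMap D.center D.radius θ ∈ C} := by
      refine interior_subset (hball ?_)
      rw [Metric.mem_ball, Real.dist_eq, abs_lt]
      constructor <;> linarith [ht.1, ht.2]
    exact hmem
  have hac := hf (θ - ε / 2) (θ + ε / 2) (by linarith) hsub
  have hd := hac.boundedVariationOn.ae_differentiableAt_of_mem_uIcc
  refine ⟨_ ∩ Set.Ioo (θ - ε / 2) (θ + ε / 2), inter_mem self_mem_nhdsWithin
    (mem_nhdsWithin_of_mem_nhds (Ioo_mem_nhds (by linarith) (by linarith))), ?_⟩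
  rw [ae_iff] at hd
  refine measure_mono_null ?_ hd
  rintro t ⟨ht, ht'⟩
  simp only [Set.mem_ofPred_eq, Classical.not_imp] at ht ⊢
  refine ⟨?_, ht.2⟩
  rw [Set.uIcc_of_le (by linarith)]
  exact Set.Ioo_subset_Icc_self ht'

lemma arcGrad_add {D : Disk} {C : Set ℂ} {f g : ℂ → ℝ} (hf : IsACOn D C f) (hg : IsACOn D C g) :
    arcGrad D (f + g) =ᵐ[arcLength D C] arcGrad D f + arcGrad D g := by
  filter_upwards [hf.ae_differentiableAt, hg.ae_differentiableAt] with θ h1 h2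
  simp only [arcGrad, Pi.add_apply]
  rw [deriv_fun_add h1 h2, add_div, add_smul]

lemma arcGrad_smul (D : Disk) (c : ℝ) (f : ℂ → ℝ) : arcGrad D (c • f) = c • arcGrad D f := by
  funext θ
  simp only [arcGrad, Pi.smul_apply, smul_eq_mul]
  rw [deriv_const_mul_field, mul_div_assoc, mul_smul]

/-! ### The arc-energy form -/

/-- `u` restricted to the arc with index `i` belongs to `W^{1,2}`. -/
def IsW12 (T : Fin 3 → Disk) (u : K0 T → ℝ) (i : ArcIndex) : Prop :=
  IsACOn (arcDisk T i) (arc T i) (extend u) ∧ MemLp (grad T u i) 2 (len T i)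

/-- `∫_C |∇_C u|² rad(C) dℋ¹_C`, as an element of `[0, ∞]`, for the arc with index `i`. -/
def arcEnergy (T : Fin 3 → Disk) (u : K0 T → ℝ) (i : ArcIndex) : ENNReal :=
  ∫⁻ θ, ‖grad T u i θ‖ₑ ^ 2 * ENNReal.ofReal (arcDisk T i).radius ∂(len T i)

lemma grad_add {T : Fin 3 → Disk} {u v : K0 T → ℝ} {i : ArcIndex} (hu : IsW12 T u i)
    (hv : IsW12 T v i) : grad T (u + v) i =ᵐ[len T i] grad T u i + grad T v i := by
  unfold grad len
  rw [extend_add]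
  exact arcGrad_add hu.1 hv.1

lemma grad_smul (T : Fin 3 → Disk) (c : ℝ) (u : K0 T → ℝ) (i : ArcIndex) :
    grad T (c • u) i = c • grad T u i := by
  unfold grad
  rw [extend_smul, arcGrad_smul]

lemma enorm_add_sq_le (a b : ℂ) : ‖a + b‖ₑ ^ 2 ≤ 2 * ‖a‖ₑ ^ 2 + 2 * ‖b‖ₑ ^ 2 := by
  have h : ‖a + b‖₊ ^ 2 ≤ 2 * ‖a‖₊ ^ 2 + 2 * ‖b‖₊ ^ 2 := by
    rw [← NNReal.coe_le_coe]
    push_cast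
    nlinarith [norm_add_le a b, norm_nonneg (a + b), sq_nonneg (‖a‖ - ‖b‖)]
  simp only [enorm_eq_nnnorm]
  exact_mod_cast h

lemma arcEnergy_add_le {T : Fin 3 → Disk} {u v : K0 T → ℝ} {i : ArcIndex} (hu : IsW12 T u i)
    (hv : IsW12 T v i) :
    arcEnergy T (u + v) i ≤ 2 * arcEnergy T u i + 2 * arcEnergy T v i := by
  unfold arcEnergy
  have hm : AEMeasurable (fun θ => 2 * (‖grad T u i θ‖ₑ ^ 2 *
      ENNReal.ofReal (arcDisk T i).radius)) (len T i) :=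
    ((hu.2.1.enorm.pow_const 2).mul_const _).const_mul 2
  rw [← lintegral_const_mul' 2 _ (by simp), ← lintegral_const_mul' 2 _ (by simp),
    ← lintegral_add_left' hm]
  refine lintegral_mono_ae ?_
  filter_upwards [grad_add hu hv] with θ h
  rw [h, Pi.add_apply, ← mul_assoc, ← mul_assoc, ← add_mul]
  exact mul_le_mul_left (enorm_add_sq_le _ _) _

/-- The space `F_D`: functions on `K^0` that are in `W^{1,2}` on every arc and have finite total
energy. -/
def domain (T : Fin 3 → Disk) : Submodule ℝ (K0 T → ℝ) where
  carrier := {u | (∀ i, IsW12 T u i) ∧ ∑' i, arcEnergy T u i < ⊤}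
  zero_mem' := by
    have h0 : extend (0 : K0 T → ℝ) = 0 := by simpa using extend_smul 0 (0 : K0 T → ℝ)
    have hg : ∀ i, grad T (0 : K0 T → ℝ) i = 0 := fun i => by simpa using grad_smul T 0 0 i
    refine ⟨fun i => ⟨?_, ?_⟩, ?_⟩
    · intro a b _ _
      rw [h0]
      exact (LipschitzWith.const (0 : ℝ)).lipschitzOnWith.absolutelyContinuousOnInterval
    · rw [hg]
      exact MemLp.zero
    · simp [arcEnergy, hg]
  add_mem' := by
    rintro u v ⟨hu, hu'⟩ ⟨hv, hv'⟩
    refine ⟨fun i => ⟨?_, ?_⟩, ?_⟩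
    · intro a b hab hC
      rw [extend_add]
      exact ((hu i).1 a b hab hC).add ((hv i).1 a b hab hC)
    · exact (memLp_congr_ae (grad_add (hu i) (hv i))).2 ((hu i).2.add (hv i).2)
    · refine (ENNReal.tsum_le_tsum fun i => arcEnergy_add_le (hu i) (hv i)).trans_lt ?_
      rw [ENNReal.tsum_add, ENNReal.tsum_mul_left, ENNReal.tsum_mul_left]
      exact ENNReal.add_lt_top.2 ⟨ENNReal.mul_lt_top (by simp) hu', ENNReal.mul_lt_top (by simp) hv'⟩
  smul_mem' := by
    rintro c u ⟨hu, hu'⟩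
    refine ⟨fun i => ⟨?_, ?_⟩, ?_⟩
    · intro a b hab hC
      rw [extend_smul]
      exact ((hu i).1 a b hab hC).const_mul c
    · rw [grad_smul]
      exact (hu i).2.const_smul c
    · have h : ∀ i, arcEnergy T (c • u) i = ‖c‖ₑ ^ 2 * arcEnergy T u i := by
        intro i
        unfold arcEnergy
        rw [← lintegral_const_mul' _ _ (by simp), grad_smul]
        refine lintegral_congr fun θ => ?_
        rw [Pi.smul_apply, enorm_smul, mul_pow, mul_assoc]
      simp only [h]
      rw [ENNReal.tsum_mul_left]
      exact ENNReal.mul_lt_top (by simp) hu'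

/-- `∫_C ⟨∇_C u, ∇_C v⟩ rad(C) dℋ¹_C` for the arc `C` with index `i`. -/
def arcForm (T : Fin 3 → Disk) (u v : K0 T → ℝ) (i : ArcIndex) : ℝ :=
  ∫ θ, inner ℝ (grad T u i θ) (grad T v i θ) * (arcDisk T i).radius ∂(len T i)

/-- The arc-energy form `E^D(u, v)`, the sum of `arcForm` over all arcs. -/
def energy (T : Fin 3 → Disk) (u v : K0 T → ℝ) : ℝ := ∑' i, arcForm T u v i

/-! ### The discrete forms and their inductive limit -/

lemma q_Phi (T : Fin 3 → Disk) (j : Fin 3) : q (Phi T j) j = q T j := by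
  fin_cases j <;> simp [q, Phi, Function.update]

lemma V_subset_succ (T : Fin 3 → Disk) (m : ℕ) : V T m ⊆ V T (m + 1) := by
  rintro x ⟨w, hw, j, rfl⟩
  refine ⟨w ++ [j], by simp [hw], j, ?_⟩
  simp only [cell, List.foldl_append, List.foldl_cons, List.foldl_nil]
  exact q_Phi _ j

lemma V_subset_VStar (T : Fin 3 → Disk) (m : ℕ) : V T m ⊆ VStar T :=
  Set.subset_iUnion (V T) m

/-- `E` is a symmetric Dirichlet form on `ℓ²(A)`; it is used for finite sets `A`. -/
structure IsDirichletForm {A : Set ℂ} (E : LinearMap.BilinForm ℝ (A → ℝ)) : Prop where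
  symm : ∀ u v, E u v = E v u
  nonneg : ∀ u, 0 ≤ E u u
  markov : ∀ u, E ((u ⊔ 0) ⊓ 1) ((u ⊔ 0) ⊓ 1) ≤ E u u

/-- The indicator function of the point `x`. -/
def ind {A : Set ℂ} (x : A) : A → ℝ := Set.indicator {x} 1

/-- The first coordinate function `h_1` on `A`. -/
def h1 (A : Set ℂ) : A → ℝ := fun x => (x : ℂ).re

/-- The second coordinate function `h_2` on `A`. -/
def h2 (A : Set ℂ) : A → ℝ := fun x => (x : ℂ).im

/-- `h` is harmonic off `B` with respect to the form `E` on functions on `A`. -/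
def IsHarmonicOff {A : Set ℂ} (E : LinearMap.BilinForm ℝ (A → ℝ)) (B : Set ℂ) (h : A → ℝ) : Prop :=
  ∀ v : A → ℝ, (∀ x : A, (x : ℂ) ∈ B → v x = 0) → E h v = 0

/-- The defining properties of the sequence of discrete forms `E_m` on `V_m`. -/
structure IsDiscreteForms (T : Fin 3 → Disk)
    (E : (m : ℕ) → LinearMap.BilinForm ℝ (V T m → ℝ)) : Prop where
  dirichlet : ∀ m, IsDirichletForm (E m)
  isLocal : ∀ m (x y : V T m),
    (¬ ∃ w : List (Fin 3), w.length = m ∧ (x : ℂ) ∈ V0 (cell T w) ∧ (y : ℂ) ∈ V0 (cell T w)) →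
      E m (ind x) (ind y) = 0 ∧ E m (ind x) 1 = 0
  harmonic : ∀ m, IsHarmonicOff (E m) (V0 T) (h1 (V T m)) ∧ IsHarmonicOff (E m) (V0 T) (h2 (V T m))
  compatible : ∀ m (u : V T m → ℝ),
    IsLeast {e | ∃ v : V T (m + 1) → ℝ, restr (V_subset_succ T m) v = u ∧ e = E (m + 1) v v}
      (E m u u)
  normalized : ∀ m, E m (h1 (V T m)) (h1 (V T m)) + E m (h2 (V T m)) (h2 (V T m)) =
    2 * volume.real (centerTriangle T)

/-- `E_m(u|_{V_m}, v|_{V_m})` for functions `u`, `v` on `V_*`. -/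
def level (T : Fin 3 → Disk) (E : (m : ℕ) → LinearMap.BilinForm ℝ (V T m → ℝ))
    (u v : VStar T → ℝ) (m : ℕ) : ℝ :=
  E m (restr (V_subset_VStar T m) u) (restr (V_subset_VStar T m) v)

lemma IsDiscreteForms.level_mono {T : Fin 3 → Disk}
    {E : (m : ℕ) → LinearMap.BilinForm ℝ (V T m → ℝ)} (hE : IsDiscreteForms T E)
    (u : VStar T → ℝ) : Monotone (level T E u u) :=
  monotone_nat_of_le_succ fun m => (hE.compatible m _).2 ⟨restr (V_subset_VStar T (m + 1)) u,
    rfl, rfl⟩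

/-- The space `F'_D`: functions `u` on `V_*` for which the (non-decreasing) sequence
`E_m(u|_{V_m}, u|_{V_m})` has a finite limit. -/
def limitDomain (T : Fin 3 → Disk) (E : (m : ℕ) → LinearMap.BilinForm ℝ (V T m → ℝ))
    (hE : IsDiscreteForms T E) : Submodule ℝ (VStar T → ℝ) where
  carrier := {u | ∃ l : ℝ, Tendsto (level T E u u) atTop (𝓝 l)}
  zero_mem' := by
    have h : level T E 0 0 = fun _ => 0 := by
      funext m
      simp only [level, map_zero]
    exact ⟨0, by rw [h]; exact tendsto_const_nhds⟩
  add_mem' := by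
    rintro u v ⟨a, ha⟩ ⟨b, hb⟩
    refine ⟨_, tendsto_atTop_ciSup (hE.level_mono (u + v)) ⟨2 * a + 2 * b, ?_⟩⟩
    rintro _ ⟨m, rfl⟩
    have hu := (hE.level_mono u).ge_of_tendsto ha m
    have hv := (hE.level_mono v).ge_of_tendsto hb m
    have huv := (hE.dirichlet m).nonneg
      (restr (V_subset_VStar T m) u - restr (V_subset_VStar T m) v)
    simp only [level] at hu hv ⊢
    simp only [map_sub, LinearMap.sub_apply] at huv
    simp only [map_add, LinearMap.add_apply]
    linarith
  smul_mem' := by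
    rintro c u ⟨a, ha⟩
    refine ⟨c * (c * a), ?_⟩
    have h : level T E (c • u) (c • u) = fun m => c * (c * level T E u u m) := by
      funext m
      simp [level]
    simp only [h]
    exact (ha.const_mul c).const_mul c

/-- The inductive-limit form `E'^D(u, v) = lim_m E_m(u|_{V_m}, v|_{V_m})`. -/
def limitForm (T : Fin 3 → Disk) (E : (m : ℕ) → LinearMap.BilinForm ℝ (V T m → ℝ))
    (u v : VStar T → ℝ) : ℝ :=
  limUnder atTop (level T E u v)

end Apollonian

end

noncomputable section

namespace Apollonian

variable {T : Fin 3 → Disk}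

/-! ### Tangential triples in coordinates -/

/-! The three points of tangency of a triple lie on the incircle of the triangle of centres, whose
radius is `inradius`. Call the disk it bounds the dual ball of the cell. The incircle meets the
boundaries of the three disks orthogonally. Dual balls of subcells are nested, and on one level two
of them share at most a vertex, so statements can be localized along the tree of cells.

Existence. Give side l of a cell the conductance `cond` = 1 / sin(2η), where 2η is the angle under
which the side is seen from the centre of its disk. By `flux_eq`, the current of a linear function
through a vertex depends only on the two disks touching there. A subcell that keeps a vertex keeps
these two disks, and at a new vertex the currents of the two subcells cancel. So affine functions
are harmonic, and refinement does not change the pairing of a piecewise affine function with any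
function (`IsPiecewiseAffine.levelForm_eq`). The properties of `discreteForm` follow.

Uniqueness. For an arbitrary admissible sequence, the flux of linear functions through a vertex of a
cell is inherited by the subcell keeping that vertex (`IsDiscreteForms.flux_concat`). Under
iteration the cells shrink to the vertex while the two disks stay, which forces the flux to be
parallel to their common tangent. The three fluxes of a cell add up to zero, so the conductances are
a multiple of the explicit ones, with the same factor for all cells. The normalization fixes the
factor.

Identification with the arc energy. In terms of the angle, the energy of an arc is the integral of
the squared derivative, so an increment d over a side costs at least d² / (2η). The sum of these
costs on one level is `arcSum`, and 1 / (2η) ≤ `cond` gives `arcSum` ≤ `levelForm`. Conversely, a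
bound for all `arcSum` bounds all `levelForm` (`levelForm_le_of_arcSum_le`): on a piecewise affine
function the two weights differ by at most a constant times the total area of the dual balls of the
level, and this area tends to zero by `sum_potential_Phi_le`. A function on the vertices with
bounded energies yields, by weak compactness, square integrable densities on the arcs with the right
increments; their primitives extend it without more energy (`exists_extension`). The vertices are
dense in the arcs, so the extension is unique, and the two forms agree (`tendsto_levelForm`). -/

/-- The real scalar product of two complex numbers. -/
def dot (z w : ℂ) : ℝ := z.re * w.re + z.im * w.im

/-- The oriented area of the parallelogram spanned by two complex numbers. -/
def cross (z w : ℂ) : ℝ := z.re * w.im - z.im * w.re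

lemma norm_sq_eq_dot (z : ℂ) : ‖z‖ ^ 2 = dot z z := by
  rw [← Complex.normSq_eq_norm_sq, Complex.normSq_apply, dot]

/-- Pairwise externally tangent disks whose centres are in counterclockwise order. -/
structure Tangential (T : Fin 3 → Disk) : Prop where
  dist_eq : ∀ j, ‖(T (j + 2)).center - (T (j + 1)).center‖ =
    (T (j + 1)).radius + (T (j + 2)).radius
  cross_pos : 0 < cross ((T 1).center - (T 0).center) ((T 2).center - (T 0).center)

/-- Half of the perimeter of the triangle of centres. -/
def semiperimeter (T : Fin 3 → Disk) : ℝ := (T 0).radius + (T 1).radius + (T 2).radius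

/-- The radius of the circle through the three points of tangency. -/
def inradius (T : Fin 3 → Disk) : ℝ :=
  √((T 0).radius * (T 1).radius * (T 2).radius / semiperimeter T)

/-- The centre of the circle through the three points of tangency. -/
def incenter (T : Fin 3 → Disk) : ℂ :=
  ((((T 1).radius + (T 2).radius : ℝ) : ℂ) * (T 0).center +
    (((T 2).radius + (T 0).radius : ℝ) : ℂ) * (T 1).center +
    (((T 0).radius + (T 1).radius : ℝ) : ℂ) * (T 2).center) / ((2 * semiperimeter T : ℝ) : ℂ)

/-- The unit vector from the centre of disk `j + 1` to the centre of disk `j + 2`. -/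
def dir (T : Fin 3 → Disk) (j : Fin 3) : ℂ :=
  ((T (j + 2)).center - (T (j + 1)).center) /
    (((T (j + 1)).radius + (T (j + 2)).radius : ℝ) : ℂ)

/-- The conductance between the two points of tangency lying on disk `l`. -/
def cond (T : Fin 3 → Disk) (l : Fin 3) : ℝ :=
  (inradius T ^ 2 + (T l).radius ^ 2) / (2 * inradius T * (T l).radius)

/-- The triple with the disks cyclically renumbered. -/
def rot (T : Fin 3 → Disk) : Fin 3 → Disk := fun j => T (j + 1)

/-! ### Triangles with side lengths x + y, x + z, y + z. -/

section triangle

variable {a b : ℂ} {x y z : ℝ}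

/-- Law of cosines; `a` and `b` issue from the centre of the disk of radius `x`. -/
lemma dot_eq_of_tangent (ha : ‖a‖ = x + y) (hb : ‖b‖ = x + z) (hab : ‖b - a‖ = y + z) :
    dot a b = x ^ 2 + x * y + x * z - y * z := by
  have h1 := norm_sq_eq_dot a
  have h2 := norm_sq_eq_dot b
  have h3 := norm_sq_eq_dot (b - a)
  rw [ha] at h1; rw [hb] at h2; rw [hab] at h3
  simp only [dot, Complex.sub_re, Complex.sub_im] at *
  linarith

/-- Heron's formula with semiperimeter x + y + z. -/
lemma cross_sq_of_tangent (ha : ‖a‖ = x + y) (hb : ‖b‖ = x + z) (hab : ‖b - a‖ = y + z) :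
    cross a b ^ 2 = 4 * (x * y * z) * (x + y + z) := by
  have h0 := dot_eq_of_tangent ha hb hab
  have h1 := norm_sq_eq_dot a
  have h2 := norm_sq_eq_dot b
  rw [ha] at h1; rw [hb] at h2
  have : cross a b ^ 2 = dot a a * dot b b - dot a b ^ 2 := by
    simp only [dot, cross]; ring
  rw [this, ← h1, ← h2, h0]; ring

/-- The part |a|² b − (a · b) a of `b` orthogonal to `a` is a multiple of `I * a`. This writes a
rotated side through unrotated ones and turns identities containing the square root `inradius` into
rational ones. -/
lemma cross_mul_I_of_tangent (ha : ‖a‖ = x + y) (hb : ‖b‖ = x + z) (hab : ‖b - a‖ = y + z) :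
    (cross a b : ℂ) * (Complex.I * a) =
      ((x + y) ^ 2 : ℝ) * b - ((x ^ 2 + x * y + x * z - y * z : ℝ) : ℂ) * a := by
  rw [← dot_eq_of_tangent ha hb hab, ← ha, norm_sq_eq_dot]
  apply Complex.ext <;> simp [dot, cross] <;> ring

end triangle

variable {T : Fin 3 → Disk}

/-! ### The incircle of the triangle of centres and cyclic symmetry. -/

lemma semiperimeter_pos (T : Fin 3 → Disk) : 0 < semiperimeter T := by
  have := (T 0).radius_pos; have := (T 1).radius_pos; have := (T 2).radius_pos
  unfold semiperimeter; positivity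

lemma inradius_sq (T : Fin 3 → Disk) :
    inradius T ^ 2 = (T 0).radius * (T 1).radius * (T 2).radius / semiperimeter T := by
  have := (T 0).radius_pos; have := (T 1).radius_pos; have := (T 2).radius_pos
  have := semiperimeter_pos T
  rw [inradius, Real.sq_sqrt (by positivity)]

lemma inradius_pos (T : Fin 3 → Disk) : 0 < inradius T := by
  have := (T 0).radius_pos; have := (T 1).radius_pos; have := (T 2).radius_pos
  have := semiperimeter_pos T
  exact Real.sqrt_pos.2 (by positivity)

lemma semiperimeter_rot (T : Fin 3 → Disk) : semiperimeter (rot T) = semiperimeter T := by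
  simp only [semiperimeter, rot, Fin.isValue, zero_add, Fin.reduceAdd]; ring

lemma inradius_rot (T : Fin 3 → Disk) : inradius (rot T) = inradius T := by
  rw [inradius, inradius, semiperimeter_rot]
  simp only [rot, Fin.isValue, zero_add, Fin.reduceAdd]
  congr 2; ring

lemma incenter_rot (T : Fin 3 → Disk) : incenter (rot T) = incenter T := by
  rw [incenter, incenter, semiperimeter_rot]
  simp only [rot, Fin.isValue, zero_add, Fin.reduceAdd]
  congr 1; ring

lemma dir_rot (T : Fin 3 → Disk) (j : Fin 3) : dir (rot T) j = dir T (j + 1) := by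
  simp only [dir, rot, add_right_comm j _ 1]

lemma q_rot (T : Fin 3 → Disk) (j : Fin 3) : q (rot T) j = q T (j + 1) := by
  simp only [q, rot, add_right_comm j _ 1]

lemma cond_rot (T : Fin 3 → Disk) (l : Fin 3) : cond (rot T) l = cond T (l + 1) := by
  simp only [cond, rot, inradius_rot]

lemma Tangential.rot (hT : Tangential T) : Tangential (rot T) := by
  refine ⟨fun j => ?_, ?_⟩
  · have := hT.dist_eq (j + 1)
    simpa only [Apollonian.rot, add_right_comm j _ 1] using this
  · have := hT.cross_pos
    simp only [Apollonian.rot, cross, Complex.sub_re, Complex.sub_im, Fin.isValue, zero_add,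
      Fin.reduceAdd] at *
    linarith

/-- By cyclic symmetry index 2 is enough; there the side joins disks 0 and 1, which matches the
triangle lemmas. -/
lemma forall_fin_three_of_rot {P : (Fin 3 → Disk) → Fin 3 → Prop}
    (hrot : ∀ T j, P (Apollonian.rot T) j → P T (j + 1))
    (h : ∀ T, Tangential T → P T 2) (hT : Tangential T) (j : Fin 3) : P T j := by
  have h0 : P T 0 := hrot T 2 (h _ hT.rot)
  fin_cases j
  · exact h0
  · exact hrot T 0 (hrot _ 2 (h _ hT.rot.rot))
  · exact h T hT

/-- Twice the area is twice the inradius times the semiperimeter. Both sides are positive, so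
Heron's formula for the squares suffices. -/
lemma Tangential.cross_eq (hT : Tangential T) :
    cross ((T 1).center - (T 0).center) ((T 2).center - (T 0).center) =
      2 * inradius T * semiperimeter T := by
  have h := cross_sq_of_tangent (a := (T 1).center - (T 0).center)
    (b := (T 2).center - (T 0).center) (hT.dist_eq 2)
    (x := (T 0).radius) (y := (T 1).radius) (z := (T 2).radius)
    (by rw [add_comm, norm_sub_rev]; exact hT.dist_eq 1)
    (by rw [sub_sub_sub_cancel_right]; exact hT.dist_eq 0)
  have hs := semiperimeter_pos T
  have hρ := inradius_pos T
  refine (pow_left_inj₀ hT.cross_pos.le (by positivity) two_ne_zero).1 ?_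
  rw [h, mul_pow, mul_pow, inradius_sq]
  field_simp
  rw [semiperimeter]; ring

lemma norm_dir (hT : Tangential T) (j : Fin 3) : ‖dir T j‖ = 1 := by
  have h1 := (T (j + 1)).radius_pos
  have h2 := (T (j + 2)).radius_pos
  rw [dir, norm_div, hT.dist_eq, Complex.norm_real, Real.norm_of_nonneg (by positivity)]
  exact div_self (by positivity)

lemma radius_add_ne_zero (T : Fin 3 → Disk) (j : Fin 3) :
    ((T (j + 1)).radius : ℂ) + ((T (j + 2)).radius : ℂ) ≠ 0 := by
  have h1 := (T (j + 1)).radius_pos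
  have h2 := (T (j + 2)).radius_pos
  exact_mod_cast (by positivity : (T (j + 1)).radius + (T (j + 2)).radius ≠ 0)

lemma center_succ (T : Fin 3 → Disk) (j : Fin 3) :
    (T (j + 1)).center = q T j - (T (j + 1)).radius * dir T j := by
  have h3 := radius_add_ne_zero T j
  rw [q, dir, AffineMap.lineMap_apply, Complex.real_smul, vsub_eq_sub, vadd_eq_add]
  push_cast
  field_simp
  ring

lemma center_succ_succ (T : Fin 3 → Disk) (j : Fin 3) :
    (T (j + 2)).center = q T j + (T (j + 2)).radius * dir T j := by
  have h3 := radius_add_ne_zero T j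
  rw [q, dir, AffineMap.lineMap_apply, Complex.real_smul, vsub_eq_sub, vadd_eq_add]
  push_cast
  field_simp
  ring

lemma center_sub_center (T : Fin 3 → Disk) (j : Fin 3) :
    (T (j + 2)).center - (T (j + 1)).center =
      (((T (j + 1)).radius + (T (j + 2)).radius : ℝ) : ℂ) * dir T j := by
  have h3 := radius_add_ne_zero T j
  rw [dir]
  push_cast
  field_simp

/-- Each point of tangency is the foot of the perpendicular from the incentre to a side, and the
orientation makes `I * dir` the inner normal. -/
lemma incenter_eq (hT : Tangential T) (j : Fin 3) :
    incenter T = q T j + inradius T * (Complex.I * dir T j) := by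
  refine forall_fin_three_of_rot
    (P := fun T j => incenter T = q T j + inradius T * (Complex.I * dir T j)) ?_ ?_ hT j
  · intro T j h
    rwa [incenter_rot, q_rot, inradius_rot, dir_rot] at h
  intro T hT
  have hc := hT.cross_eq
  have h := cross_mul_I_of_tangent (a := (T 1).center - (T 0).center)
    (b := (T 2).center - (T 0).center) (hT.dist_eq 2)
    (x := (T 0).radius) (y := (T 1).radius) (z := (T 2).radius)
    (by rw [add_comm, norm_sub_rev]; exact hT.dist_eq 1)
    (by rw [sub_sub_sub_cancel_right]; exact hT.dist_eq 0)
  rw [hc] at h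
  have hs : (semiperimeter T : ℂ) ≠ 0 := by exact_mod_cast (semiperimeter_pos T).ne'
  have h3 := radius_add_ne_zero T 2
  have h4 : (semiperimeter T : ℂ) = (T 0).radius + (T 1).radius + (T 2).radius := by
    simp [semiperimeter]
  have e : inradius T * (Complex.I * dir T 2) =
      ((((T 0).radius + (T 1).radius) ^ 2 : ℝ) * ((T 2).center - (T 0).center) -
        (((T 0).radius ^ 2 + (T 0).radius * (T 1).radius + (T 0).radius * (T 2).radius -
          (T 1).radius * (T 2).radius : ℝ) : ℂ) * ((T 1).center - (T 0).center)) /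
      (2 * semiperimeter T * ((T 0).radius + (T 1).radius)) := by
    rw [← h, dir]
    simp only [Fin.isValue, Fin.reduceAdd] at h3 ⊢
    push_cast
    field_simp
  rw [e, incenter, q, AffineMap.lineMap_apply, Complex.real_smul, vsub_eq_sub, vadd_eq_add]
  simp only [Fin.isValue, Fin.reduceAdd] at h3 ⊢
  push_cast
  field_simp
  rw [h4]
  ring

lemma inradius_sq_add_radius_sq (T : Fin 3 → Disk) (l : Fin 3) :
    inradius T ^ 2 + (T l).radius ^ 2 =
      (T l).radius * ((T l).radius + (T (l + 1)).radius) *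
        ((T l).radius + (T (l + 2)).radius) / semiperimeter T := by
  have hs := semiperimeter_pos T
  rw [inradius_sq, eq_div_iff hs.ne', add_mul, div_mul_cancel₀ _ hs.ne', semiperimeter]
  fin_cases l <;> simp <;> ring

/-- The denominator is the quantity of `cross_eq`; in this form `flux_eq` becomes a rational
identity. -/
lemma cond_eq (T : Fin 3 → Disk) (l : Fin 3) :
    cond T l = ((T l).radius + (T (l + 1)).radius) * ((T l).radius + (T (l + 2)).radius) /
      (2 * inradius T * semiperimeter T) := by
  have := (T l).radius_pos
  have := semiperimeter_pos T
  have := inradius_pos T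
  rw [cond, inradius_sq_add_radius_sq]
  field_simp

lemma cond_pos (T : Fin 3 → Disk) (l : Fin 3) : 0 < cond T l := by
  have := (T l).radius_pos
  have := inradius_pos T
  unfold cond; positivity

/-- The total current flowing out of a point of tangency depends only on the two disks that touch
there. -/
lemma flux_eq (hT : Tangential T) (j : Fin 3) :
    (cond T (j + 1) : ℂ) * (q T (j + 2) - q T j) + cond T (j + 2) * (q T (j + 1) - q T j) =
      Complex.I * ((T (j + 2)).center - (T (j + 1)).center) := by
  refine forall_fin_three_of_rot
    (P := fun T j => (cond T (j + 1) : ℂ) * (q T (j + 2) - q T j) +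
      cond T (j + 2) * (q T (j + 1) - q T j) =
      Complex.I * ((T (j + 2)).center - (T (j + 1)).center)) ?_ ?_ hT j
  · intro T j h
    simpa only [cond_rot, q_rot, Apollonian.rot, add_right_comm j _ 1] using h
  intro T hT
  have hc := hT.cross_eq
  have h := cross_mul_I_of_tangent (a := (T 1).center - (T 0).center)
    (b := (T 2).center - (T 0).center) (hT.dist_eq 2)
    (x := (T 0).radius) (y := (T 1).radius) (z := (T 2).radius)
    (by rw [add_comm, norm_sub_rev]; exact hT.dist_eq 1)
    (by rw [sub_sub_sub_cancel_right]; exact hT.dist_eq 0)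
  rw [hc] at h
  have hs : (semiperimeter T : ℂ) ≠ 0 := by exact_mod_cast (semiperimeter_pos T).ne'
  have hρ : (inradius T : ℂ) ≠ 0 := by exact_mod_cast (inradius_pos T).ne'
  have h0 := radius_add_ne_zero T 0
  have h1 := radius_add_ne_zero T 1
  have h2 := radius_add_ne_zero T 2
  rw [cond_eq, cond_eq, q, q, q, AffineMap.lineMap_apply, AffineMap.lineMap_apply,
    AffineMap.lineMap_apply]
  simp only [Complex.real_smul, vsub_eq_sub, vadd_eq_add]
  -- The rotated side through the unrotated sides at centre 0; the rest is rational in radii and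
  -- centres.
  have e : Complex.I * ((T 1).center - (T 0).center) =
      ((((T 0).radius + (T 1).radius) ^ 2 : ℝ) * ((T 2).center - (T 0).center) -
        (((T 0).radius ^ 2 + (T 0).radius * (T 1).radius + (T 0).radius * (T 2).radius -
          (T 1).radius * (T 2).radius : ℝ) : ℂ) * ((T 1).center - (T 0).center)) /
      (2 * inradius T * semiperimeter T) := by
    rw [← h]
    push_cast
    field_simp
  simp only [Fin.isValue, Fin.reduceAdd] at h0 h1 h2 ⊢
  rw [e]
  push_cast
  rw [add_comm ((T 0).radius : ℂ) ((T 2).radius : ℂ)] at *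
  field_simp
  ring

/-! ### Index arithmetic modulo three. -/

lemma fin_three_two_one (l : Fin 3) : l + 2 + 1 = l := by decide +revert

lemma fin_three_one_two (l : Fin 3) : l + 1 + 2 = l := by decide +revert

lemma fin_three_one_one (l : Fin 3) : l + 1 + 1 = l + 2 := by decide +revert

lemma fin_three_two_two (l : Fin 3) : l + 2 + 2 = l + 1 := by decide +revert

lemma fin_three_ne_one (l : Fin 3) : l ≠ l + 1 := by decide +revert

lemma fin_three_ne_two (l : Fin 3) : l ≠ l + 2 := by decide +revert

lemma fin_three_one_ne_two (l : Fin 3) : l + 1 ≠ l + 2 := by decide +revert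

lemma fin_three_cases (l j : Fin 3) : j = l + 1 ∨ j = l + 2 ∨ j = l := by decide +revert

lemma fin_three_cases_of_ne {l j : Fin 3} (h : j ≠ l) : j = l + 1 ∨ j = l + 2 := by
  decide +revert

variable {T : Fin 3 → Disk}

/-! ### Balls through a common point -/

section balls

variable {x p d n : ℂ} {r s : ℝ}

lemma dot_self_nonneg (z : ℂ) : 0 ≤ dot z z := by rw [← norm_sq_eq_dot]; positivity

lemma eq_of_dot_sub_self_nonpos (h : dot (x - p) (x - p) ≤ 0) : x = p := by
  rw [← norm_sq_eq_dot] at h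
  have : ‖x - p‖ = 0 := by nlinarith [norm_nonneg (x - p)]
  rwa [norm_eq_zero, sub_eq_zero] at this

lemma dot_neg_right (z w : ℂ) : dot z (-w) = -dot z w := by simp [dot]; ring

lemma norm_sub_add_mul_sq (hd : ‖d‖ = 1) :
    ‖x - (p + r * d)‖ ^ 2 = dot (x - p) (x - p) - 2 * r * dot (x - p) d + r ^ 2 := by
  have h := norm_sq_eq_dot d
  rw [hd] at h
  rw [norm_sq_eq_dot]
  simp only [dot, Complex.sub_re, Complex.sub_im, Complex.add_re, Complex.add_im,
    Complex.re_ofReal_mul, Complex.im_ofReal_mul] at *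
  linear_combination (-r ^ 2) * h

/-- For balls through `p` with inner unit normal `d`, the radius enters only as the factor `2 * r`.
External tangency compares `d` with `-d`, and internal tangency compares two radii. -/
lemma mem_closedBall_iff_dot (hd : ‖d‖ = 1) (hr : 0 < r) :
    x ∈ Metric.closedBall (p + r * d) r ↔ dot (x - p) (x - p) ≤ 2 * r * dot (x - p) d := by
  rw [mem_closedBall_iff_norm, ← pow_le_pow_iff_left₀ (norm_nonneg _) hr.le two_ne_zero,
    norm_sub_add_mul_sq hd]
  constructor <;> intro h <;> linarith

lemma mem_ball_iff_dot (hd : ‖d‖ = 1) (hr : 0 < r) :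
    x ∈ Metric.ball (p + r * d) r ↔ dot (x - p) (x - p) < 2 * r * dot (x - p) d := by
  rw [mem_ball_iff_norm, ← pow_lt_pow_iff_left₀ (norm_nonneg _) hr.le two_ne_zero,
    norm_sub_add_mul_sq hd]
  constructor <;> intro h <;> linarith

lemma mem_sphere_iff_dot (hd : ‖d‖ = 1) (hr : 0 < r) :
    x ∈ Metric.sphere (p + r * d) r ↔ dot (x - p) (x - p) = 2 * r * dot (x - p) d := by
  rw [mem_sphere_iff_norm, ← pow_left_inj₀ (norm_nonneg _) hr.le two_ne_zero,
    norm_sub_add_mul_sq hd]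
  constructor <;> intro h <;> linarith

/-- Externally tangent closed balls meet in the point of tangency only. -/
lemma eq_of_mem_closedBall_of_mem_closedBall (hd : ‖d‖ = 1) (hr : 0 < r) (hs : 0 < s)
    (h1 : x ∈ Metric.closedBall (p + r * -d) r) (h2 : x ∈ Metric.closedBall (p + s * d) s) :
    x = p := by
  rw [mem_closedBall_iff_dot (by rwa [norm_neg]) hr, dot_neg_right] at h1
  rw [mem_closedBall_iff_dot hd hs] at h2
  apply eq_of_dot_sub_self_nonpos
  by_contra! h
  rcases le_total (dot (x - p) d) 0 with h0 | h0 <;> nlinarith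

/-- An internally tangent closed ball lies, except for the point of tangency, in the larger ball. -/
lemma mem_ball_or_eq_of_mem_closedBall (hd : ‖d‖ = 1) (hr : 0 < r) (hrs : r < s)
    (h : x ∈ Metric.closedBall (p + r * d) r) : x ∈ Metric.ball (p + s * d) s ∨ x = p := by
  rw [mem_closedBall_iff_dot hd hr] at h
  rw [mem_ball_iff_dot hd (hr.trans hrs)]
  by_cases hx : dot (x - p) (x - p) ≤ 0
  · exact Or.inr (eq_of_dot_sub_self_nonpos hx)
  · left
    push Not at hx
    have : 0 < dot (x - p) d := by
      by_contra! h0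
      nlinarith
    nlinarith

end balls

/-! ### Positions of the points of a tangential triple -/

lemma center_left (T : Fin 3 → Disk) (l : Fin 3) :
    (T l).center = q T (l + 2) + (T l).radius * -dir T (l + 2) := by
  have := center_succ T (l + 2)
  rw [fin_three_two_one l] at this
  rw [this]; ring

lemma center_right (T : Fin 3 → Disk) (l : Fin 3) :
    (T l).center = q T (l + 1) + (T l).radius * dir T (l + 1) := by
  have := center_succ_succ T (l + 1)
  rwa [fin_three_one_two l] at this

lemma norm_I_mul_dir (hT : Tangential T) (j : Fin 3) : ‖Complex.I * dir T j‖ = 1 := by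
  simp [norm_dir hT]

lemma norm_q_sub_incenter (hT : Tangential T) (j : Fin 3) : ‖q T j - incenter T‖ = inradius T := by
  rw [incenter_eq hT j, sub_add_cancel_left, norm_neg, norm_mul, norm_I_mul_dir hT,
    Complex.norm_real, Real.norm_of_nonneg (inradius_pos T).le, mul_one]

/-- Pythagoras: the circle through the points of tangency is orthogonal to the boundary of each
disk. -/
lemma norm_incenter_sub_center_sq (hT : Tangential T) (l : Fin 3) :
    ‖incenter T - (T l).center‖ ^ 2 = (T l).radius ^ 2 + inradius T ^ 2 := by
  have h := norm_sq_eq_dot (dir T (l + 1))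
  rw [norm_dir hT] at h
  rw [incenter_eq hT (l + 1), center_right, norm_sq_eq_dot]
  simp only [dot] at *
  simp
  linear_combination (-(T l).radius ^ 2 - inradius T ^ 2) * h

lemma norm_q_sub_center_left (hT : Tangential T) (l : Fin 3) :
    ‖q T (l + 2) - (T l).center‖ = (T l).radius := by
  rw [center_left, sub_add_cancel_left, norm_neg, norm_mul, norm_neg, norm_dir hT,
    Complex.norm_real, Real.norm_of_nonneg (T l).radius_pos.le, mul_one]

lemma norm_q_sub_center_right (hT : Tangential T) (l : Fin 3) :
    ‖q T (l + 1) - (T l).center‖ = (T l).radius := by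
  rw [center_right, sub_add_cancel_left, norm_neg, norm_mul, norm_dir hT,
    Complex.norm_real, Real.norm_of_nonneg (T l).radius_pos.le, mul_one]

/-- If the points coincided, the two expressions for the centre would make the two unit vectors
opposite, and the two expressions for the incentre would make them equal. -/
lemma q_ne (hT : Tangential T) (l : Fin 3) : q T (l + 2) ≠ q T (l + 1) := by
  intro h
  have h1 := center_left T l
  rw [center_right, h, add_right_inj] at h1
  have hr : ((T l).radius : ℂ) ≠ 0 := by exact_mod_cast (T l).radius_pos.ne'
  have h2 := mul_left_cancel₀ hr h1
  have h3 := incenter_eq hT (l + 2)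
  rw [incenter_eq hT (l + 1), h, add_right_inj] at h3
  have hρ : (inradius T : ℂ) ≠ 0 := by exact_mod_cast (inradius_pos T).ne'
  have h4 := mul_left_cancel₀ Complex.I_ne_zero (mul_left_cancel₀ hρ h3)
  have h5 : dir T (l + 2) = 0 := by
    rw [h2] at h4
    linear_combination (-1 / 2 : ℂ) * h4
  have := norm_dir hT (l + 2)
  rw [h5] at this
  simp at this

lemma q_injective (hT : Tangential T) : Function.Injective (q T) := by
  have h0 := q_ne hT 0
  have h1 := q_ne hT 1
  have h2 := q_ne hT 2
  intro i j hij
  fin_cases i <;> fin_cases j <;> simp_all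

lemma eq_q_of_mem_closedBall (hT : Tangential T) {j : Fin 3} {x : ℂ}
    (h1 : x ∈ Metric.closedBall (T (j + 1)).center (T (j + 1)).radius)
    (h2 : x ∈ Metric.closedBall (T (j + 2)).center (T (j + 2)).radius) : x = q T j := by
  have e1 := center_left T (j + 1)
  have e2 := center_right T (j + 2)
  rw [fin_three_one_two j] at e1
  rw [fin_three_two_one j] at e2
  rw [e1] at h1
  rw [e2] at h2
  exact eq_of_mem_closedBall_of_mem_closedBall (norm_dir hT j) (T _).radius_pos (T _).radius_pos
    h1 h2

lemma eq_q_of_mem_of_mem (hT : Tangential T) {j k : Fin 3} {x : ℂ} (hjk : j ≠ k)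
    (h1 : x ∈ Metric.closedBall (T j).center (T j).radius)
    (h2 : x ∈ Metric.closedBall (T k).center (T k).radius) :
    ∃ l, l ≠ j ∧ l ≠ k ∧ x = q T l := by
  obtain rfl | rfl := fin_three_cases_of_ne hjk.symm
  · refine ⟨j + 2, (fin_three_ne_two j).symm, (fin_three_one_ne_two j).symm, ?_⟩
    apply eq_q_of_mem_closedBall hT
    · rwa [fin_three_two_one j]
    · rwa [fin_three_two_two j]
  · refine ⟨j + 1, (fin_three_ne_one j).symm, fin_three_one_ne_two j, ?_⟩
    apply eq_q_of_mem_closedBall hT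
    · rwa [fin_three_one_one j]
    · rwa [fin_three_one_two j]

lemma q_mem_sphere_iff (hT : Tangential T) {j l : Fin 3} :
    q T j ∈ Metric.sphere (T l).center (T l).radius ↔ j ≠ l := by
  rw [mem_sphere_iff_norm]
  obtain rfl | rfl | rfl := fin_three_cases l j
  · exact iff_of_true (norm_q_sub_center_right hT l) (fin_three_ne_one l).symm
  · exact iff_of_true (norm_q_sub_center_left hT l) (fin_three_ne_two l).symm
  · refine iff_of_false (fun h => ?_) (by simp)
    have h1 := norm_q_sub_center_left hT (j + 1)
    rw [fin_three_one_two j] at h1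
    obtain ⟨i, hi, -, h2⟩ := eq_q_of_mem_of_mem hT (j := j) (k := j + 1) (x := q T j)
      (fin_three_ne_one j) (mem_closedBall_iff_norm.2 h.le) (mem_closedBall_iff_norm.2 h1.le)
    exact hi (q_injective hT h2).symm

lemma q_notMem_closedBall (hT : Tangential T) (j : Fin 3) :
    q T j ∉ Metric.closedBall (T j).center (T j).radius := by
  intro h
  have h1 := norm_q_sub_center_left hT (j + 1)
  rw [fin_three_one_two j] at h1
  obtain ⟨i, hi, -, h2⟩ := eq_q_of_mem_of_mem hT (j := j) (k := j + 1) (x := q T j)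
    (fin_three_ne_one j) h (mem_closedBall_iff_norm.2 h1.le)
  exact hi (q_injective hT h2).symm

/-! ### The inner Soddy disk -/

lemma dot_center_self (hT : Tangential T) (l : Fin 3) :
    dot ((T l).center - incenter T) ((T l).center - incenter T) =
      (T l).radius ^ 2 + inradius T ^ 2 := by
  rw [← norm_sq_eq_dot, norm_sub_rev, norm_incenter_sub_center_sq hT]

lemma dot_comm (z w : ℂ) : dot z w = dot w z := by simp only [dot]; ring

lemma dot_center_succ (hT : Tangential T) (j : Fin 3) :
    dot ((T (j + 2)).center - incenter T) ((T (j + 1)).center - incenter T) =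
      inradius T ^ 2 - (T (j + 1)).radius * (T (j + 2)).radius := by
  have h1 := dot_center_self hT (j + 1)
  have h2 := dot_center_self hT (j + 2)
  have h3 := norm_sq_eq_dot ((T (j + 2)).center - (T (j + 1)).center)
  rw [hT.dist_eq j] at h3
  simp only [dot, Complex.sub_re, Complex.sub_im] at *
  linarith

/-- The sum of the curvatures of the disks. -/
def curvSum (T : Fin 3 → Disk) : ℝ := 1 / (T 0).radius + 1 / (T 1).radius + 1 / (T 2).radius

lemma curvSum_pos (T : Fin 3 → Disk) : 0 < curvSum T := by
  have := (T 0).radius_pos; have := (T 1).radius_pos; have := (T 2).radius_pos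
  unfold curvSum; positivity

/-- The disk touching the three disks from inside the gap between them. -/
def soddy (T : Fin 3 → Disk) : Disk where
  center := ((1 / (curvSum T + 2 / inradius T) : ℝ) : ℂ) *
    (((2 / inradius T : ℝ) : ℂ) * incenter T + ((1 / (T 0).radius : ℝ) : ℂ) * (T 0).center +
      ((1 / (T 1).radius : ℝ) : ℂ) * (T 1).center + ((1 / (T 2).radius : ℝ) : ℂ) * (T 2).center)
  radius := 1 / (curvSum T + 2 / inradius T)
  radius_pos := by
    have := curvSum_pos T
    have := inradius_pos T
    positivity

/-- Descartes' circle theorem: the root of the sum of the pairwise products of the curvatures is 1 /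
`inradius`, by `one_div_inradius_sq`. -/
lemma one_div_soddy_radius (T : Fin 3 → Disk) :
    1 / (soddy T).radius = curvSum T + 2 / inradius T := by
  simp [soddy]

/-- The weights in the definition of the centre add up to one, so with the incentre as origin its
own term drops out. -/
lemma soddy_center_sub (T : Fin 3 → Disk) : (soddy T).center - incenter T =
    ((soddy T).radius : ℂ) * (((1 / (T 0).radius : ℝ) : ℂ) * ((T 0).center - incenter T) +
      ((1 / (T 1).radius : ℝ) : ℂ) * ((T 1).center - incenter T) +
      ((1 / (T 2).radius : ℝ) : ℂ) * ((T 2).center - incenter T)) := by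
  have h : ((soddy T).radius : ℂ) * (((1 / (T 0).radius : ℝ) : ℂ) + ((1 / (T 1).radius : ℝ) : ℂ) +
      ((1 / (T 2).radius : ℝ) : ℂ) + ((2 / inradius T : ℝ) : ℂ)) = 1 := by
    have h1 : (soddy T).radius * (curvSum T + 2 / inradius T) = 1 := by
      rw [← one_div_soddy_radius, mul_one_div_cancel (soddy T).radius_pos.ne']
    rw [curvSum] at h1
    exact_mod_cast h1
  rw [show (soddy T).center = ((soddy T).radius : ℂ) * (((2 / inradius T : ℝ) : ℂ) * incenter T +
    ((1 / (T 0).radius : ℝ) : ℂ) * (T 0).center + ((1 / (T 1).radius : ℝ) : ℂ) * (T 1).center +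
    ((1 / (T 2).radius : ℝ) : ℂ) * (T 2).center) from rfl]
  linear_combination incenter T * h

/-- Bilinearity and the Gram matrix of the centres seen from the incentre (`dot_center_self`,
`dot_center_succ`). -/
lemma dot_soddy_center (hT : Tangential T) (k : Fin 3) :
    dot ((soddy T).center - incenter T) ((T k).center - incenter T) =
      (soddy T).radius * (inradius T ^ 2 * curvSum T - (T k).radius) := by
  have r0 := (T 0).radius_pos
  have r1 := (T 1).radius_pos
  have r2 := (T 2).radius_pos
  have e (x y z R : ℝ) (a b c d : ℂ) : dot (R * (x * a + y * b + z * c)) d =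
      R * (x * dot a d + y * dot b d + z * dot c d) := by
    simp only [dot, Complex.re_ofReal_mul, Complex.im_ofReal_mul, Complex.add_re, Complex.add_im]
    ring
  have h0 := dot_center_succ hT 0
  have h1 := dot_center_succ hT 1
  have h2 := dot_center_succ hT 2
  have d0 := dot_center_self hT 0
  have d1 := dot_center_self hT 1
  have d2 := dot_center_self hT 2
  simp only [Fin.isValue, Fin.reduceAdd, zero_add] at h0 h1 h2
  rw [soddy_center_sub, e, curvSum]
  fin_cases k
  · simp only [Fin.zero_eta]
    rw [d0, h2, dot_comm, h1]; field_simp; ring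
  · simp only [Fin.mk_one]
    rw [d1, h0, dot_comm, h2]; field_simp; ring
  · simp only [Fin.reduceFinMk]
    rw [d2, h1, dot_comm, h0]; field_simp; ring

lemma dot_soddy_center_self (hT : Tangential T) :
    dot ((soddy T).center - incenter T) ((soddy T).center - incenter T) =
      (soddy T).radius ^ 2 * (inradius T ^ 2 * curvSum T ^ 2 - 3) := by
  have r0 := (T 0).radius_pos
  have r1 := (T 1).radius_pos
  have r2 := (T 2).radius_pos
  have e (x y z R : ℝ) (a b c d : ℂ) : dot d (R * (x * a + y * b + z * c)) =
      R * (x * dot d a + y * dot d b + z * dot d c) := by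
    simp only [dot, Complex.re_ofReal_mul, Complex.im_ofReal_mul, Complex.add_re, Complex.add_im]
    ring
  nth_rw 2 [soddy_center_sub]
  rw [e, dot_soddy_center hT, dot_soddy_center hT, dot_soddy_center hT, curvSum]
  field_simp
  ring

lemma soddy_radius_mul (T : Fin 3 → Disk) :
    (soddy T).radius * (inradius T * curvSum T + 2) = inradius T := by
  have := curvSum_pos T
  have := inradius_pos T
  simp only [soddy]
  field_simp

/-- After expansion into inner products, the defect is a multiple of the relation `soddy_radius_mul`
that fixes the radius. -/
lemma norm_soddy_center_sub (hT : Tangential T) (k : Fin 3) :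
    ‖(soddy T).center - (T k).center‖ = (soddy T).radius + (T k).radius := by
  have h1 := (soddy T).radius_pos
  have h2 := (T k).radius_pos
  refine (pow_left_inj₀ (norm_nonneg _) (by positivity) two_ne_zero).1 ?_
  rw [norm_sq_eq_dot]
  have a1 := dot_soddy_center_self hT
  have a2 := dot_soddy_center hT k
  have a3 := dot_center_self hT k
  have a4 := soddy_radius_mul T
  have : dot ((soddy T).center - (T k).center) ((soddy T).center - (T k).center) =
      (soddy T).radius ^ 2 * (inradius T ^ 2 * curvSum T ^ 2 - 3) -
      2 * ((soddy T).radius * (inradius T ^ 2 * curvSum T - (T k).radius)) +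
      ((T k).radius ^ 2 + inradius T ^ 2) := by
    rw [← a1, ← a2, ← a3]
    simp only [dot, Complex.sub_re, Complex.sub_im]
    ring
  rw [this]
  linear_combination (inradius T * curvSum T * (soddy T).radius - inradius T -
    2 * (soddy T).radius) * a4

/-- Barycentric coordinates of the centre of the Soddy disk. -/
def soddyWeight (T : Fin 3 → Disk) (j : Fin 3) : ℝ :=
  (soddy T).radius * (((T (j + 1)).radius + (T (j + 2)).radius) / (inradius T * semiperimeter T) +
    1 / (T j).radius)

lemma soddyWeight_pos (T : Fin 3 → Disk) (j : Fin 3) : 0 < soddyWeight T j := by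
  have := (T j).radius_pos; have := (T (j + 1)).radius_pos; have := (T (j + 2)).radius_pos
  have := (soddy T).radius_pos
  have := inradius_pos T
  have := semiperimeter_pos T
  unfold soddyWeight; positivity

lemma sum_soddyWeight (T : Fin 3 → Disk) :
    soddyWeight T 0 + soddyWeight T 1 + soddyWeight T 2 = 1 := by
  have h1 := soddy_radius_mul T
  have h2 := inradius_pos T
  have r0 := (T 0).radius_pos
  have r1 := (T 1).radius_pos
  have r2 := (T 2).radius_pos
  have hs := semiperimeter_pos T
  have : soddyWeight T 0 + soddyWeight T 1 + soddyWeight T 2 =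
      (soddy T).radius * (inradius T * curvSum T + 2) / inradius T := by
    simp only [soddyWeight, curvSum, Fin.isValue, zero_add, Fin.reduceAdd]
    rw [semiperimeter] at *
    field_simp
    ring
  rw [this, h1, div_self h2.ne']

/-- Obtained from the barycentric form of the incentre. As the weights are positive, the centre lies
inside the triangle of centres. -/
lemma soddy_center_eq (T : Fin 3 → Disk) : (soddy T).center =
    soddyWeight T 0 * (T 0).center + soddyWeight T 1 * (T 1).center +
      soddyWeight T 2 * (T 2).center := by
  have h2 : (inradius T : ℂ) ≠ 0 := by exact_mod_cast (inradius_pos T).ne'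
  have hs : (semiperimeter T : ℂ) ≠ 0 := by exact_mod_cast (semiperimeter_pos T).ne'
  rw [show (soddy T).center = ((soddy T).radius : ℂ) * (((2 / inradius T : ℝ) : ℂ) * incenter T +
    ((1 / (T 0).radius : ℝ) : ℂ) * (T 0).center + ((1 / (T 1).radius : ℝ) : ℂ) * (T 1).center +
    ((1 / (T 2).radius : ℝ) : ℂ) * (T 2).center) from rfl]
  simp only [soddyWeight, incenter, Fin.isValue, zero_add, Fin.reduceAdd]
  push_cast
  field_simp
  ring

/-- Replacing a vertex by a point multiplies the oriented area by the corresponding barycentric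
coordinate; positive coordinates therefore keep the orientation. -/
lemma cross_barycentric (a b c : ℂ) {u v w : ℝ} (h : u + v + w = 1) :
    cross (b - (u * a + v * b + w * c)) (c - (u * a + v * b + w * c)) =
        u * cross (b - a) (c - a) ∧
      cross (u * a + v * b + w * c - a) (c - a) = v * cross (b - a) (c - a) ∧
      cross (b - a) (u * a + v * b + w * c - a) = w * cross (b - a) (c - a) := by
  obtain rfl : u = 1 - v - w := by linarith
  simp only [cross, Complex.sub_re, Complex.sub_im, Complex.add_re, Complex.add_im,
    Complex.re_ofReal_mul, Complex.im_ofReal_mul]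
  refine ⟨?_, ?_, ?_⟩ <;> ring

lemma Tangential.update_soddy (hT : Tangential T) (k : Fin 3) :
    Tangential (Function.update T k (soddy T)) := by
  have hc := hT.cross_pos
  have hw := cross_barycentric (T 0).center (T 1).center (T 2).center (sum_soddyWeight T)
  rw [← soddy_center_eq] at hw
  have w := soddyWeight_pos T
  have n := norm_soddy_center_sub hT
  have d0 := hT.dist_eq 0
  have d1 := hT.dist_eq 1
  have d2 := hT.dist_eq 2
  simp only [Fin.isValue, zero_add, Fin.reduceAdd] at d0 d1 d2
  refine ⟨fun j => ?_, ?_⟩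
  · fin_cases k <;> fin_cases j <;>
      simp [n, d0, d1, d2, norm_sub_rev _ (soddy T).center, add_comm]
  · fin_cases k
    · simpa [hw.1] using mul_pos (w 0) hc
    · simpa [hw.2.1] using mul_pos (w 1) hc
    · simpa [hw.2.2] using mul_pos (w 2) hc

/-! ### Recognizing tangency -/

lemma Disk.closure_toSet (D : Disk) : closure D.toSet = Metric.closedBall D.center D.radius :=
  closure_ball _ D.radius_pos.ne'

lemma Disk.frontier_toSet (D : Disk) : frontier D.toSet = Metric.sphere D.center D.radius :=
  frontier_ball _ D.radius_pos.ne'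

/-- If the centres are too close, the balls share a nonempty open set, and `ncard` of an infinite
set is zero; if they are too far apart, the intersection is empty. -/
lemma norm_center_sub_of_ncard {D D' : Disk} (h : (closure D.toSet ∩ closure D'.toSet).ncard = 1) :
    ‖D'.center - D.center‖ = D.radius + D'.radius := by
  rw [Disk.closure_toSet, Disk.closure_toSet] at h
  rw [← dist_eq_norm, dist_comm]
  rcases lt_trichotomy (dist D.center D'.center) (D.radius + D'.radius) with h1 | h1 | h1
  · exfalso
    obtain ⟨y, hy1, hy2⟩ := exists_dist_lt_lt D.radius_pos D'.radius_pos (by linarith)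
    have hinf : (Metric.closedBall D.center D.radius ∩
        Metric.closedBall D'.center D'.radius).Infinite := by
      refine infinite_of_mem_nhds y (inter_mem ?_ ?_)
      · exact Metric.closedBall_mem_nhds_of_mem (by rwa [Metric.mem_ball, dist_comm])
      · exact Metric.closedBall_mem_nhds_of_mem (by rwa [Metric.mem_ball])
    rw [hinf.ncard] at h
    exact zero_ne_one h
  · exact h1
  · exfalso
    rw [(Metric.closedBall_disjoint_closedBall h1).inter_eq, Set.ncard_empty] at h
    exact zero_ne_one h

lemma ncard_inter_eq_one (hT : Tangential T) {j k : Fin 3} (hjk : j ≠ k) :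
    (closure (T j).toSet ∩ closure (T k).toSet).ncard = 1 := by
  rw [Disk.closure_toSet, Disk.closure_toSet, Set.ncard_eq_one]
  obtain ⟨l, hlj, hlk⟩ : ∃ l, l ≠ j ∧ l ≠ k := by decide +revert
  refine ⟨q T l, Set.eq_singleton_iff_unique_mem.2 ⟨⟨?_, ?_⟩, ?_⟩⟩
  · exact Metric.sphere_subset_closedBall ((q_mem_sphere_iff hT).2 hlj)
  · exact Metric.sphere_subset_closedBall ((q_mem_sphere_iff hT).2 hlk)
  · rintro x ⟨h1, h2⟩
    obtain ⟨i, hij, hik, rfl⟩ := eq_q_of_mem_of_mem hT hjk h1 h2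
    congr 1
    clear h1 h2
    decide +revert

lemma cross_q_eq (a b c : ℂ) (s t u : ℝ) :
    cross ((c + t * (a - c)) - (b + s * (c - b))) ((a + u * (b - a)) - (b + s * (c - b))) =
      (s * t * u + (1 - s) * (1 - t) * (1 - u)) * cross (b - a) (c - a) := by
  simp only [cross, Complex.sub_re, Complex.sub_im, Complex.add_re, Complex.add_im,
    Complex.re_ofReal_mul, Complex.im_ofReal_mul]
  ring

/-- The factor in `cross_q_eq` is a sum of products of ratios between 0 and 1, so the points of
tangency are oriented like the centres. -/
lemma exists_cross_q_eq (T : Fin 3 → Disk) : ∃ t : ℝ, 0 < t ∧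
    cross (q T 1 - q T 0) (q T 2 - q T 0) =
      t * cross ((T 1).center - (T 0).center) ((T 2).center - (T 0).center) := by
  have r0 := (T 0).radius_pos
  have r1 := (T 1).radius_pos
  have r2 := (T 2).radius_pos
  rw [q, q, q]
  simp only [AffineMap.lineMap_apply, Complex.real_smul, vsub_eq_sub, vadd_eq_add, Fin.isValue,
    zero_add, Fin.reduceAdd]
  rw [add_comm _ (T 1).center, add_comm _ (T 2).center, add_comm _ (T 0).center, cross_q_eq]
  refine ⟨_, ?_, rfl⟩
  have e1 : 1 - (T 1).radius / ((T 1).radius + (T 2).radius) =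
      (T 2).radius / ((T 1).radius + (T 2).radius) := by field_simp; ring
  have e2 : 1 - (T 2).radius / ((T 2).radius + (T 0).radius) =
      (T 0).radius / ((T 2).radius + (T 0).radius) := by field_simp; ring
  have e3 : 1 - (T 0).radius / ((T 0).radius + (T 1).radius) =
      (T 1).radius / ((T 0).radius + (T 1).radius) := by field_simp; ring
  rw [e1, e2, e3]
  positivity

lemma IsTDT.tangential (hT : IsTDT T) : Tangential T := by
  refine ⟨fun j => norm_center_sub_of_ncard (hT.tangent _ _ (fin_three_one_ne_two j)), ?_⟩
  have h := hT.oriented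
  have e (z w : ℂ) : ((starRingEnd ℂ) z * w).im = cross z w := by
    simp [cross]; ring
  obtain ⟨t, ht, h'⟩ := exists_cross_q_eq T
  rw [e, h'] at h
  exact pos_of_mul_pos_right h ht.le

lemma Tangential.cross_q_ne_zero (hT : Tangential T) :
    cross (q T 1 - q T 0) (q T 2 - q T 0) ≠ 0 := by
  obtain ⟨t, ht, h⟩ := exists_cross_q_eq T
  rw [h]
  exact (mul_pos ht hT.cross_pos).ne'

/-! ### The ideal triangle -/

/-- Three vectors of equal length with a positive linear relation span three cones that cover the
plane. -/
lemma exists_mem_cone {g : Fin 3 → ℂ} {c : Fin 3 → ℝ} {R : ℝ} {x : ℂ} (hR : 0 < R)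
    (hg : ∀ j, ‖g j‖ = R) (hc : ∀ j, 0 < c j) (hsum : ∑ j, (c j : ℂ) * g j = 0)
    (hcross : cross (g 0) (g 1) ≠ 0) (hx : ‖x‖ = R) :
    ∃ (l : Fin 3) (a b : ℝ), 0 ≤ a ∧ 0 ≤ b ∧ 1 ≤ a + b ∧ x = a * g (l + 1) + b * g (l + 2) := by
  set y : Fin 3 → ℝ := ![cross x (g 1) / cross (g 0) (g 1), cross (g 0) x / cross (g 0) (g 1), 0]
  have hy : ∑ j, (y j : ℂ) * g j = x := by
    rw [Fin.sum_univ_three]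
    simp only [y, Matrix.cons_val]
    apply Complex.ext <;>
    · simp only [Complex.add_re, Complex.add_im, Complex.re_ofReal_mul, Complex.im_ofReal_mul]
      field_simp
      simp only [cross]
      ring
  -- Subtracting the multiple of the relation `c` with the smallest quotient makes one coefficient
  -- vanish and keeps the others nonnegative.
  obtain ⟨l, hl⟩ := Finite.exists_min fun j => y j / c j
  set z : Fin 3 → ℝ := fun j => y j - y l / c l * c j
  have hz0 : ∀ j, 0 ≤ z j := fun j => by
    have := hl j
    rw [div_le_div_iff₀ (hc l) (hc j)] at this
    simp only [z]
    rw [div_mul_eq_mul_div, sub_nonneg, div_le_iff₀ (hc l)]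
    exact this
  have hzl : z l = 0 := by
    simp only [z]
    rw [div_mul_cancel₀ _ (hc l).ne', sub_self]
  have hz : ∑ j, (z j : ℂ) * g j = x := by
    simp only [z, Complex.ofReal_sub, Complex.ofReal_mul, sub_mul, Finset.sum_sub_distrib, hy,
      mul_assoc, ← Finset.mul_sum, hsum, mul_zero, sub_zero]
  have hz' : x = z (l + 1) * g (l + 1) + z (l + 2) * g (l + 2) := by
    rw [← hz, Fin.sum_univ_three]
    fin_cases l <;> (simp_all; try ring)
  refine ⟨l, z (l + 1), z (l + 2), hz0 _, hz0 _, ?_, hz'⟩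
  have h1 := norm_add_le ((z (l + 1) : ℂ) * g (l + 1)) (z (l + 2) * g (l + 2))
  rw [← hz', hx, norm_mul, norm_mul, hg, hg, Complex.norm_real, Complex.norm_real,
    Real.norm_of_nonneg (hz0 _), Real.norm_of_nonneg (hz0 _), ← add_mul] at h1
  nlinarith

/-- By orthogonality of the circles, the points of tangency on disk `l` lie on the polar line of its
centre with respect to the incircle. -/
lemma dot_q_center (hT : Tangential T) {j l : Fin 3} (hjl : j ≠ l) :
    dot (q T j - incenter T) ((T l).center - incenter T) = inradius T ^ 2 := by
  have h1 := norm_sq_eq_dot (q T j - incenter T)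
  have h2 := dot_center_self hT l
  have h3 := norm_sq_eq_dot (q T j - (T l).center)
  rw [mem_sphere_iff_norm.1 ((q_mem_sphere_iff hT).2 hjl)] at h3
  rw [norm_q_sub_incenter hT] at h1
  simp only [dot, Complex.sub_re, Complex.sub_im] at *
  linarith

lemma norm_sub_center_sq (hT : Tangential T) (l : Fin 3) (x : ℂ) :
    ‖x - (T l).center‖ ^ 2 = ‖x - incenter T‖ ^ 2 -
      2 * dot (x - incenter T) ((T l).center - incenter T) + (T l).radius ^ 2 + inradius T ^ 2 := by
  rw [norm_sq_eq_dot, norm_sq_eq_dot, add_assoc, ← dot_center_self hT l]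
  simp only [dot, Complex.sub_re, Complex.sub_im]
  ring

/-- The sides of the triangle, turned by a right angle, add up to zero. -/
lemma sum_weight_q (hT : Tangential T) :
    ∑ j, (((T (j + 1)).radius + (T (j + 2)).radius : ℝ) : ℂ) * (q T j - incenter T) = 0 := by
  have h : ∀ j, (((T (j + 1)).radius + (T (j + 2)).radius : ℝ) : ℂ) * (q T j - incenter T) =
      -(inradius T * Complex.I) * ((T (j + 2)).center - (T (j + 1)).center) := fun j => by
    rw [center_sub_center, incenter_eq hT j]; ring
  simp only [h, Fin.sum_univ_three, Fin.isValue, zero_add, Fin.reduceAdd]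
  ring

lemma cross_q_sub_incenter_ne_zero (hT : Tangential T) :
    cross (q T 0 - incenter T) (q T 1 - incenter T) ≠ 0 := by
  have h0 : ((T 1).radius + (T 2).radius) * ((T 2).radius + (T 0).radius) *
      cross (q T 0 - incenter T) (q T 1 - incenter T) =
      inradius T ^ 2 * cross ((T 1).center - (T 0).center) ((T 2).center - (T 0).center) := by
    have a := center_sub_center T 0
    have b := center_sub_center T 1
    simp only [Fin.isValue, zero_add, Fin.reduceAdd] at a b
    have e : cross ((T 1).center - (T 0).center) ((T 2).center - (T 0).center) =
        cross ((T 2).center - (T 1).center) ((T 0).center - (T 2).center) := by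
      simp only [cross, Complex.sub_re, Complex.sub_im]; ring
    rw [e, a, b, incenter_eq hT 0]
    nth_rw 2 [← incenter_eq hT 0]
    rw [incenter_eq hT 1]
    simp [cross]
    ring
  have := mul_pos (pow_pos (inradius_pos T) 2) hT.cross_pos
  intro h
  rw [h, mul_zero] at h0
  exact this.ne h0

/-- The circle through the points of tangency is covered by the three closed disks. -/
lemma exists_mem_closedBall_of_mem_sphere (hT : Tangential T) {x : ℂ}
    (hx : x ∈ Metric.sphere (incenter T) (inradius T)) :
    ∃ l, x ∈ Metric.closedBall (T l).center (T l).radius := by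
  rw [mem_sphere_iff_norm] at hx
  obtain ⟨l, a, b, ha, hb, hab, h⟩ := exists_mem_cone (inradius_pos T) (norm_q_sub_incenter hT)
    (fun j => add_pos (T (j + 1)).radius_pos (T (j + 2)).radius_pos) (sum_weight_q hT)
    (cross_q_sub_incenter_ne_zero hT) hx
  refine ⟨l, ?_⟩
  rw [mem_closedBall_iff_norm, ← pow_le_pow_iff_left₀ (norm_nonneg _) (T l).radius_pos.le
    two_ne_zero, norm_sub_center_sq hT, hx]
  have h1 := dot_q_center hT (fin_three_ne_one l).symm
  have h2 := dot_q_center hT (fin_three_ne_two l).symm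
  -- A combination of the two points of tangency on disk `l` with coefficient sum at least one lies
  -- beyond their chord, hence in that disk.
  have h3 : dot (x - incenter T) ((T l).center - incenter T) = (a + b) * inradius T ^ 2 := by
    rw [h, add_mul]
    nth_rw 1 [← h1]
    rw [← h2]
    simp only [dot, Complex.add_re, Complex.add_im, Complex.re_ofReal_mul, Complex.im_ofReal_mul]
    ring
  rw [h3]
  nlinarith [pow_pos (inradius_pos T) 2]

lemma mem_compl_iUnion_iff {x : ℂ} : x ∈ (⋃ j, closure (T j).toSet)ᶜ ↔
    ∀ j, (T j).radius < ‖x - (T j).center‖ := by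
  simp [Disk.closure_toSet, dist_eq_norm]

/-- Outside the dual ball a ray from the incentre cannot enter a disk. With y the offset from the
incentre, the power of the point at parameter t exceeds t times the power at 1 by (t − 1)(t |y|² −
ρ²), which is nonnegative. -/
lemma lt_norm_ray (hT : Tangential T) {x : ℂ} (hx : inradius T ≤ ‖x - incenter T‖) {l : Fin 3}
    (hl : (T l).radius < ‖x - (T l).center‖) {t : ℝ} (ht : 1 ≤ t) :
    (T l).radius < ‖incenter T + t * (x - incenter T) - (T l).center‖ := by
  have h1 := pow_lt_pow_left₀ hl (T l).radius_pos.le two_ne_zero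
  have h2 := pow_le_pow_left₀ (inradius_pos T).le hx 2
  rw [norm_sub_center_sq hT] at h1
  rw [← pow_lt_pow_iff_left₀ (T l).radius_pos.le (norm_nonneg _) two_ne_zero,
    norm_sub_center_sq hT, add_sub_cancel_left, norm_mul, mul_pow, Complex.norm_real,
    Real.norm_eq_abs, sq_abs]
  have e : dot (t * (x - incenter T)) ((T l).center - incenter T) =
      t * dot (x - incenter T) ((T l).center - incenter T) := by
    simp only [dot, Complex.re_ofReal_mul, Complex.im_ofReal_mul]
    ring
  rw [e]
  nlinarith [mul_nonneg (sub_nonneg.2 ht) (show 0 ≤ t * ‖x - incenter T‖ ^ 2 - inradius T ^ 2 by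
    nlinarith)]

/-- A point outside the dual ball escapes to infinity along its ray, so its component is unbounded.
A component that meets the dual ball stays in it, because the bounding circle is covered by the
closed disks. -/
lemma mem_idealTriangle_iff (hT : Tangential T) {x : ℂ} : x ∈ idealTriangle T ↔
    x ∈ Metric.ball (incenter T) (inradius T) ∧ ∀ j, (T j).radius < ‖x - (T j).center‖ := by
  rw [idealTriangle, Set.mem_ofPred_eq, mem_compl_iUnion_iff]
  refine ⟨fun ⟨h1, h2⟩ => ⟨?_, h1⟩, fun ⟨h1, h2⟩ => ⟨h2, ?_⟩⟩
  · by_contra h3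
    rw [mem_ball_iff_norm, not_lt] at h3
    have hsub : (fun t : ℝ => incenter T + t * (x - incenter T)) '' Set.Ici 1 ⊆
        connectedComponentIn (⋃ j, closure (T j).toSet)ᶜ x := by
      refine IsPreconnected.subset_connectedComponentIn ?_ ⟨1, Set.self_mem_Ici, by simp⟩ ?_
      · exact isPreconnected_Ici.image _ (by fun_prop)
      · rintro _ ⟨t, ht, rfl⟩
        exact mem_compl_iUnion_iff.2 fun l => lt_norm_ray hT h3 (h1 l) ht
    obtain ⟨M, hM⟩ := (h2.subset hsub).exists_norm_le
    have hpos : 0 < ‖x - incenter T‖ := (inradius_pos T).trans_le h3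
    set t : ℝ := max 1 ((|M| + ‖incenter T‖ + 1) / ‖x - incenter T‖)
    have ht : |M| + ‖incenter T‖ + 1 ≤ t * ‖x - incenter T‖ := by
      rw [← div_le_iff₀ hpos]; exact le_max_right _ _
    have h4 := hM _ ⟨t, Set.mem_Ici.2 (le_max_left _ _), rfl⟩
    have h5 := norm_sub_le (incenter T + t * (x - incenter T)) (incenter T)
    rw [add_sub_cancel_left, norm_mul, Complex.norm_real,
      Real.norm_of_nonneg (zero_le_one.trans (le_max_left _ _))] at h5
    linarith [le_abs_self M]
  · refine (Metric.isBounded_ball (x := incenter T) (r := inradius T)).subset ?_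
    refine isPreconnected_connectedComponentIn.subset_left_of_subset_union Metric.isOpen_ball
      (v := (Metric.closedBall (incenter T) (inradius T))ᶜ) Metric.isClosed_closedBall.isOpen_compl
      ?_ ?_ ⟨x, mem_connectedComponentIn (mem_compl_iUnion_iff.2 h2), h1⟩
    · exact disjoint_compl_right.mono_left Metric.ball_subset_closedBall
    · intro y hy
      have hy' := mem_compl_iUnion_iff.1 (connectedComponentIn_subset _ _ hy)
      by_contra h
      simp only [Set.mem_union, Metric.mem_ball, Set.mem_compl_iff, Metric.mem_closedBall, not_or,
        not_lt, not_not] at h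
      obtain ⟨l, hl⟩ := exists_mem_closedBall_of_mem_sphere hT (le_antisymm h.2 h.1)
      exact absurd (mem_closedBall_iff_norm.1 hl) (hy' l).not_ge

/-! ### The inscribed disk -/

lemma isInscribed_soddy (hT : Tangential T) : IsInscribed T (soddy T) := by
  have hR := (soddy T).radius_pos
  have hρ := inradius_pos T
  have hm := soddy_radius_mul T
  have hσ := curvSum_pos T
  refine ⟨fun x hx => ?_, fun j => ?_⟩
  · rw [Disk.toSet, mem_ball_iff_norm] at hx
    refine (mem_idealTriangle_iff hT).2 ⟨?_, fun j => ?_⟩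
    · rw [mem_ball_iff_norm]
      -- With R the Soddy radius and σ the sum of curvatures, Descartes' relation gives ρ − R = R
      -- (ρσ + 1), while the squared distance is R² (ρ²σ² − 3).
      have h1 : ‖(soddy T).center - incenter T‖ ≤ inradius T - (soddy T).radius := by
        have h2 : inradius T - (soddy T).radius =
          (soddy T).radius * (inradius T * curvSum T + 1) := by linarith
        rw [h2, ← pow_le_pow_iff_left₀ (norm_nonneg _) (by positivity) two_ne_zero,
          norm_sq_eq_dot, dot_soddy_center_self hT, mul_pow]
        gcongr
        nlinarith [mul_pos hρ hσ]
      have h3 := norm_add_le (x - (soddy T).center) ((soddy T).center - incenter T)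
      rw [sub_add_sub_cancel] at h3
      linarith
    · have h1 := norm_soddy_center_sub hT j
      have h3 := norm_add_le ((soddy T).center - x) (x - (T j).center)
      rw [sub_add_sub_cancel, norm_sub_rev] at h3
      rw [norm_sub_rev] at hx
      rw [norm_sub_rev] at h1
      linarith
  · have h := ncard_inter_eq_one (hT.update_soddy (j + 1)) (fin_three_ne_one j).symm
    rwa [Function.update_self, Function.update_of_ne (fin_three_ne_one j)] at h

lemma eq_zero_of_dot_eq_zero {a b z : ℂ} (hab : cross a b ≠ 0) (ha : dot z a = 0)
    (hb : dot z b = 0) : z = 0 := by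
  have h1 : cross a b * z.re = 0 := by
    simp only [cross, dot] at *
    linear_combination b.im * ha - a.im * hb
  have h2 : cross a b * z.im = 0 := by
    simp only [cross, dot] at *
    linear_combination a.re * hb - b.re * ha
  exact Complex.ext ((mul_eq_zero.1 h1).resolve_left hab) ((mul_eq_zero.1 h2).resolve_left hab)

/-- Tangency to the three disks is a linear system for the centre (seen from the incentre) and the
radius, apart from one unknown common right-hand side. So any solution is a multiple μ of the Soddy
solution. The remaining quadratic equation has the roots 1 and ρ² / P; the second belongs to the
image of the Soddy disk under inversion in the incircle and is excluded because the centre lies in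
the dual ball. -/
lemma IsInscribed.eq_soddy (hT : Tangential T) {D : Disk} (hD : IsInscribed T D) :
    D = soddy T := by
  have hR := (soddy T).radius_pos
  have hr := D.radius_pos
  have hρ := inradius_pos T
  have hm := soddy_radius_mul T
  have hσ := curvSum_pos T
  have hc : ‖D.center - incenter T‖ < inradius T := by
    rw [← mem_ball_iff_norm]
    exact ((mem_idealTriangle_iff hT).1 (hD.1 (Metric.mem_ball_self D.radius_pos))).1
  have ht : ∀ k, dot (D.center - incenter T) ((T k).center - incenter T) +
      D.radius * (T k).radius =
      (‖D.center - incenter T‖ ^ 2 - D.radius ^ 2 + inradius T ^ 2) / 2 := fun k => by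
    have h1 := norm_center_sub_of_ncard (hD.2 k)
    have h2 := norm_sub_center_sq hT k D.center
    rw [norm_sub_rev, h1] at h2
    linarith
  set τ := (soddy T).radius * (inradius T ^ 2 * curvSum T)
  have hτ : 0 < τ := by positivity
  set μ := (‖D.center - incenter T‖ ^ 2 - D.radius ^ 2 + inradius T ^ 2) / 2 / τ
  have hμ : (‖D.center - incenter T‖ ^ 2 - D.radius ^ 2 + inradius T ^ 2) / 2 = μ * τ :=
    (div_mul_cancel₀ _ hτ.ne').symm
  have hd : ∀ k, dot ((D.center - incenter T) - μ * ((soddy T).center - incenter T))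
      ((T k).center - incenter T) + (D.radius - μ * (soddy T).radius) * (T k).radius = 0 :=
    fun k => by
    have e (a b c : ℂ) (x : ℝ) : dot (a - x * b) c = dot a c - x * dot b c := by
      simp only [dot, Complex.sub_re, Complex.sub_im, Complex.re_ofReal_mul, Complex.im_ofReal_mul]
      ring
    have h1 := ht k
    rw [hμ] at h1
    rw [e, dot_soddy_center hT]
    simp only [τ] at h1
    linear_combination h1
  set δ := (D.center - incenter T) - μ * ((soddy T).center - incenter T)
  set ε := D.radius - μ * (soddy T).radius
  -- The incentre is the barycentre for the side lengths, so these weights cancel the `δ` terms and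
  -- leave an equation for `ε`.
  have hbary : ((T 1).radius + (T 2).radius) * dot δ ((T 0).center - incenter T) +
      ((T 2).radius + (T 0).radius) * dot δ ((T 1).center - incenter T) +
      ((T 0).radius + (T 1).radius) * dot δ ((T 2).center - incenter T) = 0 := by
    have hs : ((semiperimeter T : ℝ) : ℂ) ≠ 0 := by exact_mod_cast (semiperimeter_pos T).ne'
    have h1 : (((T 1).radius + (T 2).radius : ℝ) : ℂ) * ((T 0).center - incenter T) +
        (((T 2).radius + (T 0).radius : ℝ) : ℂ) * ((T 1).center - incenter T) +
        (((T 0).radius + (T 1).radius : ℝ) : ℂ) * ((T 2).center - incenter T) = 0 := by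
      rw [incenter]
      push_cast
      field_simp
      simp only [semiperimeter]
      push_cast
      ring
    have h2 := congrArg (dot δ) h1
    simp only [dot, Complex.add_re, Complex.add_im, Complex.re_ofReal_mul, Complex.im_ofReal_mul,
      Complex.zero_re, Complex.zero_im] at h2 ⊢
    linarith
  have r0 := (T 0).radius_pos
  have r1 := (T 1).radius_pos
  have r2 := (T 2).radius_pos
  have hε : ε = 0 := by
    have h0 := hd 0
    have h1 := hd 1
    have h2 := hd 2
    have : ε * (((T 1).radius + (T 2).radius) * (T 0).radius +
        ((T 2).radius + (T 0).radius) * (T 1).radius +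
        ((T 0).radius + (T 1).radius) * (T 2).radius) = 0 := by
      linear_combination ((T 1).radius + (T 2).radius) * h0 +
        ((T 2).radius + (T 0).radius) * h1 + ((T 0).radius + (T 1).radius) * h2 - hbary
    exact (mul_eq_zero.1 this).resolve_right (by positivity)
  have hδ : δ = 0 := by
    simp only [hε, zero_mul, add_zero] at hd
    have e (a b c : ℂ) : dot δ (a - b) = dot δ (a - c) - dot δ (b - c) := by
      simp only [dot, Complex.sub_re, Complex.sub_im]; ring
    refine eq_zero_of_dot_eq_zero hT.cross_pos.ne' ?_ ?_
    · rw [e _ _ (incenter T), hd, hd, sub_zero]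
    · rw [e _ _ (incenter T), hd, hd, sub_zero]
  have hcen : D.center - incenter T = μ * ((soddy T).center - incenter T) := sub_eq_zero.1 hδ
  have hrad : D.radius = μ * (soddy T).radius := sub_eq_zero.1 hε
  have hμ0 : 0 < μ := pos_of_mul_pos_left (hrad ▸ hr) hR.le
  have hn : ‖D.center - incenter T‖ ^ 2 =
      μ ^ 2 * ((soddy T).radius ^ 2 * (inradius T ^ 2 * curvSum T ^ 2 - 3)) := by
    rw [hcen, norm_mul, mul_pow, norm_sq_eq_dot, norm_sq_eq_dot, dot_soddy_center_self hT]
    simp only [dot, Complex.ofReal_re, Complex.ofReal_im]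
    ring
  -- The power of the incentre with respect to the Soddy disk.
  set P := (soddy T).radius ^ 2 * (inradius T ^ 2 * curvSum T ^ 2 - 4)
  have hP : P + inradius T ^ 2 = 2 * τ := by
    simp only [P, τ]
    linear_combination (inradius T * curvSum T * (soddy T).radius - inradius T -
      2 * (soddy T).radius) * hm
  have hPlt : P < inradius T ^ 2 := by
    have : inradius T ^ 2 - P = (soddy T).radius ^ 2 * (4 * (inradius T * curvSum T) + 8) := by
      simp only [P]
      linear_combination -(inradius T + (soddy T).radius * (inradius T * curvSum T + 2)) * hm
    have : 0 < (soddy T).radius ^ 2 * (4 * (inradius T * curvSum T) + 8) := by positivity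
    linarith
  have hpow : μ ^ 2 * P < inradius T ^ 2 := by
    have := pow_lt_pow_left₀ hc (norm_nonneg _) two_ne_zero
    rw [hn] at this
    simp only [P]
    nlinarith [pow_pos (mul_pos hμ0 hR) 2]
  have hprod : (μ * P - inradius T ^ 2) * (μ - 1) = 0 := by
    rw [hn, hrad] at hμ
    simp only [P] at hP ⊢
    linear_combination 2 * hμ - μ * hP
  have hμ1 : μ = 1 := by
    rcases mul_eq_zero.1 hprod with h | h
    · exfalso
      have hμP : μ * P = inradius T ^ 2 := sub_eq_zero.1 h
      have hP0 : 0 < P := pos_of_mul_pos_right (hμP ▸ pow_pos hρ 2) hμ0.le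
      nlinarith
    · linarith
  rw [hμ1] at hcen hrad
  cases D
  simp only [Complex.ofReal_one, one_mul, sub_left_inj] at hcen hrad
  subst hcen hrad
  rfl

lemma inDisk_eq (hT : Tangential T) : inDisk T = soddy T :=
  (Classical.epsilon_spec ⟨_, isInscribed_soddy hT⟩ : IsInscribed T (inDisk T)).eq_soddy hT

lemma Phi_eq (hT : Tangential T) (k : Fin 3) : Phi T k = Function.update T k (soddy T) := by
  rw [Phi, inDisk_eq hT]

lemma Tangential.Phi (hT : Tangential T) (k : Fin 3) : Tangential (Phi T k) := by
  rw [Phi_eq hT]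
  exact hT.update_soddy k

lemma Tangential.cell (hT : Tangential T) (w : List (Fin 3)) : Tangential (cell T w) := by
  induction w generalizing T with
  | nil => exact hT
  | cons k w ih => exact ih (hT.Phi k)

/-! ### The dual balls of the cells -/

/-- The open disk bounded by the circle through the three points of tangency. -/
def dualBall (T : Fin 3 → Disk) : Set ℂ := Metric.ball (incenter T) (inradius T)

/-- The closed disk bounded by the circle through the three points of tangency. -/
def closedDualBall (T : Fin 3 → Disk) : Set ℂ := Metric.closedBall (incenter T) (inradius T)

lemma dualBall_subset (T : Fin 3 → Disk) : dualBall T ⊆ closedDualBall T :=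
  Metric.ball_subset_closedBall

lemma q_mem_closedDualBall (hT : Tangential T) (j : Fin 3) : q T j ∈ closedDualBall T :=
  mem_closedBall_iff_norm.2 (norm_q_sub_incenter hT j).le

lemma q_notMem_dualBall (hT : Tangential T) (j : Fin 3) : q T j ∉ dualBall T := fun h =>
  (mem_ball_iff_norm.1 h).ne (norm_q_sub_incenter hT j)

lemma one_div_inradius_sq (T : Fin 3 → Disk) : (1 / inradius T) ^ 2 =
    1 / (T 0).radius * (1 / (T 1).radius) + 1 / (T 1).radius * (1 / (T 2).radius) +
      1 / (T 2).radius * (1 / (T 0).radius) := by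
  have r0 := (T 0).radius_pos
  have r1 := (T 1).radius_pos
  have r2 := (T 2).radius_pos
  rw [one_div_pow, inradius_sq, semiperimeter]
  field_simp
  ring

/-- Both sides are positive and their squares agree by Descartes' formula for the new curvature and
`one_div_inradius_sq` for both triples. -/
lemma one_div_inradius_Phi (hT : Tangential T) (k : Fin 3) : 1 / inradius (Phi T k) =
    1 / inradius T + 1 / (T (k + 1)).radius + 1 / (T (k + 2)).radius := by
  have r0 := (T 0).radius_pos
  have r1 := (T 1).radius_pos
  have r2 := (T 2).radius_pos
  have hk1 := (T (k + 1)).radius_pos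
  have hk2 := (T (k + 2)).radius_pos
  have h1 := inradius_pos T
  have h2 := inradius_pos (Phi T k)
  refine (pow_left_inj₀ (by positivity) (by positivity) two_ne_zero).1 ?_
  have h3 := one_div_inradius_sq T
  have h4 := one_div_soddy_radius T
  rw [curvSum] at h4
  rw [one_div_inradius_sq, Phi_eq hT]
  fin_cases k <;> simp only [Fin.zero_eta, Fin.mk_one, Fin.reduceFinMk, Fin.isValue, zero_add,
    Fin.reduceAdd, Function.update_self, ne_eq, Fin.reduceEq, not_false_eq_true,
    Function.update_of_ne, h4]
  · linear_combination -h3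
  · linear_combination -h3
  · linear_combination -h3

lemma inradius_Phi_lt (hT : Tangential T) (k : Fin 3) : inradius (Phi T k) < inradius T := by
  have hk1 := (T (k + 1)).radius_pos
  have hk2 := (T (k + 2)).radius_pos
  have h1 := inradius_pos T
  have h2 := inradius_pos (Phi T k)
  rw [← one_div_lt_one_div h1 h2, one_div_inradius_Phi hT]
  have : 0 < 1 / (T (k + 1)).radius + 1 / (T (k + 2)).radius := by positivity
  linarith

lemma Phi_of_ne (T : Fin 3 → Disk) {j k : Fin 3} (h : j ≠ k) : Phi T k j = T j :=
  Function.update_of_ne h _ _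

lemma Phi_self (T : Fin 3 → Disk) (k : Fin 3) : Phi T k k = inDisk T := Function.update_self _ _ _

lemma dir_Phi (T : Fin 3 → Disk) (k : Fin 3) : dir (Phi T k) k = dir T k := by
  rw [dir, dir, Phi_of_ne T (fin_three_ne_one k).symm, Phi_of_ne T (fin_three_ne_two k).symm]

/-- The subcell keeps the two disks touching at `q T k`, so both dual balls pass through this point
with the same normal: they are internally tangent. -/
lemma mem_dualBall_or_of_mem_Phi (hT : Tangential T) {k : Fin 3} {x : ℂ}
    (h : x ∈ closedDualBall (Phi T k)) : x ∈ dualBall T ∨ x = q T k := by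
  rw [closedDualBall, incenter_eq (hT.Phi k) k, q_Phi, dir_Phi] at h
  rw [dualBall, incenter_eq hT k]
  exact mem_ball_or_eq_of_mem_closedBall (norm_I_mul_dir hT k) (inradius_pos _)
    (inradius_Phi_lt hT k) h

lemma q_Phi_mem_dualBall (hT : Tangential T) {j k : Fin 3} (h : j ≠ k) :
    q (Phi T k) j ∈ dualBall T := by
  refine (mem_dualBall_or_of_mem_Phi hT (q_mem_closedDualBall (hT.Phi k) j)).resolve_right ?_
  rw [← q_Phi T k]
  exact fun h' => h (q_injective (hT.Phi k) h')

lemma dir_Phi_succ (T : Fin 3 → Disk) (l : Fin 3) :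
    dir (Phi T (l + 1)) l = -dir (Phi T l) (l + 1) := by
  rw [dir, dir, Phi_self, Phi_of_ne T (fin_three_one_ne_two l).symm, fin_three_one_one,
    fin_three_one_two, Phi_self, Phi_of_ne T (fin_three_ne_two l).symm, ← neg_div, neg_sub,
    add_comm (inDisk T).radius]

/-- Both are the point where the inscribed disk touches disk `l + 2`. -/
lemma q_Phi_succ (T : Fin 3 → Disk) (l : Fin 3) :
    q (Phi T (l + 1)) l = q (Phi T l) (l + 1) := by
  have h1 := center_succ_succ (Phi T (l + 1)) l
  have h2 := center_succ (Phi T l) (l + 1)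
  rw [Phi_of_ne T (fin_three_one_ne_two l).symm, dir_Phi_succ] at h1
  rw [fin_three_one_one, Phi_of_ne T (fin_three_ne_two l).symm] at h2
  linear_combination h2 - h1

lemma q_Phi_comm (T : Fin 3 → Disk) {k l : Fin 3} (h : k ≠ l) :
    q (Phi T k) l = q (Phi T l) k := by
  obtain rfl | rfl := fin_three_cases_of_ne h
  · exact q_Phi_succ T l
  · have := q_Phi_succ T (l + 2)
    rw [fin_three_two_one] at this
    exact this.symm

/-- At the common vertex two sibling dual balls have opposite normals (`dir_Phi_succ`), so they are
externally tangent. -/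
lemma eq_q_of_mem_Phi_of_mem_Phi (hT : Tangential T) {k l : Fin 3} (h : k ≠ l) {x : ℂ}
    (h1 : x ∈ closedDualBall (Phi T k)) (h2 : x ∈ closedDualBall (Phi T l)) :
    x = q (Phi T k) l := by
  wlog hkl : k = l + 1 generalizing k l
  · rw [q_Phi_comm T h]
    refine this h.symm h2 h1 ?_
    obtain rfl | rfl := fin_three_cases_of_ne h
    · exact absurd rfl hkl
    · exact (fin_three_two_one l).symm
  subst hkl
  rw [closedDualBall, incenter_eq (hT.Phi _) l, dir_Phi_succ, mul_neg] at h1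
  rw [closedDualBall, incenter_eq (hT.Phi l) (l + 1), ← q_Phi_succ] at h2
  exact eq_of_mem_closedBall_of_mem_closedBall (norm_I_mul_dir (hT.Phi l) (l + 1))
    (inradius_pos _) (inradius_pos _) h1 h2

lemma dualBall_Phi_subset (hT : Tangential T) (k : Fin 3) : dualBall (Phi T k) ⊆ dualBall T := by
  intro x hx
  refine (mem_dualBall_or_of_mem_Phi hT (dualBall_subset _ hx)).resolve_right ?_
  rintro rfl
  rw [← q_Phi] at hx
  exact q_notMem_dualBall (hT.Phi k) k hx

lemma closedDualBall_Phi_subset (hT : Tangential T) (k : Fin 3) :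
    closedDualBall (Phi T k) ⊆ closedDualBall T := by
  intro x hx
  rcases mem_dualBall_or_of_mem_Phi hT hx with h | rfl
  · exact dualBall_subset _ h
  · exact q_mem_closedDualBall hT k

/-! ### The tree of cells -/

lemma cell_cons (T : Fin 3 → Disk) (k : Fin 3) (w : List (Fin 3)) :
    cell T (k :: w) = cell (Phi T k) w := rfl

lemma cell_append (T : Fin 3 → Disk) (v w : List (Fin 3)) :
    cell T (v ++ w) = cell (cell T v) w := List.foldl_append

lemma cell_concat (T : Fin 3 → Disk) (w : List (Fin 3)) (k : Fin 3) :
    cell T (w ++ [k]) = Phi (cell T w) k := by rw [cell_append]; rfl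

lemma closedDualBall_cell_subset (hT : Tangential T) (w : List (Fin 3)) :
    closedDualBall (cell T w) ⊆ closedDualBall T := by
  induction w generalizing T with
  | nil => exact le_rfl
  | cons k w ih => exact (ih (hT.Phi k)).trans (closedDualBall_Phi_subset hT k)

/-- A vertex is either kept for good or moves into the open dual ball. This is what allows
extensions to be defined separately on the dual ball of each cell. -/
lemma q_cell_mem_or (hT : Tangential T) (w : List (Fin 3)) (i : Fin 3) :
    q (cell T w) i ∈ dualBall T ∨ q (cell T w) i = q T i := by
  induction w generalizing T with
  | nil => exact Or.inr rfl
  | cons k w ih =>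
    rcases ih (hT.Phi k) with h | h
    · exact Or.inl (dualBall_Phi_subset hT k h)
    · rw [cell_cons, h]
      by_cases hik : i = k
      · subst hik
        exact Or.inr (q_Phi T i)
      · exact Or.inl (q_Phi_mem_dualBall hT hik)

lemma q_cell_eq_of_mem (hT : Tangential T) {w : List (Fin 3)} {j : Fin 3}
    (h : q T j ∈ closedDualBall (cell T w)) : q (cell T w) j = q T j := by
  induction w generalizing T with
  | nil => rfl
  | cons k w ih =>
    have h1 := closedDualBall_cell_subset (hT.Phi k) w h
    rcases mem_dualBall_or_of_mem_Phi hT h1 with h2 | h2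
    · exact absurd h2 (q_notMem_dualBall hT j)
    · have e := q_injective hT h2
      subst e
      rw [← q_Phi T j] at h ⊢
      exact ih (hT.Phi j) h

/-- At the first letter where the words differ, the ancestors are siblings and their closed dual
balls share one point; nesting does the rest. -/
lemma eq_of_mem_closedDualBall (hT : Tangential T) {w w' : List (Fin 3)}
    (hlen : w.length = w'.length) (hne : w ≠ w') {x y : ℂ}
    (hx : x ∈ closedDualBall (cell T w)) (hx' : x ∈ closedDualBall (cell T w'))
    (hy : y ∈ closedDualBall (cell T w)) (hy' : y ∈ closedDualBall (cell T w')) : x = y := by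
  induction w generalizing T w' with
  | nil => exact absurd (List.length_eq_zero_iff.1 hlen.symm).symm hne
  | cons k w ih =>
    cases w' with
    | nil => simp at hlen
    | cons l w' =>
      by_cases hkl : k = l
      · subst hkl
        exact ih (hT.Phi k) (by simpa using hlen) (by simpa using hne) hx hx' hy hy'
      · have sub := fun k w => closedDualBall_cell_subset (hT.Phi k) w
        rw [eq_q_of_mem_Phi_of_mem_Phi hT hkl (sub k w hx) (sub l w' hx'),
          eq_q_of_mem_Phi_of_mem_Phi hT hkl (sub k w hy) (sub l w' hy')]

/-- The single common point of the two sibling ancestors is a vertex, and it remains a vertex of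
every descendant whose closed dual ball contains it (`q_cell_eq_of_mem`). -/
lemma mem_V0_of_mem_closedDualBall (hT : Tangential T) {w w' : List (Fin 3)}
    (hlen : w.length = w'.length) (hne : w ≠ w') {x : ℂ}
    (hx : x ∈ closedDualBall (cell T w)) (hx' : x ∈ closedDualBall (cell T w')) :
    x ∈ V0 (cell T w) := by
  induction w generalizing T w' with
  | nil => exact absurd (List.length_eq_zero_iff.1 hlen.symm).symm hne
  | cons k w ih =>
    cases w' with
    | nil => simp at hlen
    | cons l w' =>
      by_cases hkl : k = l
      · subst hkl
        exact ih (hT.Phi k) (by simpa using hlen) (by simpa using hne) hx hx'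
      · have sub := fun k w => closedDualBall_cell_subset (hT.Phi k) w
        obtain rfl := eq_q_of_mem_Phi_of_mem_Phi hT hkl (sub k w hx) (sub l w' hx')
        exact ⟨l, q_cell_eq_of_mem (hT.Phi k) hx⟩

lemma V0_subset_closedDualBall (hT : Tangential T) : V0 T ⊆ closedDualBall T := by
  rintro _ ⟨j, rfl⟩
  exact q_mem_closedDualBall hT j

lemma V0_disjoint_dualBall (hT : Tangential T) {x : ℂ} (hx : x ∈ V0 T) : x ∉ dualBall T := by
  obtain ⟨j, rfl⟩ := hx
  exact q_notMem_dualBall hT j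

lemma mem_V0_of_mem_V (hT : Tangential T) {w : List (Fin 3)} {x : ℂ} (hV : x ∈ V T w.length)
    (hx : x ∈ closedDualBall (cell T w)) : x ∈ V0 (cell T w) := by
  obtain ⟨w', hw', hx'⟩ := hV
  by_cases h : w = w'
  · exact h ▸ hx'
  · exact mem_V0_of_mem_closedDualBall hT hw'.symm h hx (V0_subset_closedDualBall (hT.cell w') hx')

lemma notMem_dualBall_of_mem_V (hT : Tangential T) {w : List (Fin 3)} {x : ℂ}
    (hV : x ∈ V T w.length) : x ∉ dualBall (cell T w) := fun hx =>
  V0_disjoint_dualBall (hT.cell w) (mem_V0_of_mem_V hT hV (dualBall_subset _ hx)) hx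

lemma disjoint_dualBall_cell (hT : Tangential T) {w w' : List (Fin 3)}
    (hlen : w.length = w'.length) (hne : w ≠ w') {x : ℂ} (hx : x ∈ dualBall (cell T w)) :
    x ∉ closedDualBall (cell T w') := fun hx' =>
  V0_disjoint_dualBall (hT.cell w)
    (mem_V0_of_mem_closedDualBall hT hlen hne (dualBall_subset _ hx) hx') hx

lemma eq_of_mem_V0_of_mem_V0 (hT : Tangential T) {w w' : List (Fin 3)}
    (hlen : w.length = w'.length) {x y : ℂ} (hxy : x ≠ y)
    (hx : x ∈ V0 (cell T w)) (hx' : x ∈ V0 (cell T w'))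
    (hy : y ∈ V0 (cell T w)) (hy' : y ∈ V0 (cell T w')) : w = w' := by
  by_contra h
  have s := fun w => V0_subset_closedDualBall (hT.cell w)
  exact hxy (eq_of_mem_closedDualBall hT hlen h (s w hx) (s w' hx') (s w hy) (s w' hy'))

/-! ### Sides of cells cover the sides of their parents -/

/-- Because the two circles are orthogonal, the dual ball cuts the boundary of disk `l` along a
half-plane. -/
lemma mem_closedDualBall_iff (hT : Tangential T) {l : Fin 3} {x : ℂ}
    (hx : ‖x - (T l).center‖ = (T l).radius) : x ∈ closedDualBall T ↔
      (T l).radius ^ 2 ≤ dot (x - (T l).center) (incenter T - (T l).center) := by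
  rw [closedDualBall, mem_closedBall_iff_norm,
    ← pow_le_pow_iff_left₀ (norm_nonneg _) (inradius_pos T).le two_ne_zero]
  have h1 := norm_sub_center_sq hT l x
  have h2 := dot_center_self hT l
  have h3 := norm_sq_eq_dot (x - (T l).center)
  have h4 := norm_sq_eq_dot (x - incenter T)
  rw [hx] at h1 h3
  simp only [dot, Complex.sub_re, Complex.sub_im] at *
  constructor <;> intro h <;> linarith

lemma mem_dualBall_iff (hT : Tangential T) {l : Fin 3} {x : ℂ}
    (hx : ‖x - (T l).center‖ = (T l).radius) : x ∈ dualBall T ↔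
      (T l).radius ^ 2 < dot (x - (T l).center) (incenter T - (T l).center) := by
  rw [dualBall, mem_ball_iff_norm,
    ← pow_lt_pow_iff_left₀ (norm_nonneg _) (inradius_pos T).le two_ne_zero]
  have h1 := norm_sub_center_sq hT l x
  have h2 := dot_center_self hT l
  have h3 := norm_sq_eq_dot (x - (T l).center)
  have h4 := norm_sq_eq_dot (x - incenter T)
  rw [hx] at h1 h3
  simp only [dot, Complex.sub_re, Complex.sub_im] at *
  constructor <;> intro h <;> linarith

lemma norm_q_sub_center (hT : Tangential T) {j l : Fin 3} (h : j ≠ l) :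
    ‖q T j - (T l).center‖ = (T l).radius :=
  mem_sphere_iff_norm.1 ((q_mem_sphere_iff hT).2 h)

lemma dot_q_sub_center (hT : Tangential T) {j l : Fin 3} (h : j ≠ l) :
    dot (q T j - (T l).center) (incenter T - (T l).center) = (T l).radius ^ 2 := by
  have h1 := norm_sq_eq_dot (q T j - incenter T)
  have h2 := dot_center_self hT l
  have h3 := norm_sq_eq_dot (q T j - (T l).center)
  rw [norm_q_sub_center hT h] at h3
  rw [norm_q_sub_incenter hT] at h1
  simp only [dot, Complex.sub_re, Complex.sub_im] at *
  linarith

lemma cross_dir_pos (hT : Tangential T) (l : Fin 3) : 0 < cross (dir T (l + 1)) (dir T (l + 2)) := by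
  have hc := hT.cross_pos
  have r0 := (T 0).radius_pos
  have r1 := (T 1).radius_pos
  have r2 := (T 2).radius_pos
  have e (a b : ℂ) (x y : ℝ) : cross (a / x) (b / y) = cross a b / (x * y) := by
    simp only [cross, Complex.div_ofReal_re, Complex.div_ofReal_im]
    ring
  simp only [dir]
  rw [e]
  have hl : cross ((T (l + 1 + 2)).center - (T (l + 1 + 1)).center)
      ((T (l + 2 + 2)).center - (T (l + 2 + 1)).center) =
      cross ((T 1).center - (T 0).center) ((T 2).center - (T 0).center) := by
    fin_cases l <;> simp only [cross, Complex.sub_re, Complex.sub_im, Fin.isValue, Fin.zero_eta,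
      Fin.mk_one, Fin.reduceFinMk, zero_add, Fin.reduceAdd] <;> ring
  rw [hl]
  have h1 := (T (l + 1 + 1)).radius_pos
  have h2 := (T (l + 1 + 2)).radius_pos
  have h3 := (T (l + 2 + 1)).radius_pos
  have h4 := (T (l + 2 + 2)).radius_pos
  positivity

lemma one_le_of_norm_eq {g h y : ℂ} {a b r : ℝ} (hr : 0 < r) (hg : ‖g‖ = r) (hh : ‖h‖ = r)
    (hy : ‖y‖ = r) (ha : 0 ≤ a) (hb : 0 ≤ b) (e : y = a * g + b * h) : 1 ≤ a + b := by
  have h1 := norm_add_le ((a : ℂ) * g) (b * h)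
  rw [← e, hy, norm_mul, norm_mul, hg, hh, Complex.norm_real, Complex.norm_real,
    Real.norm_of_nonneg ha, Real.norm_of_nonneg hb, ← add_mul] at h1
  nlinarith

lemma dot_combination (a b : ℝ) (g h u : ℂ) :
    dot (a * g + b * h) u = a * dot g u + b * dot h u := by
  simp only [dot, Complex.add_re, Complex.add_im, Complex.re_ofReal_mul, Complex.im_ofReal_mul]
  ring

/-- For three vectors of length r, the coordinates satisfy r² ((a + b)² − 1) = 2ab (r² − g · h). So
lying beyond the chord means that both coordinates have the same sign, which is positive. -/
lemma exists_combination {g h y u : ℂ} {r : ℝ} (hr : 0 < r) (hg : ‖g‖ = r) (hh : ‖h‖ = r)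
    (hy : ‖y‖ = r) (hgh : cross g h ≠ 0) (hgu : dot g u = r ^ 2) (hhu : dot h u = r ^ 2) :
    ∃ a b : ℝ, y = a * g + b * h ∧ (r ^ 2 ≤ dot y u → 0 ≤ a ∧ 0 ≤ b) ∧
      (r ^ 2 < dot y u → 0 < a ∧ 0 < b) := by
  have e : y = (cross y h / cross g h : ℝ) * g + (cross g y / cross g h : ℝ) * h := by
    apply Complex.ext <;>
    · simp only [Complex.add_re, Complex.add_im, Complex.re_ofReal_mul, Complex.im_ofReal_mul]
      field_simp
      simp only [cross]
      ring
  set a := cross y h / cross g h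
  set b := cross g y / cross g h
  have h1 : dot y u = (a + b) * r ^ 2 := by
    rw [e, dot_combination, hgu, hhu]; ring
  have hpos : 0 < r ^ 2 - dot g h := by
    have h2 : 0 < ‖g - h‖ ^ 2 := by
      have : g - h ≠ 0 := fun h0 => hgh (by rw [sub_eq_zero.1 h0]; simp only [cross]; ring)
      positivity
    have h3 := norm_sq_eq_dot g
    have h4 := norm_sq_eq_dot h
    rw [norm_sq_eq_dot] at h2
    rw [hg] at h3
    rw [hh] at h4
    simp only [dot, Complex.sub_re, Complex.sub_im] at *
    linarith
  have h2 : (a + b) ^ 2 * r ^ 2 - r ^ 2 = 2 * (a * b) * (r ^ 2 - dot g h) := by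
    have h3 := norm_sq_eq_dot g
    have h4 := norm_sq_eq_dot h
    have h5 := norm_sq_eq_dot y
    rw [hg] at h3
    rw [hh] at h4
    rw [hy, e] at h5
    simp only [dot, Complex.add_re, Complex.add_im, Complex.re_ofReal_mul,
      Complex.im_ofReal_mul] at *
    linear_combination a ^ 2 * h3 + b ^ 2 * h4 - h5
  refine ⟨a, b, e, fun hyu => ?_, fun hyu => ?_⟩
  · have h3 : 1 ≤ a + b := by rw [h1] at hyu; nlinarith [pow_pos hr 2]
    have h4 : 0 ≤ a * b := by
      have : 0 ≤ 2 * (a * b) * (r ^ 2 - dot g h) := by rw [← h2]; nlinarith [pow_pos hr 2]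
      nlinarith
    constructor <;> nlinarith
  · have h3 : 1 < a + b := by rw [h1] at hyu; nlinarith [pow_pos hr 2]
    have h4 : 0 < a * b := by
      have : 0 < 2 * (a * b) * (r ^ 2 - dot g h) := by rw [← h2]; nlinarith [pow_pos hr 2]
      nlinarith
    constructor <;> nlinarith

/-- A side of a cell is covered by the sides of the two subcells adjacent to it. -/
lemma mem_Phi_of_mem_side (hT : Tangential T) {l : Fin 3} {x : ℂ}
    (hx : ‖x - (T l).center‖ = (T l).radius) (hxB : x ∈ closedDualBall T) :
    x ∈ closedDualBall (Phi T (l + 1)) ∨ x ∈ closedDualBall (Phi T (l + 2)) := by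
  have hr := (T l).radius_pos
  have n1 := fin_three_ne_one l
  have n2 := fin_three_ne_two l
  have n3 := fin_three_one_ne_two l
  have hP1 := Phi_of_ne T n1
  have hP2 := Phi_of_ne T n2
  have hg := norm_q_sub_center hT n1.symm
  have hh := norm_q_sub_center hT n2.symm
  have hgu := dot_q_sub_center hT n1.symm
  have hhu := dot_q_sub_center hT n2.symm
  have hcross : cross (q T (l + 1) - (T l).center) (q T (l + 2) - (T l).center) ≠ 0 := by
    have h1 := center_right T l
    have h2 := center_left T l
    rw [← sub_eq_iff_eq_add'] at h1 h2
    have e : cross (q T (l + 1) - (T l).center) (q T (l + 2) - (T l).center) =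
        -((T l).radius ^ 2 * cross (dir T (l + 1)) (dir T (l + 2))) := by
      rw [← neg_sub, h1, ← neg_sub (T l).center (q T (l + 2)), h2]
      simp [cross]
      ring
    rw [e]
    exact neg_ne_zero.2 (mul_pos (pow_pos hr 2) (cross_dir_pos hT l)).ne'
  -- the point where the inscribed disk touches disk `l`
  have hp1 := norm_q_sub_center (hT.Phi (l + 1)) n2.symm
  have hpu1 := dot_q_sub_center (hT.Phi (l + 1)) n2.symm
  have hpu2 := dot_q_sub_center (hT.Phi (l + 2)) n1.symm
  have hgu1 := dot_q_sub_center (hT.Phi (l + 1)) n1.symm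
  have hhu2 := dot_q_sub_center (hT.Phi (l + 2)) n2.symm
  have hpB := (mem_dualBall_iff hT (hP1 ▸ hp1)).1 (q_Phi_mem_dualBall hT n3.symm)
  rw [q_Phi_comm T n3.symm] at hpu2
  rw [q_Phi] at hgu1 hhu2
  have i1 := mem_closedDualBall_iff (hT.Phi (l + 1)) (l := l) (x := x) (by rw [hP1]; exact hx)
  have i2 := mem_closedDualBall_iff (hT.Phi (l + 2)) (l := l) (x := x) (by rw [hP2]; exact hx)
  rw [hP1] at hp1 hpu1 hgu1 i1
  rw [hP2] at hpu2 hhu2 i2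
  set f := q (Phi T (l + 1)) (l + 2) - (T l).center
  set g := q T (l + 1) - (T l).center
  set h := q T (l + 2) - (T l).center
  obtain ⟨a', b', hf, -, hf'⟩ := exists_combination hr hg hh hp1 hcross hgu hhu
  obtain ⟨a, b, hy, hy', -⟩ := exists_combination hr hg hh hx hcross hgu hhu
  obtain ⟨ha', hb'⟩ := hf' hpB
  obtain ⟨ha, hb⟩ := hy' ((mem_closedDualBall_iff hT hx).1 hxB)
  have hac : (a' : ℂ) ≠ 0 := by exact_mod_cast ha'.ne'
  have hbc : (b' : ℂ) ≠ 0 := by exact_mod_cast hb'.ne'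
  -- The ray through the touching point `f` splits the cone of `g` and `h`; the comparison tells in
  -- which half `x` lies.
  rcases le_total (b * a') (a * b') with hab | hab
  · left
    have e : x - (T l).center = (b / b' : ℝ) * f + (a - b * a' / b' : ℝ) * g := by
      rw [hy, hf]; push_cast; field_simp; ring
    have h1 : 0 ≤ a - b * a' / b' := by rw [sub_nonneg, div_le_iff₀ hb']; exact hab
    have h2 := one_le_of_norm_eq hr hp1 hg hx (by positivity) h1 e
    rw [i1, e, dot_combination, hpu1, hgu1, ← add_mul]
    exact le_mul_of_one_le_left (by positivity) h2
  · right
    have e : x - (T l).center = (a / a' : ℝ) * f + (b - a * b' / a' : ℝ) * h := by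
      rw [hy, hf]; push_cast; field_simp; ring
    have h1 : 0 ≤ b - a * b' / a' := by rw [sub_nonneg, div_le_iff₀ ha']; exact hab
    have h2 := one_le_of_norm_eq hr hp1 hh hx (by positivity) h1 e
    rw [i2, e, dot_combination, hpu2, hhu2, ← add_mul]
    exact le_mul_of_one_le_left (by positivity) h2

/-- The boundary of the inscribed disk is covered by the closed dual balls of the subcells. -/
lemma exists_mem_Phi_of_mem_inDisk (hT : Tangential T) {x : ℂ}
    (hx : ‖x - (inDisk T).center‖ = (inDisk T).radius) :
    ∃ l, x ∈ closedDualBall (Phi T l) := by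
  have hr := (inDisk T).radius_pos
  set g : Fin 3 → ℂ := fun m => q (Phi T (m + 1)) (m + 2) - (inDisk T).center
  have hg : ∀ m, ‖g m‖ = (inDisk T).radius := fun m => by
    have := norm_q_sub_center (hT.Phi (m + 1)) (fin_three_one_ne_two m).symm
    rwa [Phi_self] at this
  have hgc : ∀ m, g m = ((inDisk T).radius / ((T m).radius + (inDisk T).radius) : ℝ) *
      ((T m).center - (inDisk T).center) := fun m => by
    have h1 : ((T m).radius : ℂ) + (inDisk T).radius ≠ 0 := by
      have := (T m).radius_pos
      exact_mod_cast (by positivity : (T m).radius + (inDisk T).radius ≠ 0)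
    simp only [g, q, fin_three_two_one, fin_three_two_two, Phi_self,
      Phi_of_ne T (fin_three_ne_one m), AffineMap.lineMap_apply, Complex.real_smul, vsub_eq_sub,
      vadd_eq_add]
    push_cast
    field_simp
    ring
  -- The barycentric relation for the centre of the inscribed disk, rescaled to the vectors of equal
  -- length `g j`.
  have hsum : ∑ j, ((soddyWeight T j * ((T j).radius + (inDisk T).radius) : ℝ) : ℂ) * g j = 0 := by
    have h1 : ∀ j, ((soddyWeight T j * ((T j).radius + (inDisk T).radius) : ℝ) : ℂ) * g j =
        (inDisk T).radius * (soddyWeight T j * ((T j).center - (inDisk T).center)) := fun j => by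
      have h1 : ((T j).radius : ℂ) + (inDisk T).radius ≠ 0 := by
        have := (T j).radius_pos
        exact_mod_cast (by positivity : (T j).radius + (inDisk T).radius ≠ 0)
      rw [hgc]
      push_cast
      field_simp
    have h2 : (soddyWeight T 0 + soddyWeight T 1 + soddyWeight T 2 : ℂ) = 1 := by
      exact_mod_cast sum_soddyWeight T
    simp only [h1, Fin.sum_univ_three]
    have h3 : (inDisk T).center = soddyWeight T 0 * (T 0).center + soddyWeight T 1 * (T 1).center +
        soddyWeight T 2 * (T 2).center := by rw [inDisk_eq hT]; exact soddy_center_eq T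
    linear_combination (-(inDisk T).radius : ℂ) * h3 -
      ((inDisk T).radius * (inDisk T).center : ℂ) * h2
  have hcross : cross (g 0) (g 1) ≠ 0 := by
    have h1 := (hT.Phi 2).cross_pos
    rw [Phi_self, Phi_of_ne T (by decide), Phi_of_ne T (by decide)] at h1
    have e (a b : ℂ) (x y : ℝ) : cross (x * a) (y * b) = x * y * cross a b := by
      simp only [cross, Complex.re_ofReal_mul, Complex.im_ofReal_mul]
      ring
    have h2 : cross ((T 0).center - (inDisk T).center) ((T 1).center - (inDisk T).center) =
        cross ((T 1).center - (T 0).center) ((inDisk T).center - (T 0).center) := by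
      simp only [cross, Complex.sub_re, Complex.sub_im]
      ring
    have r0 := (T 0).radius_pos
    have r1 := (T 1).radius_pos
    rw [hgc, hgc, e, h2]
    positivity
  obtain ⟨l, a, b, ha, hb, hab, h⟩ := exists_mem_cone hr hg
    (fun j => mul_pos (soddyWeight_pos T j) (add_pos (T j).radius_pos hr)) hsum hcross hx
  refine ⟨l, ?_⟩
  rw [mem_closedDualBall_iff (hT.Phi l) (l := l) (by rw [Phi_self]; exact hx), Phi_self, h,
    dot_combination]
  have h1 := dot_q_sub_center (hT.Phi l) (fin_three_ne_one l).symm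
  have h2 := dot_q_sub_center (hT.Phi l) (fin_three_ne_two l).symm
  rw [Phi_self] at h1 h2
  have e1 : g (l + 1) = q (Phi T l) (l + 2) - (inDisk T).center := by
    simp only [g]
    rw [fin_three_one_one, fin_three_one_two, q_Phi_comm T (fin_three_ne_two l).symm]
  have e2 : g (l + 2) = q (Phi T l) (l + 1) - (inDisk T).center := by
    simp only [g]
    rw [fin_three_two_one, fin_three_two_two]
  rw [e1, e2, h1, h2, ← add_mul]
  exact le_mul_of_one_le_left (by positivity) hab

/-! ### Sums over words -/

/-- The words of length `n`. -/
def words : ℕ → Finset (List (Fin 3))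
  | 0 => {[]}
  | n + 1 => (words n ×ˢ Finset.univ).image fun p => p.1 ++ [p.2]

lemma mem_words {n : ℕ} {w : List (Fin 3)} : w ∈ words n ↔ w.length = n := by
  induction n generalizing w with
  | zero => simp [words]
  | succ n ih =>
    simp only [words, Finset.mem_image, Finset.mem_product, Finset.mem_univ, and_true, Prod.exists,
      ih]
    constructor
    · rintro ⟨v, k, hv, rfl⟩
      simp [hv]
    · intro h
      have hw : w ≠ [] := by rintro rfl; simp at h
      exact ⟨w.dropLast, w.getLast hw, by simp [h], List.dropLast_append_getLast hw⟩

lemma sum_words_succ {M : Type*} [AddCommMonoid M] (n : ℕ) (f : List (Fin 3) → M) :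
    ∑ w ∈ words (n + 1), f w = ∑ w ∈ words n, ∑ k, f (w ++ [k]) := by
  rw [words, Finset.sum_image, Finset.sum_product]
  rintro ⟨v, k⟩ - ⟨v', k'⟩ - h
  simpa using h

lemma sum_words_add {M : Type*} [AddCommMonoid M] (m n : ℕ) (f : List (Fin 3) → M) :
    ∑ w ∈ words (m + n), f w = ∑ w ∈ words m, ∑ v ∈ words n, f (w ++ v) := by
  induction n generalizing f with
  | zero => simp [words]
  | succ n ih => simp only [← add_assoc, sum_words_succ, ih, List.append_assoc]

/-! ### The total area of the dual balls tends to zero -/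

/-- After shifting both variables to their lower bounds the difference has only nonnegative
coefficients. -/
lemma polynomial_bound {P e : ℝ} (hP : 37 / 10 ≤ P) (hE : P ^ 2 - P - 1 / 5 ≤ e) :
    (P - 1) * (P ^ 6 - 3 * P ^ 2 * (2 * P - 1) * e + 3 * e ^ 2) +
      (P ^ 4 - 2 * (2 * P - 1) * e) * e ≤ (P - 2 - 1 / 10) * e ^ 3 := by
  obtain ⟨t, ht, rfl⟩ : ∃ t, 0 ≤ t ∧ P = 37 / 10 + t := ⟨P - 37 / 10, by linarith, by ring⟩
  obtain ⟨d, hd, rfl⟩ : ∃ d, 0 ≤ d ∧ e = (37 / 10 + t) ^ 2 - (37 / 10 + t) - 1 / 5 + d :=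
    ⟨e - ((37 / 10 + t) ^ 2 - (37 / 10 + t) - 1 / 5), by linarith, by ring⟩
  rw [← sub_nonneg]
  ring_nf
  positivity

lemma sum_inv_pow_identity {a b c s : ℝ} (ha : 0 < a) (hb : 0 < b) (hc : 0 < c) :
    (s + a) / a ^ 3 + (s + b) / b ^ 3 + (s + c) / c ^ 3 =
      (s * ((a * b + b * c + c * a) ^ 3 -
          3 * (a * b + b * c + c * a) * (a + b + c) * (a * b * c) + 3 * (a * b * c) ^ 2) +
        ((a * b + b * c + c * a) ^ 2 - 2 * (a + b + c) * (a * b * c)) * (a * b * c)) /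
      (a * b * c) ^ 3 := by
  field_simp
  ring

/-- Everything is expressed through P = x + y + z + 2 and xyz: the numbers 1 + y + z, 1 + z + x, 1 +
x + y have elementary symmetric functions 2P − 1, P² and P² − P − xyz. The constraint gives x + y +
z ≥ √3 > 17/10 and xyz ≤ 1/5, which are the bounds in `polynomial_bound`. -/
lemma potential_bound {x y z : ℝ} (hx : 0 < x) (hy : 0 < y) (hz : 0 < z)
    (h : x * y + y * z + z * x = 1) :
    (x + 2 * (y + z) + 2) / (1 + y + z) ^ 3 + (y + 2 * (z + x) + 2) / (1 + z + x) ^ 3 +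
      (z + 2 * (x + y) + 2) / (1 + x + y) ^ 3 ≤ x + y + z - 1 / 10 := by
  have hs : 3 ≤ (x + y + z) ^ 2 := by
    nlinarith [sq_nonneg (x - y), sq_nonneg (y - z), sq_nonneg (z - x)]
  have hs' : 17 / 10 ≤ x + y + z := by nlinarith
  have hp : 3 * ((x + y + z) * (x * y * z)) ≤ 1 := by
    have e : (x * y + y * z + z * x) ^ 2 - 3 * ((x + y + z) * (x * y * z)) =
      ((x * y - y * z) ^ 2 + (y * z - z * x) ^ 2 + (z * x - x * y) ^ 2) / 2 := by ring
    rw [h] at e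
    nlinarith [sq_nonneg (x * y - y * z), sq_nonneg (y * z - z * x), sq_nonneg (z * x - x * y)]
  have hp' : x * y * z ≤ 1 / 5 := by
    have : 0 < x * y * z := by positivity
    nlinarith
  set P := x + y + z + 2 with hPdef
  have e1 : (1 + y + z) + (1 + z + x) + (1 + x + y) = 2 * P - 1 := by rw [hPdef]; ring
  have e2 : (1 + y + z) * (1 + z + x) + (1 + z + x) * (1 + x + y) + (1 + x + y) * (1 + y + z) =
      P ^ 2 := by rw [hPdef]; linear_combination h
  have e3 : (1 + y + z) * (1 + z + x) * (1 + x + y) = P ^ 2 - P - x * y * z := by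
    rw [hPdef]; linear_combination (x + y + z + 1) * h
  have key := sum_inv_pow_identity (a := 1 + y + z) (b := 1 + z + x) (c := 1 + x + y)
    (s := P - 1) (by positivity) (by positivity) (by positivity)
  have l1 : P - 1 + (1 + y + z) = x + 2 * (y + z) + 2 := by rw [hPdef]; ring
  have l2 : P - 1 + (1 + z + x) = y + 2 * (z + x) + 2 := by rw [hPdef]; ring
  have l3 : P - 1 + (1 + x + y) = z + 2 * (x + y) + 2 := by rw [hPdef]; ring
  have hE : 0 < (1 + y + z) * (1 + z + x) * (1 + x + y) := by positivity
  rw [l1, l2, l3, e1, e2, e3] at key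
  rw [e3] at hE
  rw [key, div_le_iff₀ (pow_pos hE 3)]
  have := polynomial_bound (P := P) (e := P ^ 2 - P - x * y * z) (by linarith) (by linarith)
  have l4 : x + y + z - 1 / 10 = P - 2 - 1 / 10 := by rw [hPdef]; ring
  rw [l4]
  calc _ = _ := by ring
    _ ≤ _ := this

lemma curvSum_Phi (hT : Tangential T) (k : Fin 3) : curvSum (Phi T k) =
    curvSum T + 2 / inradius T + 1 / (T (k + 1)).radius + 1 / (T (k + 2)).radius := by
  have h4 := one_div_soddy_radius T
  rw [curvSum, Phi_eq hT]
  fin_cases k <;> simp only [Fin.zero_eta, Fin.mk_one, Fin.reduceFinMk, Fin.isValue, zero_add,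
    Fin.reduceAdd, Function.update_self, ne_eq, Fin.reduceEq, not_false_eq_true,
    Function.update_of_ne, h4] <;> ring

/-- A quantity that, summed over the subcells, decreases by a definite proportion of the area of the
dual ball. -/
def potential (T : Fin 3 → Disk) : ℝ := curvSum T * inradius T ^ 3

lemma potential_nonneg (T : Fin 3 → Disk) : 0 ≤ potential T := by
  have := curvSum_pos T
  have := inradius_pos T
  unfold potential; positivity

/-- In the scale-free variables inradius / radius this is `potential_bound` times the squared
inradius. -/
lemma sum_potential_Phi_le (hT : Tangential T) :
    ∑ k, potential (Phi T k) + inradius T ^ 2 / 10 ≤ potential T := by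
  have hρ := inradius_pos T
  have r0 := (T 0).radius_pos
  have r1 := (T 1).radius_pos
  have r2 := (T 2).radius_pos
  set ρ := inradius T with hρdef
  set x := ρ / (T 0).radius with hx
  set y := ρ / (T 1).radius with hy
  set z := ρ / (T 2).radius with hz
  have hxyz : x * y + y * z + z * x = 1 := by
    have := one_div_inradius_sq T
    rw [← hρdef] at this
    have h2 : ρ ^ 2 * (1 / ρ) ^ 2 = 1 := by field_simp
    rw [this] at h2
    rw [← h2, hx, hy, hz]
    ring
  have key := potential_bound (x := x) (y := y) (z := z) (by positivity) (by positivity)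
    (by positivity) hxyz
  have hin : ∀ k, inradius (Phi T k) =
      ρ / (1 + ρ / (T (k + 1)).radius + ρ / (T (k + 2)).radius) := fun k => by
    have hk1 := (T (k + 1)).radius_pos
    have hk2 := (T (k + 2)).radius_pos
    rw [← one_div_one_div (inradius (Phi T k)), one_div_inradius_Phi hT, ← hρdef]
    field_simp
  have hpot : ∀ k, potential (Phi T k) = ρ ^ 2 * ((ρ * curvSum T + 2 + ρ / (T (k + 1)).radius +
      ρ / (T (k + 2)).radius) / (1 + ρ / (T (k + 1)).radius + ρ / (T (k + 2)).radius) ^ 3) :=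
    fun k => by
    have hk1 := (T (k + 1)).radius_pos
    have hk2 := (T (k + 2)).radius_pos
    rw [potential, hin, curvSum_Phi hT, ← hρdef, div_pow]
    field_simp
  have h0 : ρ * curvSum T = x + y + z := by
    rw [curvSum, hx, hy, hz]; ring
  have h1 : potential T = ρ ^ 2 * (x + y + z) := by
    rw [potential, ← h0, ← hρdef]; ring
  simp only [hpot, h1, Fin.sum_univ_three, h0, Fin.isValue, zero_add, Fin.reduceAdd, ← hx, ← hy,
    ← hz, ← mul_add]
  have l1 : x + y + z + 2 + y + z = x + 2 * (y + z) + 2 := by ring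
  have l2 : x + y + z + 2 + z + x = y + 2 * (z + x) + 2 := by ring
  have l3 : x + y + z + 2 + x + y = z + 2 * (x + y) + 2 := by ring
  rw [l1, l2, l3]
  have := mul_le_mul_of_nonneg_left key (pow_pos hρ 2).le
  linarith

lemma sum_potential_le (hT : Tangential T) (n : ℕ) :
    ∑ w ∈ words n, potential (cell T w) +
      ∑ m ∈ Finset.range n, (∑ w ∈ words m, inradius (cell T w) ^ 2) / 10 ≤ potential T := by
  induction n with
  | zero => simp [words, cell]
  | succ n ih =>
    refine le_trans ?_ ih
    rw [Finset.sum_range_succ, sum_words_succ, ← add_assoc, add_right_comm]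
    gcongr ?_ + _
    rw [Finset.sum_div, ← Finset.sum_add_distrib]
    refine Finset.sum_le_sum fun w _ => ?_
    simpa only [cell_concat] using sum_potential_Phi_le (hT.cell w)

/-- Every cell dissipates a tenth of its squared inradius from the potential, and the potential
stays nonnegative; so even the sum over all levels is finite. -/
lemma summable_sum_inradius_sq (hT : Tangential T) :
    Summable fun n => ∑ w ∈ words n, inradius (cell T w) ^ 2 := by
  refine summable_of_sum_range_le (c := 10 * potential T)
    (fun n => Finset.sum_nonneg fun w _ => sq_nonneg _) fun n => ?_
  have h1 := sum_potential_le hT n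
  have h2 : 0 ≤ ∑ w ∈ words n, potential (cell T w) :=
    Finset.sum_nonneg fun w _ => potential_nonneg _
  rw [← Finset.sum_div] at h1
  linarith

lemma tendsto_sum_inradius_sq (hT : Tangential T) :
    Tendsto (fun n => ∑ w ∈ words n, inradius (cell T w) ^ 2) atTop (𝓝 0) :=
  (summable_sum_inradius_sq hT).tendsto_atTop_zero

/-- The radii of the dual balls tend to zero uniformly. -/
lemma exists_inradius_lt (hT : Tangential T) {ε : ℝ} (hε : 0 < ε) :
    ∃ N, ∀ w : List (Fin 3), N ≤ w.length → inradius (cell T w) < ε := by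
  obtain ⟨N, hN⟩ := eventually_atTop.1
    ((tendsto_sum_inradius_sq hT).eventually_lt_const (pow_pos hε 2))
  refine ⟨N, fun w hw => ?_⟩
  have h1 : inradius (cell T w) ^ 2 ≤ ∑ v ∈ words w.length, inradius (cell T v) ^ 2 :=
    Finset.single_le_sum (f := fun v => inradius (cell T v) ^ 2) (fun v _ => sq_nonneg _)
      (mem_words.2 rfl)
  exact lt_of_pow_lt_pow_left₀ 2 hε.le (h1.trans_lt (hN _ hw))

/-! ### The energy forms of cells -/

/-- The difference of the values of a function at the two end points of side `l`. -/
def sideDiff (T : Fin 3 → Disk) (l : Fin 3) : (ℂ → ℝ) →ₗ[ℝ] ℝ :=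
  LinearMap.proj (R := ℝ) (φ := fun _ : ℂ => ℝ) (q T (l + 1)) -
    LinearMap.proj (R := ℝ) (φ := fun _ : ℂ => ℝ) (q T (l + 2))

lemma sideDiff_apply (T : Fin 3 → Disk) (l : Fin 3) (f : ℂ → ℝ) :
    sideDiff T l f = f (q T (l + 1)) - f (q T (l + 2)) := rfl

/-- The energy form on the three points of tangency. -/
def cellForm (T : Fin 3 → Disk) : LinearMap.BilinForm ℝ (ℂ → ℝ) :=
  ∑ l, cond T l • (LinearMap.mul ℝ ℝ).compl₁₂ (sideDiff T l) (sideDiff T l)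

lemma cellForm_apply (T : Fin 3 → Disk) (f g : ℂ → ℝ) :
    cellForm T f g = ∑ l, cond T l * (sideDiff T l f * sideDiff T l g) := by
  simp [cellForm, LinearMap.sum_apply]

/-- The energy form on the points of tangency of level `n`. -/
def levelForm (T : Fin 3 → Disk) (n : ℕ) : LinearMap.BilinForm ℝ (ℂ → ℝ) :=
  ∑ w ∈ words n, cellForm (cell T w)

lemma levelForm_apply (T : Fin 3 → Disk) (n : ℕ) (f g : ℂ → ℝ) :
    levelForm T n f g = ∑ w ∈ words n, cellForm (cell T w) f g := by
  simp [levelForm, LinearMap.sum_apply]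

lemma levelForm_zero (T : Fin 3 → Disk) : levelForm T 0 = cellForm T := by
  simp [levelForm, words, cell]

lemma levelForm_add (T : Fin 3 → Disk) (m n : ℕ) (f g : ℂ → ℝ) :
    levelForm T (m + n) f g = ∑ w ∈ words m, levelForm (cell T w) n f g := by
  simp only [levelForm_apply, sum_words_add, cell_append]

lemma levelForm_comm (T : Fin 3 → Disk) (n : ℕ) (f g : ℂ → ℝ) :
    levelForm T n f g = levelForm T n g f := by
  simp only [levelForm_apply, cellForm_apply]
  refine Finset.sum_congr rfl fun w _ => Finset.sum_congr rfl fun l _ => ?_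
  ring

lemma levelForm_self_nonneg (T : Fin 3 → Disk) (n : ℕ) (f : ℂ → ℝ) : 0 ≤ levelForm T n f f := by
  simp only [levelForm_apply, cellForm_apply]
  exact Finset.sum_nonneg fun w _ => Finset.sum_nonneg fun l _ =>
    mul_nonneg (cond_pos _ _).le (mul_self_nonneg _)

lemma q_mem_V {n : ℕ} {w : List (Fin 3)} (hw : w ∈ words n) (j : Fin 3) :
    q (cell T w) j ∈ V T n := ⟨w, mem_words.1 hw, j, rfl⟩

lemma sideDiff_congr {n : ℕ} {w : List (Fin 3)} (hw : w ∈ words n) {f f' : ℂ → ℝ}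
    (h : Set.EqOn f f' (V T n)) (l : Fin 3) :
    sideDiff (cell T w) l f = sideDiff (cell T w) l f' := by
  rw [sideDiff_apply, sideDiff_apply, h (q_mem_V hw _), h (q_mem_V hw _)]

/-- The forms live on all functions on the plane but see only the vertices of their level; thus
levels are compared without restriction maps. -/
lemma levelForm_congr {n : ℕ} {f f' g g' : ℂ → ℝ} (hf : Set.EqOn f f' (V T n))
    (hg : Set.EqOn g g' (V T n)) : levelForm T n f g = levelForm T n f' g' := by
  simp only [levelForm_apply, cellForm_apply]
  refine Finset.sum_congr rfl fun w hw => Finset.sum_congr rfl fun l _ => ?_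
  rw [sideDiff_congr hw hf, sideDiff_congr hw hg]

/-! ### Affine functions -/

/-- The affine function with constant term `a` and gradient `g`. -/
def affine (a : ℝ) (g : ℂ) : ℂ → ℝ := fun z => a + dot g z

/-- Summation by parts, with the currents through the vertices given by `flux_eq`. -/
lemma cellForm_affine (hT : Tangential T) (a : ℝ) (g : ℂ) (v : ℂ → ℝ) :
    cellForm T (affine a g) v =
      -∑ j, v (q T j) * dot g (Complex.I * ((T (j + 2)).center - (T (j + 1)).center)) := by
  simp only [← flux_eq hT, cellForm_apply, sideDiff_apply, Fin.sum_univ_three, affine, dot]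
  simp
  ring

/-- At an old vertex the subcell has the same two touching disks and hence the same current. At a
new vertex the same two disks touch for both subcells, in opposite order, and the currents cancel.
-/
lemma cellForm_Phi_affine (hT : Tangential T) (a : ℝ) (g : ℂ) (v : ℂ → ℝ) :
    ∑ k, cellForm (Phi T k) (affine a g) v = cellForm T (affine a g) v := by
  simp only [cellForm_affine (hT.Phi _), cellForm_affine hT]
  have h0 := q_Phi_comm T (show (0 : Fin 3) ≠ 1 by decide)
  have h1 := q_Phi_comm T (show (1 : Fin 3) ≠ 2 by decide)
  have h2 := q_Phi_comm T (show (2 : Fin 3) ≠ 0 by decide)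
  have e0 := Phi_self T 0
  have e1 := Phi_self T 1
  have e2 := Phi_self T 2
  have e (k j : Fin 3) (h : j ≠ k) := Phi_of_ne T h
  simp only [Fin.sum_univ_three, q_Phi, h0, h1, h2, Fin.isValue, zero_add, Fin.reduceAdd, e0, e1,
    e2, e 0 1 (by decide), e 0 2 (by decide), e 1 0 (by decide), e 1 2 (by decide),
    e 2 0 (by decide), e 2 1 (by decide)]
  simp only [dot, Complex.mul_re, Complex.mul_im, Complex.sub_re, Complex.sub_im, Complex.I_re,
    Complex.I_im]
  ring

lemma levelForm_affine (hT : Tangential T) (n : ℕ) (a : ℝ) (g : ℂ) (v : ℂ → ℝ) :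
    levelForm T n (affine a g) v = cellForm T (affine a g) v := by
  induction n with
  | zero => rw [levelForm_zero]
  | succ n ih =>
    rw [← ih, levelForm_apply, sum_words_succ, levelForm_apply]
    refine Finset.sum_congr rfl fun w _ => ?_
    simpa only [cell_concat] using cellForm_Phi_affine (hT.cell w) a g v

lemma exists_affine_eq (hT : Tangential T) (f : ℂ → ℝ) :
    ∃ (a : ℝ) (g : ℂ), ∀ j, affine a g (q T j) = f (q T j) := by
  have hc := hT.cross_q_ne_zero
  set z := q T 1 - q T 0 with hz
  set y := q T 2 - q T 0 with hy
  set s := f (q T 1) - f (q T 0) with hs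
  set t := f (q T 2) - f (q T 0) with ht
  set g : ℂ := ⟨(s * y.im - t * z.im) / cross z y, (t * z.re - s * y.re) / cross z y⟩ with hg
  have h1 : dot g z = s := by
    simp only [dot, hg]
    field_simp
    simp only [cross]
    ring
  have h2 : dot g y = t := by
    simp only [dot, hg]
    field_simp
    simp only [cross]
    ring
  have e (a b : ℂ) : dot g (a - b) = dot g a - dot g b := by
    simp only [dot, Complex.sub_re, Complex.sub_im]; ring
  rw [hz, e] at h1
  rw [hy, e] at h2
  refine ⟨f (q T 0) - dot g (q T 0), g, fun j => ?_⟩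
  fin_cases j <;> simp only [affine, Fin.zero_eta, Fin.mk_one, Fin.reduceFinMk] <;> linarith

/-- A function that is affine on every cell of level `m`. -/
def IsPiecewiseAffine (T : Fin 3 → Disk) (m : ℕ) (h : ℂ → ℝ) : Prop :=
  ∀ w ∈ words m, ∃ (a : ℝ) (g : ℂ), ∀ v i,
    h (q (cell T (w ++ v)) i) = affine a g (q (cell T (w ++ v)) i)

/-- The piecewise affine extension of a function from the points of level `m` to those of all higher
levels. -/
lemma exists_piecewise_affine (hT : Tangential T) (m : ℕ) (f : ℂ → ℝ) :
    ∃ h : ℂ → ℝ, Set.EqOn h f (V T m) ∧ IsPiecewiseAffine T m h := by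
  classical
  choose a g hag using fun w : List (Fin 3) => exists_affine_eq (hT.cell w) f
  -- The open dual balls of level `m` are disjoint and contain no vertex of level `m`, so the local
  -- affine pieces do not conflict and the given values are kept.
  set h : ℂ → ℝ := fun z => if hz : ∃ w ∈ words m, z ∈ dualBall (cell T w) then
    affine (a hz.choose) (g hz.choose) z else f z
  have h1 : ∀ w ∈ words m, ∀ z ∈ dualBall (cell T w), h z = affine (a w) (g w) z := by
    intro w hw z hz
    have hex : ∃ w ∈ words m, z ∈ dualBall (cell T w) := ⟨w, hw, hz⟩
    have : hex.choose = w := by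
      by_contra hne
      refine disjoint_dualBall_cell hT ?_ hne hex.choose_spec.2 (dualBall_subset _ hz)
      rw [mem_words.1 hw, mem_words.1 hex.choose_spec.1]
    simp only [h, dif_pos hex, this]
  have h2 : Set.EqOn h f (V T m) := by
    intro z hz
    refine dif_neg ?_
    rintro ⟨w, hw, hzw⟩
    exact notMem_dualBall_of_mem_V hT ((mem_words.1 hw).symm ▸ hz) hzw
  refine ⟨h, h2, fun w hw => ⟨a w, g w, fun v i => ?_⟩⟩
  rw [cell_append]
  rcases q_cell_mem_or (hT.cell w) v i with h3 | h3
  · exact h1 w hw _ h3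
  · rw [h3, hag, h2 (q_mem_V hw i)]

lemma cellForm_congr_left {f f' : ℂ → ℝ} (h : ∀ j, f (q T j) = f' (q T j)) (g : ℂ → ℝ) :
    cellForm T f g = cellForm T f' g := by
  simp only [cellForm_apply, sideDiff_apply, h]

/-- Cell by cell this is `levelForm_affine`. Since `g` is arbitrary, piecewise affine extensions are
orthogonal to all functions vanishing on the vertices of level `m`. -/
lemma IsPiecewiseAffine.levelForm_eq (hT : Tangential T) {m : ℕ} {h : ℂ → ℝ}
    (hh : IsPiecewiseAffine T m h) (k : ℕ) (g : ℂ → ℝ) :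
    levelForm T (m + k) h g = levelForm T m h g := by
  rw [levelForm_add, levelForm_apply]
  refine Finset.sum_congr rfl fun w hw => ?_
  obtain ⟨a, b, hab⟩ := hh w hw
  have h1 : levelForm (cell T w) k h g = levelForm (cell T w) k (affine a b) g := by
    simp only [levelForm_apply]
    refine Finset.sum_congr rfl fun v _ => cellForm_congr_left (fun j => ?_) g
    rw [← cell_append]
    exact hab v j
  have h2 : ∀ j, h (q (cell T w) j) = affine a b (q (cell T w) j) := fun j => by
    simpa using hab [] j
  rw [h1, levelForm_affine (hT.cell w), cellForm_congr_left h2]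

/-- Orthogonal decomposition of `g` into the piecewise affine extension `h` and `g - h`, which
vanishes on level `m`. -/
lemma levelForm_le_of_eqOn (hT : Tangential T) {m : ℕ} {f g : ℂ → ℝ}
    (hfg : Set.EqOn g f (V T m)) : levelForm T m f f ≤ levelForm T (m + 1) g g := by
  obtain ⟨h, h1, h2⟩ := exists_piecewise_affine hT m f
  have h3 := levelForm_self_nonneg T (m + 1) (g - h)
  have h4 : levelForm T (m + 1) h (g - h) = 0 := by
    rw [IsPiecewiseAffine.levelForm_eq hT h2 1]
    have : Set.EqOn (g - h) 0 (V T m) := fun z hz => by simp [hfg hz, h1 hz]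
    rw [levelForm_congr (fun _ _ => rfl) this, map_zero]
  have h5 : levelForm T (m + 1) h h = levelForm T m f f := by
    rw [IsPiecewiseAffine.levelForm_eq hT h2 1, levelForm_congr h1 h1]
  have h6 := levelForm_comm T (m + 1) g h
  simp only [map_sub, LinearMap.sub_apply] at h3 h4
  linarith

lemma levelForm_mono (hT : Tangential T) (f : ℂ → ℝ) : Monotone fun n => levelForm T n f f :=
  monotone_nat_of_le_succ fun _ => levelForm_le_of_eqOn hT fun _ _ => rfl

/-! ### Comparison with the arc lengths -/

/-- Half of the angle under which side `l` is seen from the centre of disk `l`. -/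
def halfAngle (T : Fin 3 → Disk) (l : Fin 3) : ℝ := Real.arctan (inradius T / (T l).radius)

lemma halfAngle_pos (T : Fin 3 → Disk) (l : Fin 3) : 0 < halfAngle T l := by
  rw [halfAngle, Real.arctan_pos]
  exact div_pos (inradius_pos T) (T l).radius_pos

lemma halfAngle_lt (T : Fin 3 → Disk) (l : Fin 3) : halfAngle T l < Real.pi / 2 :=
  Real.arctan_lt_pi_div_two _

lemma halfAngle_le (T : Fin 3 → Disk) (l : Fin 3) :
    halfAngle T l ≤ inradius T / (T l).radius := by
  have := Real.lt_tan (halfAngle_pos T l) (halfAngle_lt T l)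
  rw [halfAngle, Real.tan_arctan] at this
  exact this.le

/-- `cond` is the reciprocal of the sine of the angle of the side, and sin x ≤ x. -/
lemma one_le_halfAngle_mul_cond (T : Fin 3 → Disk) (l : Fin 3) :
    1 ≤ 2 * halfAngle T l * cond T l := by
  have hr := (T l).radius_pos
  have hρ := inradius_pos T
  have h1 := Real.sin_le (mul_pos two_pos (halfAngle_pos T l)).le
  set t := inradius T / (T l).radius with ht
  have h2 : Real.sin (2 * halfAngle T l) = 2 * t / (1 + t ^ 2) := by
    rw [Real.sin_two_mul, halfAngle, Real.sin_arctan, Real.cos_arctan, ← ht, mul_assoc,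
      div_mul_div_comm, mul_one, Real.mul_self_sqrt (by positivity), mul_div_assoc]
  have h3 : cond T l * (2 * t / (1 + t ^ 2)) = 1 := by
    rw [cond, ht]
    field_simp
    ring
  rw [← h3, mul_comm (2 * halfAngle T l), ← h2]
  exact mul_le_mul_of_nonneg_left h1 (cond_pos T l).le

/-- In the frame pointing to the incentre, the end points of side `l` have arguments ± `halfAngle`;
this is the plus sign. -/
lemma q_right_sub_mul (hT : Tangential T) (l : Fin 3) :
    (q T (l + 1) - (T l).center) * (starRingEnd ℂ) (incenter T - (T l).center) =
      (T l).radius * ((T l).radius + inradius T * Complex.I) := by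
  have h := norm_sq_eq_dot (dir T (l + 1))
  rw [norm_dir hT] at h
  rw [incenter_eq hT (l + 1), center_right]
  apply Complex.ext
  · simp only [dot] at *
    simp
    linear_combination (-(T l).radius ^ 2) * h
  · simp only [dot] at *
    simp
    linear_combination (-(T l).radius * inradius T) * h

lemma q_left_sub_mul (hT : Tangential T) (l : Fin 3) :
    (q T (l + 2) - (T l).center) * (starRingEnd ℂ) (incenter T - (T l).center) =
      (T l).radius * ((T l).radius - inradius T * Complex.I) := by
  have h := norm_sq_eq_dot (dir T (l + 2))
  rw [norm_dir hT] at h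
  rw [incenter_eq hT (l + 2), center_left]
  apply Complex.ext
  · simp only [dot] at *
    simp
    linear_combination (-(T l).radius ^ 2) * h
  · simp only [dot] at *
    simp
    linear_combination ((T l).radius * inradius T) * h

/-- The chord of a side has length 2rρ / √(r² + ρ²). This identity serves both the normalization and
the error estimate. -/
lemma cond_mul_norm_sq (hT : Tangential T) (l : Fin 3) :
    cond T l * ‖q T (l + 1) - q T (l + 2)‖ ^ 2 = 2 * inradius T * (T l).radius := by
  have hr := (T l).radius_pos
  have hρ := inradius_pos T
  have h1 : (q T (l + 1) - q T (l + 2)) * (starRingEnd ℂ) (incenter T - (T l).center) =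
      ((2 * (T l).radius * inradius T : ℝ) : ℂ) * Complex.I := by
    push_cast
    linear_combination q_right_sub_mul hT l - q_left_sub_mul hT l
  have h2 := congrArg (fun z => ‖z‖ ^ 2) h1
  simp only [norm_mul, RCLike.norm_conj, mul_pow, norm_incenter_sub_center_sq hT, Complex.norm_I,
    Complex.norm_real, Real.norm_eq_abs, sq_abs] at h2
  rw [cond]
  field_simp
  linear_combination h2

lemma dot_sq_le (g z : ℂ) : dot g z ^ 2 ≤ ‖g‖ ^ 2 * ‖z‖ ^ 2 := by
  rw [norm_sq_eq_dot, norm_sq_eq_dot]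
  simp only [dot]
  nlinarith [sq_nonneg (g.re * z.im - g.im * z.re)]

/-- The energy of the interpolation that is linear in the angle on every side. -/
def arcSum (T : Fin 3 → Disk) (n : ℕ) (f : ℂ → ℝ) : ℝ :=
  ∑ w ∈ words n, ∑ l, sideDiff (cell T w) l f ^ 2 / (2 * halfAngle (cell T w) l)

lemma arcSum_le_levelForm (T : Fin 3 → Disk) (n : ℕ) (f : ℂ → ℝ) :
    arcSum T n f ≤ levelForm T n f f := by
  simp only [arcSum, levelForm_apply, cellForm_apply]
  refine Finset.sum_le_sum fun w _ => Finset.sum_le_sum fun l _ => ?_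
  have h1 := one_le_halfAngle_mul_cond (cell T w) l
  have h2 := halfAngle_pos (cell T w) l
  rw [div_le_iff₀ (by positivity)]
  nlinarith [sq_nonneg (sideDiff (cell T w) l f)]

/-- For an affine function, the error made by exchanging the weights `cond` and 1 / (2 `halfAngle`)
is at most the squared gradient times the area of the dual ball. -/
lemma halfAngle_mul_cond_sq_le (hT : Tangential T) (l : Fin 3) (a : ℝ) (g : ℂ) :
    2 * halfAngle T l * (cond T l * sideDiff T l (affine a g)) ^ 2 ≤
      cond T l * (sideDiff T l (affine a g) * sideDiff T l (affine a g)) +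
        Real.pi * ‖g‖ ^ 2 * inradius T ^ 2 := by
  have hr := (T l).radius_pos
  have hρ := inradius_pos T
  have hη := halfAngle_pos T l
  have h1 : sideDiff T l (affine a g) = dot g (q T (l + 1) - q T (l + 2)) := by
    simp only [sideDiff_apply, affine, dot, Complex.sub_re, Complex.sub_im]; ring
  have h2 := dot_sq_le g (q T (l + 1) - q T (l + 2))
  have h3 := cond_mul_norm_sq hT l
  have h4 := one_le_halfAngle_mul_cond T l
  have h5 : (2 * halfAngle T l * cond T l - 1) * (2 * inradius T * (T l).radius) ≤
      Real.pi * inradius T ^ 2 := by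
    have e : (2 * halfAngle T l * cond T l - 1) * (2 * inradius T * (T l).radius) =
        2 * halfAngle T l * inradius T ^ 2 + 2 * (T l).radius ^ 2 * (halfAngle T l -
          inradius T / (T l).radius) := by
      rw [cond]
      field_simp
      ring
    have h6 := halfAngle_le T l
    have h7 := halfAngle_lt T l
    rw [e]
    nlinarith [mul_nonneg (pow_pos hr 2).le (sub_nonneg.2 h6), pow_pos hρ 2]
  rw [h1]
  have h6 : (2 * halfAngle T l * cond T l - 1) * cond T l *
      dot g (q T (l + 1) - q T (l + 2)) ^ 2 ≤ ‖g‖ ^ 2 * (Real.pi * inradius T ^ 2) := by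
    calc _ ≤ (2 * halfAngle T l * cond T l - 1) * cond T l *
          (‖g‖ ^ 2 * ‖q T (l + 1) - q T (l + 2)‖ ^ 2) := by
          refine mul_le_mul_of_nonneg_left h2 (mul_nonneg (by linarith) (cond_pos T l).le)
      _ = ‖g‖ ^ 2 * ((2 * halfAngle T l * cond T l - 1) * (2 * inradius T * (T l).radius)) := by
          rw [← h3]; ring
      _ ≤ _ := mul_le_mul_of_nonneg_left h5 (by positivity)
  linarith

/-- A bound for the energies that are linear in the angle is a bound for the discrete energies. -/
lemma levelForm_le_of_arcSum_le (hT : Tangential T) {f : ℂ → ℝ} {M : ℝ}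
    (hM : ∀ n, arcSum T n f ≤ M) (m : ℕ) : levelForm T m f f ≤ M := by
  obtain ⟨h, h1, h2⟩ := exists_piecewise_affine hT m f
  have h2' := h2
  choose! a g hag using h2
  set G := ∑ w ∈ words m, ‖g w‖ ^ 2
  -- Pairing `f` with its piecewise affine extension `h` at level `m + k` still gives the energy of
  -- level `m`. Splitting this pairing side by side bounds twice that energy by itself, an area term
  -- and `arcSum`.
  have hstep : ∀ k, levelForm T m f f ≤
      M + 3 * (Real.pi * G) * ∑ w ∈ words (m + k), inradius (cell T w) ^ 2 := by
    intro k
    have e1 : levelForm T (m + k) h f = levelForm T m f f := by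
      rw [h2'.levelForm_eq hT, levelForm_congr h1 fun _ _ => rfl]
    have e2 : levelForm T (m + k) h h = levelForm T m f f := by
      rw [h2'.levelForm_eq hT, levelForm_congr h1 h1]
    have e3 : 2 * levelForm T (m + k) h f ≤ levelForm T (m + k) h h +
        3 * (Real.pi * G) * ∑ w ∈ words (m + k), inradius (cell T w) ^ 2 +
        arcSum T (m + k) f := by
      simp only [levelForm_apply, cellForm_apply, arcSum, sum_words_add]
      simp only [Finset.mul_sum, ← Finset.sum_add_distrib]
      refine Finset.sum_le_sum fun w hw => Finset.sum_le_sum fun v hv => ?_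
      have hg : ‖g w‖ ^ 2 ≤ G :=
        Finset.single_le_sum (f := fun w => ‖g w‖ ^ 2) (fun _ _ => sq_nonneg _) hw
      have hsd : ∀ l, sideDiff (cell T (w ++ v)) l h =
          sideDiff (cell T (w ++ v)) l (affine (a w) (g w)) := fun l => by
        rw [sideDiff_apply, sideDiff_apply, hag w hw, hag w hw]
      have e4 : 3 * (Real.pi * G) * inradius (cell T (w ++ v)) ^ 2 =
          ∑ l : Fin 3, Real.pi * G * inradius (cell T (w ++ v)) ^ 2 := by
        simp; ring
      rw [e4, ← Finset.sum_add_distrib, ← Finset.sum_add_distrib]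
      refine Finset.sum_le_sum fun l _ => ?_
      have h3 := halfAngle_mul_cond_sq_le (hT.cell (w ++ v)) l (a w) (g w)
      rw [← hsd] at h3
      have h4 := halfAngle_pos (cell T (w ++ v)) l
      have h5 : Real.pi * ‖g w‖ ^ 2 * inradius (cell T (w ++ v)) ^ 2 ≤
          Real.pi * G * inradius (cell T (w ++ v)) ^ 2 := by
        gcongr
      set η := halfAngle (cell T (w ++ v)) l
      set A := cond (cell T (w ++ v)) l * sideDiff (cell T (w ++ v)) l h
      set B := sideDiff (cell T (w ++ v)) l f
      -- Young's inequality with weight `2 * η`, which produces exactly the terms of `arcSum`.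
      have h6 : 2 * (A * B) ≤ 2 * η * A ^ 2 + B ^ 2 / (2 * η) := by
        have : 2 * η * A ^ 2 + B ^ 2 / (2 * η) - 2 * (A * B) =
            (2 * η * A - B) ^ 2 / (2 * η) := by field_simp; ring
        have : 0 ≤ (2 * η * A - B) ^ 2 / (2 * η) := by positivity
        linarith
      rw [← mul_assoc (cond _ _) (sideDiff _ _ h) B]
      linarith
    have := hM (m + k)
    linarith
  have hlim : Tendsto (fun k => M + 3 * (Real.pi * G) *
      ∑ w ∈ words (m + k), inradius (cell T w) ^ 2) atTop (𝓝 (M + 3 * (Real.pi * G) * 0)) := by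
    refine (Tendsto.const_mul _ ?_).const_add _
    have := tendsto_sum_inradius_sq hT
    rw [← tendsto_add_atTop_iff_nat m] at this
    simpa only [add_comm m] using this
  have := ge_of_tendsto' hlim hstep
  linarith

/-! ### The area of a triangle -/

lemma volume_standard_triangle :
    volume {z : ℂ | 0 ≤ z.re ∧ 0 ≤ z.im ∧ z.re + z.im ≤ 1} = ENNReal.ofReal (1 / 2) := by
  have hm : MeasurableSet {p : ℝ × ℝ | 0 ≤ p.1 ∧ 0 ≤ p.2 ∧ p.1 + p.2 ≤ 1} := by
    refine (IsClosed.and ?_ (IsClosed.and ?_ ?_)).measurableSet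
    · exact isClosed_le continuous_const continuous_fst
    · exact isClosed_le continuous_const continuous_snd
    · exact isClosed_le (continuous_fst.add continuous_snd) continuous_const
  have h1 := Complex.volume_preserving_equiv_real_prod.measure_preimage hm.nullMeasurableSet
  have h2 : Complex.measurableEquivRealProd ⁻¹' {p : ℝ × ℝ | 0 ≤ p.1 ∧ 0 ≤ p.2 ∧ p.1 + p.2 ≤ 1} =
      {z : ℂ | 0 ≤ z.re ∧ 0 ≤ z.im ∧ z.re + z.im ≤ 1} := rfl
  rw [← h2, h1, Measure.volume_eq_prod, Measure.prod_apply hm]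
  have h3 : ∀ x : ℝ, volume (Prod.mk x ⁻¹' {p : ℝ × ℝ | 0 ≤ p.1 ∧ 0 ≤ p.2 ∧ p.1 + p.2 ≤ 1}) =
      (Set.Icc (0 : ℝ) 1).indicator (fun x => ENNReal.ofReal (1 - x)) x := fun x => by
    by_cases hx : x ∈ Set.Icc (0 : ℝ) 1
    · rw [Set.indicator_of_mem hx, ← sub_zero (1 - x), ← Real.volume_Icc]
      congr 1
      ext y
      simp only [Set.mem_preimage, Set.mem_ofPred_eq, Set.mem_Icc]
      constructor
      · rintro ⟨-, h2, h3⟩; exact ⟨h2, by linarith⟩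
      · rintro ⟨h2, h3⟩; exact ⟨hx.1, h2, by linarith⟩
    · rw [Set.indicator_of_notMem hx]
      convert measure_empty (μ := (volume : Measure ℝ))
      refine Set.eq_empty_of_forall_notMem ?_
      rintro y ⟨h1, h2, h3⟩
      simp only at h1 h2 h3
      exact hx ⟨h1, by linarith⟩
  simp only [h3]
  rw [lintegral_indicator measurableSet_Icc, ← ofReal_integral_eq_lintegral_ofReal]
  · rw [integral_Icc_eq_integral_Ioc, ← intervalIntegral.integral_of_le zero_le_one,
      intervalIntegral.integral_sub intervalIntegrable_const intervalIntegral.intervalIntegrable_id,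
      integral_id, intervalIntegral.integral_const]
    norm_num
  · exact (continuous_const.sub continuous_id).integrableOn_Icc
  · filter_upwards [ae_restrict_mem measurableSet_Icc] with x hx
    simpa using hx.2

/-- The triangle is an affine image of the standard one, and the determinant is the cross product.
-/
lemma volume_centerTriangle (hT : Tangential T) : volume.real (centerTriangle T) =
    cross ((T 1).center - (T 0).center) ((T 2).center - (T 0).center) / 2 := by
  set a := (T 1).center - (T 0).center with ha
  set b := (T 2).center - (T 0).center with hb
  have hc := hT.cross_pos
  set S := convexHull ℝ (Set.range fun j => (T j).center)
  -- The boundary of a convex set is a null set.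
  have hS : volume (interior S) = volume S := by
    have h1 : volume (frontier S) = 0 := (convex_convexHull ℝ _).addHaar_frontier volume
    refine le_antisymm (measure_mono interior_subset) ?_
    calc volume S ≤ volume (interior S ∪ frontier S) :=
          measure_mono (by rw [← closure_eq_interior_union_frontier]; exact subset_closure)
      _ ≤ volume (interior S) + volume (frontier S) := measure_union_le _ _
      _ = volume (interior S) := by rw [h1, add_zero]
  set L : ℂ →ₗ[ℝ] ℂ :=
    { toFun := fun z => z.re * a + z.im * b
      map_add' := fun z w => by simp; ring
      map_smul' := fun c z => by simp; ring }
  have hL : ∀ z, L z = z.re * a + z.im * b := fun _ => rfl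
  have hdet : LinearMap.det L = cross a b := by
    rw [← LinearMap.det_toMatrix Complex.basisOneI, Matrix.det_fin_two]
    simp [LinearMap.toMatrix_apply, hL, cross]
    ring
  have hSL : S = (fun z => (T 0).center + z) ''
      (L '' {z : ℂ | 0 ≤ z.re ∧ 0 ≤ z.im ∧ z.re + z.im ≤ 1}) := by
    apply Set.Subset.antisymm
    · refine convexHull_min ?_ ?_
      · rintro _ ⟨j, rfl⟩
        fin_cases j
        · exact ⟨_, ⟨0, by simp, rfl⟩, by simp [hL]⟩
        · exact ⟨_, ⟨1, by simp, rfl⟩, by simp [hL, ha]⟩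
        · exact ⟨_, ⟨Complex.I, by simp, rfl⟩, by simp [hL, hb]⟩
      · refine Convex.translate ?_ _
        refine Convex.linear_image ?_ L
        rintro x ⟨h1, h2, h3⟩ y ⟨h4, h5, h6⟩ s t hs ht hst
        refine ⟨?_, ?_, ?_⟩ <;>
          simp only [Complex.add_re, Complex.add_im, Complex.smul_re, Complex.smul_im, smul_eq_mul]
        · positivity
        · positivity
        · nlinarith
    · rintro _ ⟨_, ⟨z, ⟨h1, h2, h3⟩, rfl⟩, rfl⟩
      have := (convex_convexHull ℝ (Set.range fun j => (T j).center)).sum_mem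
        (t := Finset.univ) (w := ![1 - z.re - z.im, z.re, z.im])
        (z := fun j => (T j).center) ?_ ?_ ?_
      · convert this using 1
        rw [Fin.sum_univ_three]
        simp [hL, ha, hb]
        ring
      · intro i _
        fin_cases i <;> simp
        · linarith
        · exact h1
        · exact h2
      · rw [Fin.sum_univ_three]; simp; ring
      · intro i _
        exact subset_convexHull ℝ _ ⟨i, rfl⟩
  rw [centerTriangle, Measure.real, hS, hSL, Set.image_add_left, measure_preimage_add,
    Measure.addHaar_image_linearMap, hdet, volume_standard_triangle, abs_of_pos hc,
    ← ENNReal.ofReal_mul hc.le, ENNReal.toReal_ofReal (by positivity)]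
  ring

/-! ### The explicit discrete forms -/

/-- Extension by zero as a linear map. -/
def extendLin (A : Set ℂ) : (A → ℝ) →ₗ[ℝ] (ℂ → ℝ) where
  toFun := extend
  map_add' := extend_add
  map_smul' := extend_smul

lemma extend_of_mem {A : Set ℂ} (u : A → ℝ) {z : ℂ} (hz : z ∈ A) : extend u z = u ⟨z, hz⟩ :=
  Subtype.val_injective.extend_apply u 0 ⟨z, hz⟩

lemma extend_of_notMem {A : Set ℂ} (u : A → ℝ) {z : ℂ} (hz : z ∉ A) : extend u z = 0 := by
  rw [extend, Function.extend_apply', Pi.zero_apply]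
  rintro ⟨a, rfl⟩
  exact hz a.2

lemma extend_restr {A B : Set ℂ} (h : B ⊆ A) (u : A → ℝ) :
    Set.EqOn (extend (restr h u)) (extend u) B := fun z hz => by
  rw [extend_of_mem _ hz, extend_of_mem _ (h hz)]; rfl

/-- The explicit discrete form of level `n`. -/
def discreteForm (T : Fin 3 → Disk) (n : ℕ) : LinearMap.BilinForm ℝ (V T n → ℝ) :=
  (levelForm T n).compl₁₂ (extendLin _) (extendLin _)

lemma discreteForm_apply (T : Fin 3 → Disk) (n : ℕ) (u v : V T n → ℝ) :
    discreteForm T n u v = levelForm T n (extend u) (extend v) := rfl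

lemma extend_ind {A : Set ℂ} (x : A) (z : ℂ) [Decidable (z = x)] :
    extend (ind x) z = if z = x then 1 else 0 := by
  by_cases hz : z ∈ A
  · rw [extend_of_mem _ hz, ind, Set.indicator_apply]
    simp [Subtype.ext_iff]
  · rw [extend_of_notMem _ hz, if_neg]
    rintro rfl
    exact hz x.2

lemma extend_ind_of_ne {A : Set ℂ} (x : A) {z : ℂ} (h : z ≠ x) : extend (ind x) z = 0 := by
  classical
  rw [extend_ind, if_neg h]

lemma V0_subset_V (T : Fin 3 → Disk) (n : ℕ) : V0 T ⊆ V T n := by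
  induction n with
  | zero => exact fun x hx => ⟨[], rfl, hx⟩
  | succ n ih => exact ih.trans (V_subset_succ T n)

/-- Truncation to [0, 1] is 1-Lipschitz and the conductances are positive. -/
lemma isDirichletForm_discreteForm (T : Fin 3 → Disk) (n : ℕ) :
    IsDirichletForm (discreteForm T n) := by
  refine ⟨fun u v => levelForm_comm _ _ _ _, fun u => levelForm_self_nonneg _ _ _, fun u => ?_⟩
  have h : ∀ z, extend ((u ⊔ 0) ⊓ 1) z = min (max (extend u z) 0) 1 := fun z => by
    by_cases hz : z ∈ V T n
    · simp [extend_of_mem _ hz]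
    · simp [extend_of_notMem _ hz]
  simp only [discreteForm_apply, levelForm_apply, cellForm_apply]
  refine Finset.sum_le_sum fun w _ => Finset.sum_le_sum fun l _ => ?_
  refine mul_le_mul_of_nonneg_left ?_ (cond_pos _ _).le
  rw [← sq, ← sq, sq_le_sq, sideDiff_apply, sideDiff_apply, h, h]
  exact (abs_inf_sub_inf_le_abs _ _ _).trans (abs_sup_sub_sup_le_abs _ _ _)

lemma sideDiff_eq_zero {n : ℕ} {w : List (Fin 3)} (x : V T n)
    (h : (x : ℂ) ∉ V0 (cell T w)) (l : Fin 3) : sideDiff (cell T w) l (extend (ind x)) = 0 := by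
  have h1 : ∀ j, extend (ind x) (q (cell T w) j) = 0 := fun j =>
    extend_ind_of_ne x fun he => h ⟨j, he⟩
  rw [sideDiff_apply, h1, h1, sub_zero]

lemma isLocal_discreteForm (n : ℕ) (x y : V T n)
    (h : ¬ ∃ w : List (Fin 3), w.length = n ∧ (x : ℂ) ∈ V0 (cell T w) ∧
      (y : ℂ) ∈ V0 (cell T w)) : discreteForm T n (ind x) (ind y) = 0 := by
  simp only [discreteForm_apply, levelForm_apply, cellForm_apply]
  refine Finset.sum_eq_zero fun w hw => Finset.sum_eq_zero fun l _ => ?_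
  by_cases hx : (x : ℂ) ∈ V0 (cell T w)
  · by_cases hy : (y : ℂ) ∈ V0 (cell T w)
    · exact absurd ⟨w, mem_words.1 hw, hx, hy⟩ h
    · rw [sideDiff_eq_zero y hy, mul_zero, mul_zero]
  · rw [sideDiff_eq_zero x hx, zero_mul, mul_zero]

lemma discreteForm_one (n : ℕ) (u : V T n → ℝ) : discreteForm T n u 1 = 0 := by
  simp only [discreteForm_apply, levelForm_apply, cellForm_apply]
  refine Finset.sum_eq_zero fun w hw => Finset.sum_eq_zero fun l _ => ?_
  rw [sideDiff_apply _ _ (extend 1), extend_of_mem _ (q_mem_V hw _), extend_of_mem _ (q_mem_V hw _)]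
  simp

lemma extend_h1 (A : Set ℂ) : Set.EqOn (extend (h1 A)) (affine 0 1) A := fun z hz => by
  rw [extend_of_mem _ hz]; simp [h1, affine, dot]

lemma extend_h2 (A : Set ℂ) : Set.EqOn (extend (h2 A)) (affine 0 Complex.I) A := fun z hz => by
  rw [extend_of_mem _ hz]; simp [h2, affine, dot]

/-- By `levelForm_affine` the pairing collapses to level 0, where only boundary values enter. -/
lemma isHarmonicOff_discreteForm (hT : Tangential T) (n : ℕ) (u : V T n → ℝ) (g : ℂ)
    (hu : Set.EqOn (extend u) (affine 0 g) (V T n)) :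
    IsHarmonicOff (discreteForm T n) (V0 T) u := by
  intro v hv
  have h0 : ∀ j, extend v (q T j) = 0 := fun j => by
    rw [extend_of_mem _ (V0_subset_V T n ⟨j, rfl⟩)]
    exact hv _ ⟨j, rfl⟩
  rw [discreteForm_apply, levelForm_congr hu fun _ _ => rfl, levelForm_affine hT,
    cellForm_apply]
  refine Finset.sum_eq_zero fun l _ => ?_
  rw [sideDiff_apply _ _ (extend v), h0, h0, sub_zero, mul_zero, mul_zero]

/-- The two coordinates together give squared chord lengths; `cond_mul_norm_sq` turns the sum into
2ρ times the semiperimeter. -/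
lemma sum_cellForm_coordinates (hT : Tangential T) :
    cellForm T (affine 0 1) (affine 0 1) + cellForm T (affine 0 Complex.I) (affine 0 Complex.I) =
      cross ((T 1).center - (T 0).center) ((T 2).center - (T 0).center) := by
  rw [cellForm_apply, cellForm_apply, ← Finset.sum_add_distrib]
  have h : ∀ l, cond T l * (sideDiff T l (affine 0 1) * sideDiff T l (affine 0 1)) +
      cond T l * (sideDiff T l (affine 0 Complex.I) * sideDiff T l (affine 0 Complex.I)) =
      2 * inradius T * (T l).radius := fun l => by
    rw [← cond_mul_norm_sq hT, norm_sq_eq_dot]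
    simp only [sideDiff_apply, affine, dot]
    simp
    ring
  simp only [h, Fin.sum_univ_three]
  rw [hT.cross_eq, semiperimeter]
  ring

lemma isDiscreteForms_discreteForm (hT : Tangential T) : IsDiscreteForms T (discreteForm T) := by
  refine ⟨isDirichletForm_discreteForm T, fun m x y h => ⟨isLocal_discreteForm m x y h,
    discreteForm_one m _⟩, fun m => ⟨isHarmonicOff_discreteForm hT m _ _ (extend_h1 _),
    isHarmonicOff_discreteForm hT m _ _ (extend_h2 _)⟩, fun m u => ⟨?_, ?_⟩, fun m => ?_⟩
  -- The minimum is attained at the piecewise affine extension.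
  · obtain ⟨h, e1, e2⟩ := exists_piecewise_affine hT m (extend u)
    have e3 : Set.EqOn (extend (fun x : V T (m + 1) => h x)) h (V T (m + 1)) := fun z hz => by
      rw [extend_of_mem _ hz]
    refine ⟨fun x => h x, ?_, ?_⟩
    · funext x
      have := e1 x.2
      rw [extend_of_mem _ x.2] at this
      exact this
    · rw [discreteForm_apply, discreteForm_apply, levelForm_congr e3 e3, e2.levelForm_eq hT,
        levelForm_congr e1 e1]
  · rintro _ ⟨v, rfl, rfl⟩
    refine levelForm_le_of_eqOn hT fun z hz => ?_
    exact (extend_restr (V_subset_succ T m) v hz).symm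
  · rw [discreteForm_apply, discreteForm_apply, levelForm_congr (extend_h1 _) (extend_h1 _),
      levelForm_congr (extend_h2 _) (extend_h2 _), levelForm_affine hT, levelForm_affine hT,
      sum_cellForm_coordinates hT, volume_centerTriangle hT]
    ring

/-! ### Bilinear forms on functions on a finite set -/

section finite

variable {A : Set ℂ} [Fintype A]

lemma eq_sum_ind (u : A → ℝ) : u = ∑ x, u x • ind x := by
  classical
  funext y
  rw [Finset.sum_apply, Finset.sum_eq_single y]
  · simp [ind]
  · intro x _ hx
    simp [ind, Ne.symm hx]
  · simp

lemma bilin_eq_sum_left (E : LinearMap.BilinForm ℝ (A → ℝ)) (u v : A → ℝ) :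
    E u v = ∑ x, u x * E (ind x) v := by
  conv_lhs => rw [eq_sum_ind u]
  simp [LinearMap.sum_apply]

lemma bilin_eq_sum_right (E : LinearMap.BilinForm ℝ (A → ℝ)) (u v : A → ℝ) :
    E u v = ∑ x, v x * E u (ind x) := by
  conv_lhs => rw [eq_sum_ind v]
  simp

/-- The diagonal entries are recovered from the row sums. -/
lemma bilin_ext {E E' : LinearMap.BilinForm ℝ (A → ℝ)}
    (h : ∀ x y, x ≠ y → E (ind x) (ind y) = E' (ind x) (ind y))
    (h1 : ∀ x, E (ind x) 1 = E' (ind x) 1) : E = E' := by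
  classical
  have hd : ∀ x y, E (ind x) (ind y) = E' (ind x) (ind y) := by
    intro x y
    by_cases hxy : x = y
    · subst hxy
      have h2 := h1 x
      rw [bilin_eq_sum_right E, bilin_eq_sum_right E', ← Finset.add_sum_erase _ _ (Finset.mem_univ x),
        ← Finset.add_sum_erase _ _ (Finset.mem_univ x)] at h2
      have h3 : ∑ y ∈ Finset.univ.erase x, (1 : A → ℝ) y * E (ind x) (ind y) =
          ∑ y ∈ Finset.univ.erase x, (1 : A → ℝ) y * E' (ind x) (ind y) :=
        Finset.sum_congr rfl fun y hy => by rw [h x y (Finset.ne_of_mem_erase hy).symm]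
      rw [h3, add_left_inj] at h2
      simpa only [Pi.one_apply, one_mul] using h2
    · exact h x y hxy
  refine LinearMap.ext fun u => LinearMap.ext fun v => ?_
  rw [bilin_eq_sum_left E, bilin_eq_sum_left E']
  refine Finset.sum_congr rfl fun x _ => ?_
  rw [bilin_eq_sum_right E, bilin_eq_sum_right E']
  simp only [hd]

end finite

/-- The energy of `u + t • v` is affine in `t` and nonnegative, so its slope vanishes. -/
lemma bilin_eq_zero_of_self {M : Type*} [AddCommGroup M] [Module ℝ M]
    {E : LinearMap.BilinForm ℝ M} (hs : ∀ u v, E u v = E v u) (h0 : ∀ u, 0 ≤ E u u) {v : M}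
    (hv : E v v = 0) (u : M) : E u v = 0 := by
  have h : ∀ t : ℝ, 0 ≤ E u u + 2 * t * E u v := fun t => by
    have := h0 (u + t • v)
    simp only [map_add, map_smul, LinearMap.add_apply, LinearMap.smul_apply, smul_eq_mul, hv,
      hs v u] at this
    linarith
  by_contra hne
  have h1 := h (-(E u u + 1) / (2 * E u v))
  have h2 : 2 * (-(E u u + 1) / (2 * E u v)) * E u v = -(E u u + 1) := by field_simp
  linarith

/-- Truncating the indicator of `x` minus `t` times that of `y` leaves the indicator of `x`; the
Markov inequality for small `t` gives the sign. -/
lemma IsDirichletForm.offdiag_nonpos {A : Set ℂ} {E : LinearMap.BilinForm ℝ (A → ℝ)}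
    (hE : IsDirichletForm E) {x y : A} (hxy : x ≠ y) : E (ind x) (ind y) ≤ 0 := by
  classical
  have h : ∀ t : ℝ, 0 < t → 2 * E (ind x) (ind y) ≤ t * E (ind y) (ind y) := fun t ht => by
    have e : ((ind x - t • ind y) ⊔ 0) ⊓ 1 = ind x := by
      funext z
      simp only [ind, Pi.inf_apply, Pi.sup_apply, Pi.sub_apply, Pi.smul_apply, Pi.zero_apply,
        Pi.one_apply, Set.indicator_apply, Set.mem_singleton_iff, smul_eq_mul]
      by_cases h1 : z = x
      · subst h1
        simp [hxy]
      · by_cases h2 : z = y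
        · simp [h2, ht.le, hxy.symm]
        · simp [h1, h2]
    have h1 := hE.markov (ind x - t • ind y)
    rw [e] at h1
    simp only [map_sub, map_smul, LinearMap.sub_apply, LinearMap.smul_apply, smul_eq_mul,
      hE.symm (ind y) (ind x)] at h1
    nlinarith
  by_contra! hpos
  have hy := hE.nonneg (ind y)
  have h1 := h (E (ind x) (ind y) / (E (ind y) (ind y) + 1)) (by positivity)
  have h2 : E (ind x) (ind y) / (E (ind y) (ind y) + 1) * E (ind y) (ind y) ≤
      E (ind x) (ind y) := by
    rw [div_mul_eq_mul_div, div_le_iff₀ (by positivity)]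
    nlinarith
  linarith

instance finite_V (T : Fin 3 → Disk) (n : ℕ) : Finite (V T n) := by
  have : V T n ⊆ ⋃ w ∈ words n, V0 (cell T w) := by
    rintro x ⟨w, hw, hx⟩
    exact Set.mem_biUnion (mem_words.2 hw) hx
  exact ((words n).finite_toSet.biUnion fun w _ => Set.finite_range _).subset this

instance fintype_V (T : Fin 3 → Disk) (n : ℕ) : Fintype (V T n) := Fintype.ofFinite _

/-! ### Uniqueness of the discrete forms -/

/-- No point lies in the closed dual balls of all three subcells. If `x` misses that of subcell `k`,
then it shares no cell with `q T k`, whose cells all descend from subcell `k`. -/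
lemma exists_not_adjacent (hT : Tangential T) {n : ℕ} (hn : 1 ≤ n) (x : V T n) :
    ∃ y : V T n, ¬ ∃ w : List (Fin 3), w.length = n ∧ (x : ℂ) ∈ V0 (cell T w) ∧
      (y : ℂ) ∈ V0 (cell T w) := by
  obtain ⟨k, hk⟩ : ∃ k, (x : ℂ) ∉ closedDualBall (Phi T k) := by
    by_contra! h
    have h1 := eq_q_of_mem_Phi_of_mem_Phi hT (show (0 : Fin 3) ≠ 1 by decide) (h 0) (h 1)
    have h2 := eq_q_of_mem_Phi_of_mem_Phi hT (show (0 : Fin 3) ≠ 2 by decide) (h 0) (h 2)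
    exact absurd (q_injective (hT.Phi 0) (h1.symm.trans h2)) (by decide)
  refine ⟨⟨q T k, V0_subset_V T n ⟨k, rfl⟩⟩, ?_⟩
  rintro ⟨w, hw, hx, hy⟩
  cases w with
  | nil => simp at hw; omega
  | cons l w =>
    have sub := (V0_subset_closedDualBall ((hT.Phi l).cell w)).trans
      (closedDualBall_cell_subset (hT.Phi l) w)
    rcases mem_dualBall_or_of_mem_Phi hT (sub hy) with h | h
    · exact q_notMem_dualBall hT k h
    · obtain rfl := q_injective hT h
      exact hk (sub hx)

variable {E : (m : ℕ) → LinearMap.BilinForm ℝ (V T m → ℝ)}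

/-- For positive levels, locality applied to a non-adjacent pair gives zero row sums. On level 0 all
vertices are adjacent, and constants get energy zero from compatibility with level 1. -/
lemma IsDiscreteForms.apply_one (hT : Tangential T) (hE : IsDiscreteForms T E) (m : ℕ)
    (u : V T m → ℝ) : E m u 1 = 0 := by
  have hpos : ∀ m, 1 ≤ m → ∀ u, E m u 1 = 0 := fun m hm u => by
    rw [bilin_eq_sum_left]
    refine Finset.sum_eq_zero fun x _ => ?_
    obtain ⟨y, hy⟩ := exists_not_adjacent hT hm x
    rw [(hE.isLocal m x y hy).2, mul_zero]
  rcases Nat.eq_zero_or_pos m with rfl | hm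
  · refine bilin_eq_zero_of_self (hE.dirichlet 0).symm (hE.dirichlet 0).nonneg ?_ u
    refine le_antisymm ?_ ((hE.dirichlet 0).nonneg 1)
    have := (hE.compatible 0 1).2 ⟨1, rfl, rfl⟩
    rwa [hpos 1 le_rfl] at this
  · exact hpos m hm u

/-- Two vertices are adjacent if they belong to a common cell. -/
def Adjacent (T : Fin 3 → Disk) (n : ℕ) (x y : ℂ) : Prop :=
  ∃ w : List (Fin 3), w.length = n ∧ x ∈ V0 (cell T w) ∧ y ∈ V0 (cell T w)

lemma IsDiscreteForms.congr (hE : IsDiscreteForms T E) {m : ℕ} {u v : V T m → ℝ} {x : V T m}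
    (h : ∀ y : V T m, Adjacent T m y x → u y = v y) : E m u (ind x) = E m v (ind x) := by
  rw [bilin_eq_sum_left, bilin_eq_sum_left]
  refine Finset.sum_congr rfl fun y _ => ?_
  by_cases hy : Adjacent T m y x
  · rw [h y hy]
  · rw [(hE.isLocal m y x hy).1, mul_zero, mul_zero]

lemma IsDiscreteForms.affine_ind (hT : Tangential T) (hE : IsDiscreteForms T E) {m : ℕ}
    {x : V T m} (hx : (x : ℂ) ∉ V0 T) (a : ℝ) (g : ℂ) :
    E m (fun y => affine a g y) (ind x) = 0 := by
  have e : (fun y : V T m => affine a g y) =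
      a • (1 : V T m → ℝ) + (g.re • h1 (V T m) + g.im • h2 (V T m)) := by
    funext y
    simp [affine, dot, h1, h2]
  have hv : ∀ y : V T m, (y : ℂ) ∈ V0 T → ind x y = 0 := fun y hy => by
    refine Set.indicator_of_notMem ?_ _
    rintro rfl
    exact hx hy
  rw [e]
  simp only [map_add, map_smul, LinearMap.add_apply, LinearMap.smul_apply]
  rw [(hE.harmonic m).1 _ hv, (hE.harmonic m).2 _ hv, (hE.dirichlet m).symm, hE.apply_one hT]
  simp

lemma mem_dualBall_of_notMem_V (hT : Tangential T) {m : ℕ} {v : List (Fin 3)}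
    (hv : v.length = m) {i : Fin 3} {x : ℂ} (hx : x ∈ V0 (cell T (v ++ [i]))) (hxm : x ∉ V T m) :
    x ∈ dualBall (cell T v) := by
  obtain ⟨j, rfl⟩ := hx
  rw [cell_append] at hxm ⊢
  refine (q_cell_mem_or (hT.cell v) [i] j).resolve_right fun h => hxm ?_
  rw [h]
  exact q_mem_V (mem_words.2 hv) j

/-- The restriction of a piecewise affine function is harmonic at the new vertices. -/
lemma IsDiscreteForms.piecewise_affine_ind (hT : Tangential T) (hE : IsDiscreteForms T E) {m : ℕ}
    {h : ℂ → ℝ} (hh : IsPiecewiseAffine T m h) {x : V T (m + 1)} (hx : (x : ℂ) ∉ V T m) :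
    E (m + 1) (fun y => h y) (ind x) = 0 := by
  have split : ∀ w : List (Fin 3), w.length = m + 1 → ∃ v i, v.length = m ∧ w = v ++ [i] := by
    intro w hw
    have hne : w ≠ [] := by rintro rfl; simp at hw
    exact ⟨w.dropLast, w.getLast hne, by simp [hw], (List.dropLast_append_getLast hne).symm⟩
  obtain ⟨w, hw, hxw⟩ := x.2
  obtain ⟨v, i, hv, rfl⟩ := split w hw
  obtain ⟨a, g, hag⟩ := hh v (mem_words.2 hv)
  -- All neighbours of a new vertex belong to one cell of level `m`, where `h` agrees with a single
  -- affine function.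
  rw [← hE.affine_ind hT (x := x) (fun h0 => hx (V0_subset_V T m h0)) a g]
  refine hE.congr fun y => ?_
  rintro ⟨w', hw', hy, hx'⟩
  obtain ⟨v', i', hv', rfl⟩ := split w' hw'
  -- A new vertex lies in the open dual ball of its parent cell, which determines the parent.
  have hvv : v = v' := by
    by_contra hne
    refine disjoint_dualBall_cell hT (hv.trans hv'.symm) hne
      (mem_dualBall_of_notMem_V hT hv hxw hx) ?_
    exact dualBall_subset _ (mem_dualBall_of_notMem_V hT hv' hx' hx)
  subst hvv
  obtain ⟨j, hj⟩ := hy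
  rw [← hj]
  exact hag [i'] j

/-- Harmonicity at the new vertices makes the piecewise affine function the minimizer. Compatibility
then bounds one quadratic form by the other with equality at this function, so their first
variations agree. -/
lemma IsDiscreteForms.eq_of_piecewise_affine (hT : Tangential T) (hE : IsDiscreteForms T E)
    {m : ℕ} {h : ℂ → ℝ} (hh : IsPiecewiseAffine T m h) (v : V T (m + 1) → ℝ) :
    E (m + 1) (fun y => h y) v = E m (fun y => h y) (restr (V_subset_succ T m) v) := by
  have harm : ∀ v : V T (m + 1) → ℝ, restr (V_subset_succ T m) v = 0 →
      E (m + 1) (fun y => h y) v = 0 := fun v hv => by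
    rw [bilin_eq_sum_right]
    refine Finset.sum_eq_zero fun x _ => ?_
    by_cases hx : (x : ℂ) ∈ V T m
    · have : v x = 0 := congrFun hv ⟨x, hx⟩
      rw [this, zero_mul]
    · rw [hE.piecewise_affine_ind hT hh hx, mul_zero]
  have sy := (hE.dirichlet (m + 1)).symm
  set u : V T (m + 1) → ℝ := fun y => h y
  set u₀ : V T m → ℝ := fun y => h y
  have hu : restr (V_subset_succ T m) u = u₀ := rfl
  -- the function minimizes the energy among its extensions
  have hmin : E m u₀ u₀ = E (m + 1) u u := by
    refine le_antisymm ((hE.compatible m _).2 ⟨u, hu, rfl⟩) ?_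
    obtain ⟨v, hv, hv'⟩ := (hE.compatible m u₀).1
    rw [hv']
    have h1 := harm (v - u) (by rw [map_sub, hv, hu, sub_self])
    have h2 := (hE.dirichlet (m + 1)).nonneg (v - u)
    have h3 := sy v u
    simp only [map_sub, LinearMap.sub_apply] at h1 h2
    linarith
  -- Compatibility along the line in direction `v`; a quadratic polynomial without constant term is
  -- nonnegative for all `t` only if its linear coefficient is zero.
  have key : ∀ t : ℝ, 0 ≤ 2 * t * (E (m + 1) u v - E m u₀
      (restr (V_subset_succ T m) v)) + t ^ 2 * (E (m + 1) v v -
        E m (restr (V_subset_succ T m) v) (restr (V_subset_succ T m) v)) := fun t => by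
    have h1 := (hE.compatible m (u₀ + t • restr (V_subset_succ T m) v)).2
      ⟨u + t • v, by rw [map_add, map_smul, hu], rfl⟩
    have h2 := (hE.dirichlet m).symm u₀ (restr (V_subset_succ T m) v)
    have h3 := sy u v
    simp only [map_add, map_smul, LinearMap.add_apply, LinearMap.smul_apply, smul_eq_mul] at h1
    rw [← h2, ← h3] at h1
    linarith
  set D := E (m + 1) u v - E m u₀ (restr (V_subset_succ T m) v)
  set C := E (m + 1) v v - E m (restr (V_subset_succ T m) v) (restr (V_subset_succ T m) v)
  have hD : D = 0 := by
    by_contra hne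
    have hpos : 0 < |C| + 1 := by positivity
    have h1 := key (-D / (|C| + 1))
    have h2 : 2 * (-D / (|C| + 1)) * D + (-D / (|C| + 1)) ^ 2 * C =
        D ^ 2 / (|C| + 1) * (C / (|C| + 1) - 2) := by field_simp; ring
    rw [h2] at h1
    have h3 : C / (|C| + 1) ≤ 1 := by
      rw [div_le_one hpos]
      linarith [le_abs_self C]
    have h4 : 0 < D ^ 2 / (|C| + 1) := by positivity
    nlinarith
  linarith

/-! ### The flux of a discrete form through the vertices of a cell -/

lemma dot_add_right (g z w : ℂ) : dot g (z + w) = dot g z + dot g w := by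
  simp only [dot, Complex.add_re, Complex.add_im]; ring

lemma dot_ofReal_mul_right (g : ℂ) (r : ℝ) (z : ℂ) : dot g (r * z) = r * dot g z := by
  simp only [dot, Complex.re_ofReal_mul, Complex.im_ofReal_mul]; ring

lemma dot_sub_right (g z w : ℂ) : dot g (z - w) = dot g z - dot g w := by
  simp only [dot, Complex.sub_re, Complex.sub_im]; ring

/-- An affine function is determined by its values at the three points of tangency. -/
lemma affine_eq_of_forall_q (hT : Tangential T) {a a' : ℝ} {b b' : ℂ}
    (h : ∀ k, affine a b (q T k) = affine a' b' (q T k)) : affine a b = affine a' b' := by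
  have h1 : ∀ k, dot (b - b') (q T k - q T 0) = 0 := fun k => by
    have := h k
    have := h 0
    simp only [affine, dot, Complex.sub_re, Complex.sub_im] at *
    linarith
  have h2 : b = b' := by
    have h3 := hT.cross_q_ne_zero
    have h4 := h1 1
    have h5 := h1 2
    set z := q T 1 - q T 0
    set y := q T 2 - q T 0
    have h6 : (b - b').re * cross z y = 0 := by
      simp only [dot, cross] at *; linear_combination y.im * h4 - z.im * h5
    have h7 : (b - b').im * cross z y = 0 := by
      simp only [dot, cross] at *; linear_combination z.re * h5 - y.re * h4
    exact sub_eq_zero.1 (Complex.ext ((mul_eq_zero.1 h6).resolve_right h3)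
      ((mul_eq_zero.1 h7).resolve_right h3))
  subst h2
  have h3 : a = a' := add_right_cancel (h 0)
  rw [h3]

lemma eq_zero_of_cross_ne_zero {z y : ℂ} (h : cross z y ≠ 0) {a b : ℝ}
    (hab : (a : ℂ) * z + b * y = 0) : a = 0 ∧ b = 0 := by
  have h1 := congrArg Complex.re hab
  have h2 := congrArg Complex.im hab
  simp at h1 h2
  have h3 : a * cross z y = 0 := by
    simp only [cross]; linear_combination y.im * h1 - y.re * h2
  have h4 : b * cross z y = 0 := by
    simp only [cross]; linear_combination z.re * h2 - z.im * h1
  exact ⟨(mul_eq_zero.1 h3).resolve_right h, (mul_eq_zero.1 h4).resolve_right h⟩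

variable {E : (m : ℕ) → LinearMap.BilinForm ℝ (V T m → ℝ)}

/-- The conductance of the form `E m` between the end points of side `l` of the cell of `w`. -/
def edgeCond (E : (m : ℕ) → LinearMap.BilinForm ℝ (V T m → ℝ)) (m : ℕ) (w : List (Fin 3))
    (l : Fin 3) : ℝ :=
  -E m (fun y => Pi.single (M := fun _ : ℂ => ℝ) (q (cell T w) (l + 1)) 1 y)
    (fun y => Pi.single (M := fun _ : ℂ => ℝ) (q (cell T w) (l + 2)) 1 y)

/-- Writing indicators by `Pi.single` on the plane keeps membership proofs out of `edgeCond`. -/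
lemma ind_eq_single {A : Set ℂ} {x : ℂ} (hx : x ∈ A) :
    ind (⟨x, hx⟩ : A) = fun y : A => Pi.single (M := fun _ : ℂ => ℝ) x 1 y := by
  classical
  funext y
  simp [ind, Pi.single_apply, Subtype.ext_iff]

lemma edgeCond_eq (E : (m : ℕ) → LinearMap.BilinForm ℝ (V T m → ℝ)) {m : ℕ} {w : List (Fin 3)}
    (hw : w ∈ words m) (l : Fin 3) : edgeCond E m w l =
      -E m (ind ⟨q (cell T w) (l + 1), q_mem_V hw _⟩) (ind ⟨q (cell T w) (l + 2), q_mem_V hw _⟩) := by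
  rw [ind_eq_single, ind_eq_single, edgeCond]

lemma IsDiscreteForms.edgeCond_nonneg (hT : Tangential T) (hE : IsDiscreteForms T E) {m : ℕ}
    {w : List (Fin 3)} (hw : w ∈ words m) (l : Fin 3) : 0 ≤ edgeCond E m w l := by
  rw [edgeCond_eq E hw, neg_nonneg]
  refine (hE.dirichlet m).offdiag_nonpos fun h => ?_
  exact fin_three_one_ne_two l (q_injective (hT.cell w) (congrArg Subtype.val h))

/-- The flux through vertex `j` of the cell of `w`. -/
def flux (E : (m : ℕ) → LinearMap.BilinForm ℝ (V T m → ℝ)) (m : ℕ) (w : List (Fin 3))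
    (j : Fin 3) : ℂ :=
  edgeCond E m w (j + 1) * (q (cell T w) (j + 2) - q (cell T w) j) +
    edgeCond E m w (j + 2) * (q (cell T w) (j + 1) - q (cell T w) j)

/-- The affine function on the cell of `w` vanishing at vertex `j`, extended by zero. -/
def cutoff (T : Fin 3 → Disk) (w : List (Fin 3)) (j : Fin 3) (g : ℂ) : ℂ → ℝ :=
  (V0 (cell T w)).indicator fun z => dot g (z - q (cell T w) j)

/-- The cutoff vanishes at vertex `j` and off the cell, so only the other two vertices contribute.
Expressing the flux as a value of the form makes it comparable between levels. -/
lemma IsDiscreteForms.cutoff_ind (hT : Tangential T) (hE : IsDiscreteForms T E) {m : ℕ}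
    {w : List (Fin 3)} (hw : w ∈ words m) (j : Fin 3) (g : ℂ) :
    E m (fun y => cutoff T w j g y) (ind ⟨q (cell T w) j, q_mem_V hw j⟩) =
      -dot g (flux E m w j) := by
  have inj := q_injective (hT.cell w)
  have e : (fun y : V T m => cutoff T w j g y) =
      dot g (q (cell T w) (j + 1) - q (cell T w) j) • ind ⟨q (cell T w) (j + 1), q_mem_V hw _⟩ +
      dot g (q (cell T w) (j + 2) - q (cell T w) j) • ind ⟨q (cell T w) (j + 2), q_mem_V hw _⟩ := by
    rw [ind_eq_single, ind_eq_single]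
    funext y
    simp only [Pi.add_apply, Pi.smul_apply, Pi.single_apply, smul_eq_mul, cutoff]
    by_cases hy : (y : ℂ) ∈ V0 (cell T w)
    · rw [Set.indicator_of_mem hy]
      obtain ⟨i, hi⟩ := hy
      rw [← hi]
      simp only [inj.eq_iff]
      rcases fin_three_cases j i with rfl | rfl | rfl
      · simp
      · simp [(fin_three_one_ne_two j).symm]
      · simp [dot]
    · rw [Set.indicator_of_notMem hy, if_neg, if_neg]
      · simp
      · exact fun h => hy ⟨_, h.symm⟩
      · exact fun h => hy ⟨_, h.symm⟩
  rw [e, flux, edgeCond_eq E hw, edgeCond_eq E hw]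
  simp only [map_add, map_smul, LinearMap.add_apply, LinearMap.smul_apply, smul_eq_mul,
    dot_add_right, dot_ofReal_mul_right, fin_three_one_one, fin_three_one_two, fin_three_two_one,
    fin_three_two_two]
  rw [(hE.dirichlet m).symm (ind ⟨q (cell T w) j, _⟩)]
  ring

/-- By `IsDiscreteForms.eq_of_piecewise_affine` the cutoff can be replaced by its piecewise affine
extension one level higher. At all neighbours of the vertex this extension agrees with the cutoff of
subcell `j`: it is linear in the cell of `w` and zero in any other cell at the vertex. -/
lemma IsDiscreteForms.flux_concat (hT : Tangential T) (hE : IsDiscreteForms T E) {m : ℕ}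
    {w : List (Fin 3)} (hw : w ∈ words m) (j : Fin 3) :
    flux E (m + 1) (w ++ [j]) j = flux E m w j := by
  have hw' : w ++ [j] ∈ words (m + 1) := by rw [mem_words] at *; simp [hw]
  have hq : q (cell T (w ++ [j])) j = q (cell T w) j := by rw [cell_concat, q_Phi]
  have hxm := q_mem_V (T := T) hw j
  have hxm' := V_subset_succ T m hxm
  suffices h : ∀ g : ℂ, dot g (flux E (m + 1) (w ++ [j]) j) = dot g (flux E m w j) by
    have h1 := h 1
    have hI := h Complex.I
    apply Complex.ext
    · simpa [dot] using h1
    · simpa [dot] using hI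
  intro g
  rw [← neg_inj, ← hE.cutoff_ind hT hw, ← hE.cutoff_ind hT hw']
  obtain ⟨h, h1, h2⟩ := exists_piecewise_affine hT m (cutoff T w j g)
  have key := hE.eq_of_piecewise_affine hT h2 (ind ⟨q (cell T w) j, hxm'⟩)
  have e1 : restr (V_subset_succ T m) (ind ⟨q (cell T w) j, hxm'⟩) =
      ind ⟨q (cell T w) j, hxm⟩ := by
    rw [ind_eq_single, ind_eq_single]; rfl
  have e2 : (fun y : V T m => h y) = fun y : V T m => cutoff T w j g y :=
    funext fun y => h1 y.2
  have e3 : ind (⟨q (cell T (w ++ [j])) j, q_mem_V hw' j⟩ : V T (m + 1)) =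
      ind ⟨q (cell T w) j, hxm'⟩ := by simp only [hq]
  rw [e1, e2] at key
  rw [← key, e3]
  refine hE.congr fun y hy => ?_
  obtain ⟨w₁, hw₁, hyw, hxw⟩ := hy
  obtain ⟨v, i, rfl⟩ : ∃ v i, w₁ = v ++ [i] := by
    have hne : w₁ ≠ [] := by rintro rfl; simp at hw₁
    exact ⟨w₁.dropLast, w₁.getLast hne, (List.dropLast_append_getLast hne).symm⟩
  have hv : v.length = m := by simpa using hw₁
  have hvw : v ∈ words m := mem_words.2 hv
  obtain ⟨a, b, hab⟩ := h2 v hvw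
  by_cases hvw' : v = w
  · subst hvw'
    -- Subcell `i` keeps vertex `i` and has its other vertices inside the dual ball, so `q_j`
    -- belongs to subcell `j` only.
    obtain rfl : i = j := by
      obtain ⟨k, hk⟩ := hxw
      by_contra hne
      simp only [cell_concat] at hk
      by_cases hki : k = i
      · subst hki
        rw [q_Phi] at hk
        exact hne (q_injective (hT.cell v) hk)
      · exact q_notMem_dualBall (hT.cell v) j (hk ▸ q_Phi_mem_dualBall (hT.cell v) hki)
    have h3 : ∀ k, affine a b (q (cell T v) k) = dot g (q (cell T v) k - q (cell T v) i) := by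
      intro k
      have h4 := hab [] k
      rw [List.append_nil] at h4
      rw [← h4, h1 (q_mem_V hw k), cutoff,
        Set.indicator_of_mem (show q (cell T v) k ∈ V0 (cell T v) from ⟨k, rfl⟩)]
    have h5 : ∀ z, affine a b z = dot g (z - q (cell T v) i) := fun z => by
      rw [affine_eq_of_forall_q (hT.cell v) (a' := -dot g (q (cell T v) i)) (b' := g)
        fun k => by rw [h3, dot_sub_right]; simp only [affine]; ring]
      rw [dot_sub_right]; simp only [affine]; ring
    rw [cutoff, Set.indicator_of_mem hyw, hq, ← h5]
    obtain ⟨k, hk⟩ := hyw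
    rw [← hk]
    exact (hab [i] k).symm
  -- Another cell at this vertex shares no further vertex with the cell of `w`, so the cutoff
  -- vanishes at its three vertices and the extension vanishes on it.
  · have hx : q (cell T w) j ∈ V0 (cell T v) := by
      refine mem_V0_of_mem_V hT (hv.symm ▸ hxm) ?_
      refine closedDualBall_cell_subset (hT.cell v) [i] ?_
      rw [← cell_append]
      exact V0_subset_closedDualBall (hT.cell _) hxw
    have hy0 : h y = 0 := by
      have h3 : ∀ k, affine a b (q (cell T v) k) = 0 := by
        intro k
        have h4 := hab [] k
        rw [List.append_nil] at h4
        rw [← h4, h1 (q_mem_V hvw k), cutoff]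
        by_cases h5 : q (cell T v) k ∈ V0 (cell T w)
        · rw [Set.indicator_of_mem h5]
          have : q (cell T v) k = q (cell T w) j := by
            by_contra hne
            exact hvw' (eq_of_mem_V0_of_mem_V0 hT (hv.trans (mem_words.1 hw).symm) hne ⟨k, rfl⟩ h5
              hx ⟨j, rfl⟩)
          rw [this, sub_self]; simp [dot]
        · exact Set.indicator_of_notMem h5 _
      have h4 : affine a b = affine 0 0 :=
        affine_eq_of_forall_q (hT.cell v) fun k => by rw [h3]; simp [affine, dot]
      obtain ⟨k, hk⟩ := hyw
      rw [← hk, hab [i] k, h4]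
      simp [affine, dot]
    rw [hy0, cutoff]
    by_cases hyw' : (y : ℂ) ∈ V0 (cell T (w ++ [j]))
    · rw [Set.indicator_of_mem hyw', hq]
      by_cases hxy : (y : ℂ) = q (cell T w) j
      · rw [hxy]; simp [dot]
      · have := eq_of_mem_V0_of_mem_V0 hT (w := v ++ [i]) (w' := w ++ [j]) (by simp [hv, mem_words.1 hw])
          hxy hyw hyw' hxw ⟨j, hq⟩
        exact absurd (List.append_inj_left this (hv.trans (mem_words.1 hw).symm)) hvw'
    · rw [Set.indicator_of_notMem hyw']

lemma dot_q_sub_q (hT : Tangential T) (i j : Fin 3) :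
    dot (q T i - q T j) (q T i - q T j) =
      2 * inradius T * dot (q T i - q T j) (Complex.I * dir T j) := by
  rw [← mem_sphere_iff_dot (norm_I_mul_dir hT j) (inradius_pos T), ← incenter_eq hT,
    mem_sphere_iff_norm, norm_q_sub_incenter hT]

lemma dot_q_sub_q_nonneg (hT : Tangential T) (i j : Fin 3) :
    0 ≤ dot (q T i - q T j) (Complex.I * dir T j) := by
  have h1 := dot_q_sub_q hT i j
  have h2 := dot_self_nonneg (q T i - q T j)
  have h3 := inradius_pos T
  by_contra! h
  nlinarith

/-- The point lies on two circles through `q T j`, the incircle and the boundary of disk `j + 2`,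
whose normals there are orthogonal. Comparing their equations gives the ratio of the components. -/
lemma dot_q_right_dir (hT : Tangential T) (j : Fin 3) :
    dot (q T (j + 1) - q T j) (dir T j) =
      inradius T / (T (j + 2)).radius * dot (q T (j + 1) - q T j) (Complex.I * dir T j) := by
  have hr := (T (j + 2)).radius_pos
  have h1 := (q_mem_sphere_iff hT (l := j + 2) (j := j + 1)).2 (fin_three_one_ne_two j)
  rw [center_succ_succ, mem_sphere_iff_dot (norm_dir hT j) hr, dot_q_sub_q hT] at h1
  field_simp
  linarith

lemma dot_q_left_dir (hT : Tangential T) (j : Fin 3) :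
    dot (q T (j + 2) - q T j) (dir T j) =
      -(inradius T / (T (j + 1)).radius * dot (q T (j + 2) - q T j) (Complex.I * dir T j)) := by
  have hr := (T (j + 1)).radius_pos
  have h1 := (q_mem_sphere_iff hT (l := j + 1) (j := j + 2)).2 (fin_three_one_ne_two j).symm
  rw [center_succ, sub_eq_add_neg, ← mul_neg, mem_sphere_iff_dot (by rw [norm_neg, norm_dir hT]) hr,
    dot_q_sub_q hT, dot_neg_right] at h1
  field_simp
  linarith

/-- With nonnegative conductances, the component along the line of centres is at most the inradius
times a factor that involves only the two touching disks, times the orthogonal component. -/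
lemma abs_dot_dir_le (hT : Tangential T) (j : Fin 3) {a b : ℝ} (ha : 0 ≤ a) (hb : 0 ≤ b) {F : ℂ}
    (hF : F = a * (q T (j + 2) - q T j) + b * (q T (j + 1) - q T j)) :
    |dot (dir T j) F| ≤ inradius T * (1 / (T (j + 1)).radius + 1 / (T (j + 2)).radius) *
      dot (Complex.I * dir T j) F := by
  have h1 := (T (j + 1)).radius_pos
  have h2 := (T (j + 2)).radius_pos
  have hρ := inradius_pos T
  have h3 := mul_nonneg ha (dot_q_sub_q_nonneg hT (j + 2) j)
  have h4 := mul_nonneg hb (dot_q_sub_q_nonneg hT (j + 1) j)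
  rw [hF, dot_add_right, dot_add_right, dot_ofReal_mul_right, dot_ofReal_mul_right,
    dot_ofReal_mul_right, dot_ofReal_mul_right, dot_comm (dir T j), dot_comm (dir T j),
    dot_comm (_ * dir T j), dot_comm (_ * dir T j), dot_q_right_dir hT, dot_q_left_dir hT]
  set x := dot (q T (j + 2) - q T j) (Complex.I * dir T j)
  set y := dot (q T (j + 1) - q T j) (Complex.I * dir T j)
  have h5 : 0 ≤ inradius T / (T (j + 1)).radius * (a * x) := by positivity
  have h6 : 0 ≤ inradius T / (T (j + 2)).radius * (b * y) := by positivity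
  have h7 : 0 ≤ inradius T / (T (j + 1)).radius * (b * y) := by positivity
  have h8 : 0 ≤ inradius T / (T (j + 2)).radius * (a * x) := by positivity
  have e : inradius T * (1 / (T (j + 1)).radius + 1 / (T (j + 2)).radius) * (a * x + b * y) =
      inradius T / (T (j + 1)).radius * (a * x) + inradius T / (T (j + 2)).radius * (b * y) +
      (inradius T / (T (j + 1)).radius * (b * y) + inradius T / (T (j + 2)).radius * (a * x)) := by
    ring
  rw [e, abs_le]
  constructor <;> linarith

lemma cell_replicate (U : Fin 3 → Disk) (j : Fin 3) (k : ℕ) :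
    cell U (List.replicate k j) (j + 1) = U (j + 1) ∧
    cell U (List.replicate k j) (j + 2) = U (j + 2) ∧
    dir (cell U (List.replicate k j)) j = dir U j := by
  induction k with
  | zero => exact ⟨rfl, rfl, rfl⟩
  | succ k ih =>
    rw [List.replicate_succ', cell_concat, dir_Phi, Phi_of_ne _ (fin_three_ne_one j).symm,
      Phi_of_ne _ (fin_three_ne_two j).symm]
    exact ih

lemma IsDiscreteForms.flux_replicate (hT : Tangential T) (hE : IsDiscreteForms T E) {m : ℕ}
    {w : List (Fin 3)} (hw : w ∈ words m) (j : Fin 3) (k : ℕ) :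
    flux E (m + k) (w ++ List.replicate k j) j = flux E m w j := by
  induction k with
  | zero => simp
  | succ k ih =>
    have hw' : w ++ List.replicate k j ∈ words (m + k) := by
      rw [mem_words] at *; simp [hw]
    rw [List.replicate_succ', ← List.append_assoc, ← add_assoc, hE.flux_concat hT hw', ih]

/-- Repeating the letter `j` keeps the flux, the direction and the two disks, while the inradius in
`abs_dot_dir_le` tends to zero. -/
lemma IsDiscreteForms.dot_flux_dir (hT : Tangential T) (hE : IsDiscreteForms T E) {m : ℕ}
    {w : List (Fin 3)} (hw : w ∈ words m) (j : Fin 3) :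
    dot (dir (cell T w) j) (flux E m w j) = 0 := by
  set U := cell T w with hU
  set C := (1 / (U (j + 1)).radius + 1 / (U (j + 2)).radius) *
    dot (Complex.I * dir U j) (flux E m w j)
  have key : ∀ k, |dot (dir U j) (flux E m w j)| ≤
      inradius (cell T (w ++ List.replicate k j)) * C := fun k => by
    have hw' : w ++ List.replicate k j ∈ words (m + k) := by
      rw [mem_words] at *; simp [hw]
    obtain ⟨h1, h2, h3⟩ := cell_replicate U j k
    have h := abs_dot_dir_le (hT.cell (w ++ List.replicate k j)) j
      (hE.edgeCond_nonneg hT hw' (j + 1)) (hE.edgeCond_nonneg hT hw' (j + 2)) rfl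
    have hf := hE.flux_replicate hT hw j k
    rw [flux] at hf
    rw [hf, cell_append, ← hU, h1, h2, h3, mul_assoc] at h
    rwa [cell_append]
  by_contra hne
  have hpos := abs_pos.2 hne
  have hC : 0 < |C| + 1 := by positivity
  obtain ⟨N, hN⟩ := exists_inradius_lt hT (div_pos hpos hC)
  have h1 := hN (w ++ List.replicate N j) (by simp)
  have h2 := key N
  have h3 := inradius_pos (cell T (w ++ List.replicate N j))
  rw [lt_div_iff₀ hC] at h1
  nlinarith [le_abs_self C]

lemma eq_mul_of_dot_eq_zero {d F : ℂ} (hd : ‖d‖ = 1) (h : dot d F = 0) :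
    F = (dot (Complex.I * d) F : ℝ) * (Complex.I * d) := by
  have h1 := norm_sq_eq_dot d
  rw [hd] at h1
  apply Complex.ext
  · simp only [dot] at *
    simp
    linear_combination d.re * h - (-F.re) * h1
  · simp only [dot] at *
    simp
    linear_combination d.im * h - (-F.im) * h1

/-- On every cell, the conductances are a multiple of those of the explicit form. -/
lemma IsDiscreteForms.exists_edgeCond_eq (hT : Tangential T) (hE : IsDiscreteForms T E) {m : ℕ}
    {w : List (Fin 3)} (hw : w ∈ words m) : ∃ s : ℝ,
      (∀ l, edgeCond E m w l = s * cond (cell T w) l) ∧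
      ∀ j, flux E m w j =
        s * (Complex.I * ((cell T w (j + 2)).center - (cell T w (j + 1)).center)) := by
  set U := cell T w with hUdef
  have hU : Tangential U := hT.cell w
  have h1 : ∀ j, ∃ s : ℝ, flux E m w j =
      s * (Complex.I * ((U (j + 2)).center - (U (j + 1)).center)) := fun j => by
    refine ⟨dot (Complex.I * dir U j) (flux E m w j) /
      ((U (j + 1)).radius + (U (j + 2)).radius), ?_⟩
    have h2 := radius_add_ne_zero U j
    conv_lhs => rw [eq_mul_of_dot_eq_zero (norm_dir hU j) (hE.dot_flux_dir hT hw j)]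
    rw [center_sub_center]
    push_cast
    field_simp
  choose s hs using h1
  -- Each edge contributes opposite vectors at its two ends.
  have h2 : flux E m w 0 + flux E m w 1 + flux E m w 2 = 0 := by
    simp only [flux, Fin.isValue, zero_add, Fin.reduceAdd]
    ring
  rw [hs, hs, hs] at h2
  simp only [Fin.isValue, zero_add, Fin.reduceAdd] at h2
  -- The only linear relation among the sides of the triangle of centres is, up to a factor, that
  -- their sum is zero; hence the three factors coincide.
  have h3 := eq_zero_of_cross_ne_zero (a := s 2 - s 0) (b := s 0 - s 1) hU.cross_pos.ne' (by
    have h3 : Complex.I * (((s 2 - s 0 : ℝ) : ℂ) * ((U 1).center - (U 0).center) +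
        ((s 0 - s 1 : ℝ) : ℂ) * ((U 2).center - (U 0).center)) = 0 := by
      push_cast
      linear_combination h2
    exact (mul_eq_zero.1 h3).resolve_left Complex.I_ne_zero)
  have h4 : ∀ j, s j = s 0 := by
    intro j
    fin_cases j
    · rfl
    · exact (sub_eq_zero.1 h3.2).symm
    · exact sub_eq_zero.1 h3.1
  refine ⟨s 0, ?_, fun j => by rw [hs, h4]⟩
  -- The two edges at a vertex are linearly independent, so the flux determines the conductances.
  have h5 : ∀ j, ((edgeCond E m w (j + 1) - s 0 * cond U (j + 1) : ℝ) : ℂ) *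
      (q U (j + 2) - q U j) + ((edgeCond E m w (j + 2) - s 0 * cond U (j + 2) : ℝ) : ℂ) *
      (q U (j + 1) - q U j) = 0 := fun j => by
    have h6 := hs j
    rw [← flux_eq hU, h4, flux, ← hUdef] at h6
    push_cast
    linear_combination h6
  have hc := hU.cross_q_ne_zero
  have h6 := eq_zero_of_cross_ne_zero hc (a := edgeCond E m w 2 - s 0 * cond U 2)
    (b := edgeCond E m w 1 - s 0 * cond U 1) (by
      have := h5 0
      simp only [Fin.isValue, zero_add] at this
      linear_combination this)
  have hc' : cross (q U 2 - q U 1) (q U 0 - q U 1) ≠ 0 := by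
    convert hc using 1
    simp only [cross, Complex.sub_re, Complex.sub_im]; ring
  have h7 := eq_zero_of_cross_ne_zero hc' (a := edgeCond E m w 0 - s 0 * cond U 0)
    (b := edgeCond E m w 2 - s 0 * cond U 2) (by
      have := h5 1
      simp only [Fin.isValue, Fin.reduceAdd] at this
      linear_combination this)
  intro l
  fin_cases l
  · exact sub_eq_zero.1 h7.1
  · exact sub_eq_zero.1 h6.2
  · exact sub_eq_zero.1 h6.1

/-- A subcell inherits a flux together with the side of the triangle of centres it is proportional
to, and hence the factor. -/
lemma IsDiscreteForms.exists_forall_edgeCond_eq (hT : Tangential T) (hE : IsDiscreteForms T E) :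
    ∃ s : ℝ, ∀ m, ∀ w ∈ words m, ∀ l, edgeCond E m w l = s * cond (cell T w) l := by
  obtain ⟨s, -, hs⟩ := hE.exists_edgeCond_eq hT (w := []) (mem_words.2 rfl)
  have key : ∀ m, ∀ w ∈ words m, (∀ l, edgeCond E m w l = s * cond (cell T w) l) ∧
      ∀ j, flux E m w j =
        s * (Complex.I * ((cell T w (j + 2)).center - (cell T w (j + 1)).center)) := by
    have uniq : ∀ m, ∀ w ∈ words m, (∃ j, flux E m w j =
        s * (Complex.I * ((cell T w (j + 2)).center - (cell T w (j + 1)).center))) →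
        (∀ l, edgeCond E m w l = s * cond (cell T w) l) ∧ ∀ j, flux E m w j =
          s * (Complex.I * ((cell T w (j + 2)).center - (cell T w (j + 1)).center)) := by
      rintro m w hw ⟨j, hj⟩
      obtain ⟨s', h1, h2⟩ := hE.exists_edgeCond_eq hT hw
      have h3 := h2 j
      have h4 : (cell T w (j + 2)).center - (cell T w (j + 1)).center ≠ 0 := by
        rw [← norm_ne_zero_iff, (hT.cell w).dist_eq]
        have := (cell T w (j + 1)).radius_pos
        have := (cell T w (j + 2)).radius_pos
        positivity
      rw [hj] at h3
      have h5 : s = s' := by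
        have := mul_right_cancel₀ (mul_ne_zero Complex.I_ne_zero h4) h3
        exact_mod_cast this
      subst h5
      exact ⟨h1, h2⟩
    intro m
    induction m with
    | zero =>
      intro w hw
      obtain rfl : w = [] := List.length_eq_zero_iff.1 (mem_words.1 hw)
      exact uniq 0 [] hw ⟨0, hs 0⟩
    | succ m ih =>
      intro w hw
      obtain ⟨v, j, rfl⟩ : ∃ v j, w = v ++ [j] := by
        have hne : w ≠ [] := by rintro rfl; simp [mem_words] at hw
        exact ⟨w.dropLast, w.getLast hne, (List.dropLast_append_getLast hne).symm⟩
      have hv : v ∈ words m := by rw [mem_words] at *; simpa using hw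
      refine uniq _ _ hw ⟨j, ?_⟩
      rw [hE.flux_concat hT hv, (ih v hv).2, cell_concat, Phi_of_ne _ (fin_three_ne_one j).symm,
        Phi_of_ne _ (fin_three_ne_two j).symm]
  exact ⟨s, fun m w hw => (key m w hw).1⟩

lemma IsDiscreteForms.eq_smul (hT : Tangential T) (hE : IsDiscreteForms T E)
    {E' : (m : ℕ) → LinearMap.BilinForm ℝ (V T m → ℝ)} (hE' : IsDiscreteForms T E') {t : ℝ}
    (h : ∀ m, ∀ w ∈ words m, ∀ l, edgeCond E m w l = t * edgeCond E' m w l) (m : ℕ) :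
    E m = t • E' m := by
  refine bilin_ext (fun x y hxy => ?_) fun x => ?_
  · by_cases hadj : Adjacent T m x y
    · obtain ⟨w, hw, ⟨i, hi⟩, ⟨j, hj⟩⟩ := hadj
      have hw' : w ∈ words m := mem_words.2 hw
      have key : ∀ l, E m (ind ⟨q (cell T w) (l + 1), q_mem_V hw' _⟩)
          (ind ⟨q (cell T w) (l + 2), q_mem_V hw' _⟩) =
          (t • E' m) (ind ⟨q (cell T w) (l + 1), q_mem_V hw' _⟩)
          (ind ⟨q (cell T w) (l + 2), q_mem_V hw' _⟩) := fun l => by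
        have h1 := h m w hw' l
        rw [edgeCond_eq E hw', edgeCond_eq E' hw'] at h1
        simp only [LinearMap.smul_apply, smul_eq_mul]
        linarith
      obtain rfl : x = ⟨q (cell T w) i, q_mem_V hw' _⟩ := Subtype.ext hi.symm
      obtain rfl : y = ⟨q (cell T w) j, q_mem_V hw' _⟩ := Subtype.ext hj.symm
      have hij : j ≠ i := fun hij => hxy (by rw [hij])
      rcases fin_three_cases_of_ne hij with rfl | rfl
      · have := key (i + 2)
        simpa only [fin_three_two_one, fin_three_two_two] using this
      · have := key (i + 1)
        rw [(hE.dirichlet m).symm, LinearMap.smul_apply, LinearMap.smul_apply,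
          (hE'.dirichlet m).symm]
        simpa only [fin_three_one_one, fin_three_one_two, LinearMap.smul_apply] using this
    · rw [(hE.isLocal m x y hadj).1, LinearMap.smul_apply, LinearMap.smul_apply,
        (hE'.isLocal m x y hadj).1, smul_zero]
  · rw [hE.apply_one hT, LinearMap.smul_apply, LinearMap.smul_apply, hE'.apply_one hT, smul_zero]

lemma IsDiscreteForms.unique (hT : Tangential T) (hE : IsDiscreteForms T E)
    {E' : (m : ℕ) → LinearMap.BilinForm ℝ (V T m → ℝ)} (hE' : IsDiscreteForms T E') : E = E' := by
  obtain ⟨s, hs⟩ := hE.exists_forall_edgeCond_eq hT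
  obtain ⟨s', hs'⟩ := hE'.exists_forall_edgeCond_eq hT
  have hv : 0 < 2 * volume.real (centerTriangle T) := by
    rw [volume_centerTriangle hT]
    linarith [hT.cross_pos]
  -- A zero factor would give the zero form, against the positive area in the normalization.
  have h0 : s' ≠ 0 := by
    rintro rfl
    have h1 := hE'.eq_smul hT hE' (t := 0) (fun m w hw l => by simp [hs' m w hw l]) 0
    have h2 := hE'.normalized 0
    rw [h1] at h2
    simp at h2
    linarith
  have h1 := hE.eq_smul hT hE' (t := s / s') fun m w hw l => by
    rw [hs m w hw, hs' m w hw, ← mul_assoc, div_mul_cancel₀ _ h0]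
  have h2 : s / s' = 1 := by
    have h3 := hE.normalized 0
    rw [h1, ← hE'.normalized 0] at h3
    rw [← hE'.normalized 0] at hv
    simp only [LinearMap.smul_apply, smul_eq_mul, ← mul_add] at h3
    exact mul_right_cancel₀ hv.ne' (h3.trans (one_mul _).symm)
  funext m
  rw [h1, h2, one_smul]

/-! ### The sides of a triple in terms of the angle -/

/-- The angles of the points of side `l`, without its end points. -/
def sideAngles (T : Fin 3 → Disk) (l : Fin 3) : Set ℝ :=
  {θ | circleMap (T l).center (T l).radius θ ∈ dualBall T}

/-- `β` is an angle of the midpoint of side `l`. -/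
def IsMidAngle (T : Fin 3 → Disk) (l : Fin 3) (β : ℝ) : Prop :=
  incenter T - (T l).center = ‖incenter T - (T l).center‖ * Complex.exp (β * Complex.I)

lemma isOpen_sideAngles (T : Fin 3 → Disk) (l : Fin 3) : IsOpen (sideAngles T l) :=
  Metric.isOpen_ball.preimage (continuous_circleMap _ _)

lemma mem_sideAngles_add_iff {l : Fin 3} {θ : ℝ} :
    θ + 2 * Real.pi ∈ sideAngles T l ↔ θ ∈ sideAngles T l := by
  simp only [sideAngles, Set.mem_ofPred_eq, periodic_circleMap _ _ θ]

lemma norm_incenter_sub_center_pos (hT : Tangential T) (l : Fin 3) :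
    0 < ‖incenter T - (T l).center‖ := by
  have h := norm_incenter_sub_center_sq hT l
  have := (T l).radius_pos
  refine lt_of_le_of_ne (norm_nonneg _) fun h0 => ?_
  rw [← h0] at h
  nlinarith [sq_nonneg (inradius T)]

lemma norm_mul_cos_halfAngle (hT : Tangential T) (l : Fin 3) :
    ‖incenter T - (T l).center‖ * Real.cos (halfAngle T l) = (T l).radius := by
  have hr := (T l).radius_pos
  have h2 : 0 < Real.cos (halfAngle T l) := Real.cos_arctan_pos _
  rw [← pow_left_inj₀ (mul_nonneg (norm_nonneg _) h2.le) hr.le two_ne_zero, mul_pow,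
    norm_incenter_sub_center_sq hT, halfAngle, Real.cos_sq_arctan]
  field_simp

lemma norm_mul_sin_halfAngle (hT : Tangential T) (l : Fin 3) :
    ‖incenter T - (T l).center‖ * Real.sin (halfAngle T l) = inradius T := by
  have hr := (T l).radius_pos
  have h2 : 0 < Real.cos (halfAngle T l) := Real.cos_arctan_pos _
  rw [← Real.tan_mul_cos h2.ne', mul_left_comm, norm_mul_cos_halfAngle hT, halfAngle,
    Real.tan_arctan, div_mul_cancel₀ _ hr.ne']

namespace IsMidAngle

variable {l : Fin 3} {β : ℝ}

lemma dot_eq (h : IsMidAngle T l β) (θ : ℝ) :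
    dot (circleMap (T l).center (T l).radius θ - (T l).center) (incenter T - (T l).center) =
      (T l).radius * (‖incenter T - (T l).center‖ * Real.cos (θ - β)) := by
  unfold IsMidAngle at h
  rw [circleMap_sub_center, circleMap_zero]
  set N := ‖incenter T - (T l).center‖
  rw [h]
  simp only [dot, Complex.re_ofReal_mul, Complex.im_ofReal_mul, Complex.exp_ofReal_mul_I_re,
    Complex.exp_ofReal_mul_I_im, Real.cos_sub]
  ring

lemma mem_closedDualBall_iff (hT : Tangential T) (h : IsMidAngle T l β) {θ : ℝ} :
    circleMap (T l).center (T l).radius θ ∈ closedDualBall T ↔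
      Real.cos (halfAngle T l) ≤ Real.cos (θ - β) := by
  have hr := (T l).radius_pos
  have hx : ‖circleMap (T l).center (T l).radius θ - (T l).center‖ = (T l).radius := by
    simpa using hr.le
  rw [Apollonian.mem_closedDualBall_iff hT hx, h.dot_eq, sq, mul_le_mul_iff_right₀ hr]
  nth_rw 1 [← norm_mul_cos_halfAngle hT l]
  rw [mul_le_mul_iff_right₀ (norm_incenter_sub_center_pos hT l)]

lemma mem_sideAngles_iff (hT : Tangential T) (h : IsMidAngle T l β) {θ : ℝ} :
    θ ∈ sideAngles T l ↔ Real.cos (halfAngle T l) < Real.cos (θ - β) := by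
  have hr := (T l).radius_pos
  have hx : ‖circleMap (T l).center (T l).radius θ - (T l).center‖ = (T l).radius := by
    simpa using hr.le
  rw [sideAngles, Set.mem_ofPred_eq, mem_dualBall_iff hT hx, h.dot_eq, sq,
    mul_lt_mul_iff_right₀ hr]
  nth_rw 1 [← norm_mul_cos_halfAngle hT l]
  rw [mul_lt_mul_iff_right₀ (norm_incenter_sub_center_pos hT l)]

lemma circleMap_right (hT : Tangential T) (h : IsMidAngle T l β) :
    circleMap (T l).center (T l).radius (β + halfAngle T l) = q T (l + 1) := by
  have hN := norm_incenter_sub_center_pos hT l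
  have h1 := q_right_sub_mul hT l
  rw [← norm_mul_cos_halfAngle hT l, ← norm_mul_sin_halfAngle hT l] at h1
  have h2 : incenter T - (T l).center ≠ 0 := norm_pos_iff.1 hN
  have h3 : (starRingEnd ℂ) (incenter T - (T l).center) ≠ 0 :=
    (map_ne_zero _).2 h2
  rw [← sub_left_inj (a := (T l).center)]
  refine mul_right_cancel₀ h3 ?_
  rw [h1, circleMap_sub_center, circleMap_zero, ← norm_mul_cos_halfAngle hT l]
  unfold IsMidAngle at h
  set N := ‖incenter T - (T l).center‖
  rw [h]
  simp only [map_mul, Complex.conj_ofReal, ← Complex.exp_conj, Complex.conj_I, Complex.ofReal_add,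
    add_mul, Complex.exp_add]
  rw [mul_neg, Complex.exp_neg]
  push_cast
  rw [Complex.exp_mul_I (halfAngle T l)]
  field_simp [Complex.exp_ne_zero]

lemma circleMap_left (hT : Tangential T) (h : IsMidAngle T l β) :
    circleMap (T l).center (T l).radius (β - halfAngle T l) = q T (l + 2) := by
  have hN := norm_incenter_sub_center_pos hT l
  have h1 := q_left_sub_mul hT l
  rw [← norm_mul_cos_halfAngle hT l, ← norm_mul_sin_halfAngle hT l] at h1
  have h2 : incenter T - (T l).center ≠ 0 := norm_pos_iff.1 hN
  have h3 : (starRingEnd ℂ) (incenter T - (T l).center) ≠ 0 :=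
    (map_ne_zero _).2 h2
  rw [← sub_left_inj (a := (T l).center)]
  refine mul_right_cancel₀ h3 ?_
  rw [h1, circleMap_sub_center, circleMap_zero, ← norm_mul_cos_halfAngle hT l]
  unfold IsMidAngle at h
  set N := ‖incenter T - (T l).center‖
  rw [h]
  simp only [map_mul, Complex.conj_ofReal, ← Complex.exp_conj, Complex.conj_I, sub_eq_add_neg,
    Complex.ofReal_add, Complex.ofReal_neg, add_mul, Complex.exp_add]
  simp only [← sub_eq_add_neg]
  rw [mul_neg, Complex.exp_neg]
  push_cast
  rw [← Complex.ofReal_neg, Complex.exp_mul_I ((-halfAngle T l : ℝ) : ℂ)]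
  push_cast
  rw [Complex.cos_neg, Complex.sin_neg]
  field_simp [Complex.exp_ne_zero]
  ring

lemma add_two_pi_mul (h : IsMidAngle T l β) (k : ℤ) : IsMidAngle T l (β + k * (2 * Real.pi)) := by
  unfold IsMidAngle at *
  rw [Complex.ofReal_add, add_mul, Complex.exp_add]
  push_cast
  rw [mul_assoc (k : ℂ), Complex.exp_int_mul_two_pi_mul_I, mul_one]
  exact h

/-- Within half a turn of the mid angle the cosine is decreasing in the distance, so the cosine
condition becomes an interval. -/
lemma mem_Ioo_of_mem_sideAngles (hT : Tangential T) (h : IsMidAngle T l β) {θ : ℝ}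
    (hθ : |θ - β| ≤ Real.pi) : θ ∈ sideAngles T l ↔
      θ ∈ Set.Ioo (β - halfAngle T l) (β + halfAngle T l) := by
  have h1 := halfAngle_pos T l
  have h2 := halfAngle_lt T l
  have h3 := Real.pi_pos
  rw [h.mem_sideAngles_iff hT, ← Real.cos_abs (θ - β),
    Real.strictAntiOn_cos.lt_iff_gt ⟨h1.le, by linarith⟩ ⟨abs_nonneg _, hθ⟩, abs_lt]
  constructor <;> rintro ⟨h4, h5⟩ <;> constructor <;> linarith

lemma mem_Icc_of_mem_closedDualBall (hT : Tangential T) (h : IsMidAngle T l β) {θ : ℝ}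
    (hθ : |θ - β| ≤ Real.pi) : circleMap (T l).center (T l).radius θ ∈ closedDualBall T ↔
      θ ∈ Set.Icc (β - halfAngle T l) (β + halfAngle T l) := by
  have h1 := halfAngle_pos T l
  have h2 := halfAngle_lt T l
  have h3 := Real.pi_pos
  rw [h.mem_closedDualBall_iff hT, ← Real.cos_abs (θ - β),
    Real.strictAntiOn_cos.le_iff_ge ⟨h1.le, by linarith⟩ ⟨abs_nonneg _, hθ⟩, abs_le]
  constructor <;> rintro ⟨h4, h5⟩ <;> constructor <;> linarith

end IsMidAngle

lemma exists_isMidAngle (T : Fin 3 → Disk) (l : Fin 3) : ∃ β, IsMidAngle T l β :=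
  ⟨Complex.arg (incenter T - (T l).center), (Complex.norm_mul_exp_arg_mul_I _).symm⟩

lemma exists_isMidAngle_abs_sub_le (T : Fin 3 → Disk) (l : Fin 3) (θ : ℝ) :
    ∃ β, IsMidAngle T l β ∧ |θ - β| ≤ Real.pi := by
  obtain ⟨β, h⟩ := exists_isMidAngle T l
  obtain ⟨k, hk, -⟩ := existsUnique_add_zsmul_mem_Ioc Real.two_pi_pos β (θ - Real.pi)
  refine ⟨_, h.add_two_pi_mul k, ?_⟩
  rw [zsmul_eq_mul] at hk
  rw [abs_le]
  constructor <;> linarith [hk.1, hk.2]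

/-- The points of a closed side are its inner points and its end points. -/
lemma mem_side_cases (hT : Tangential T) {l : Fin 3} {θ : ℝ}
    (hθ : circleMap (T l).center (T l).radius θ ∈ closedDualBall T) :
    θ ∈ sideAngles T l ∨ circleMap (T l).center (T l).radius θ = q T (l + 1) ∨
      circleMap (T l).center (T l).radius θ = q T (l + 2) := by
  obtain ⟨β, h, hβ⟩ := exists_isMidAngle_abs_sub_le T l θ
  rw [h.mem_Icc_of_mem_closedDualBall hT hβ] at hθ
  rw [h.mem_Ioo_of_mem_sideAngles hT hβ]
  rcases hθ.1.eq_or_lt with h1 | h1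
  · exact Or.inr (Or.inr (by rw [← h1, h.circleMap_left hT]))
  rcases hθ.2.eq_or_lt with h2 | h2
  · exact Or.inr (Or.inl (by rw [h2, h.circleMap_right hT]))
  · exact Or.inl ⟨h1, h2⟩

lemma eq_q_of_mem_sphere_of_notMem_dualBall (hT : Tangential T) {l : Fin 3} {x : ℂ}
    (hx : x ∈ Metric.sphere (T l).center (T l).radius) (hB : x ∈ closedDualBall T)
    (hx' : x ∉ dualBall T) : ∃ j, j ≠ l ∧ x = q T j := by
  rw [← abs_of_pos (T l).radius_pos, ← range_circleMap] at hx
  obtain ⟨θ, rfl⟩ := hx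
  rcases mem_side_cases hT hB with h | h | h
  · exact absurd h hx'
  · exact ⟨_, (fin_three_ne_one l).symm, h⟩
  · exact ⟨_, (fin_three_ne_two l).symm, h⟩

/-! ### Integrals of periodic functions -/

lemma lintegral_periodic {φ : ℝ → ENNReal} (hφ : Function.Periodic φ (2 * Real.pi)) (a b : ℝ) :
    ∫⁻ θ in Set.Ioc a (a + 2 * Real.pi), φ θ = ∫⁻ θ in Set.Ioc b (b + 2 * Real.pi), φ θ := by
  refine (isAddFundamentalDomain_Ioc Real.two_pi_pos a).setLIntegral_eq
    (isAddFundamentalDomain_Ioc Real.two_pi_pos b) φ ?_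
  rintro ⟨_, k, rfl⟩ x
  have := hφ.zsmul k x
  rw [add_comm] at this
  exact this

lemma sideAngles_inter_Ioc (hT : Tangential T) {l : Fin 3} {β : ℝ} (h : IsMidAngle T l β) :
    sideAngles T l ∩ Set.Ioc (β - Real.pi) (β - Real.pi + 2 * Real.pi) =
      Set.Ioo (β - halfAngle T l) (β + halfAngle T l) := by
  have h1 := halfAngle_lt T l
  have h2 := halfAngle_pos T l
  ext θ
  constructor
  · rintro ⟨h3, h4⟩
    refine (h.mem_Ioo_of_mem_sideAngles hT ?_).1 h3
    rw [abs_le]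
    constructor <;> linarith [h4.1, h4.2]
  · intro h3
    refine ⟨(h.mem_Ioo_of_mem_sideAngles hT ?_).2 h3, ?_, ?_⟩
    · rw [abs_le]
      constructor <;> linarith [h3.1, h3.2]
    · linarith [h3.1]
    · linarith [h3.2]

/-- The window (0, 2π] may cut the side in two. By periodicity it can be moved so that it is centred
at the mid angle. -/
lemma setLIntegral_sideAngles (hT : Tangential T) {l : Fin 3} {β : ℝ} (h : IsMidAngle T l β)
    {φ : ℝ → ENNReal} (hφ : Function.Periodic φ (2 * Real.pi)) :
    ∫⁻ θ in sideAngles T l ∩ Set.Ioc 0 (2 * Real.pi), φ θ =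
      ∫⁻ θ in Set.Ioo (β - halfAngle T l) (β + halfAngle T l), φ θ := by
  have hm := (isOpen_sideAngles T l).measurableSet
  have hper : Function.Periodic ((sideAngles T l).indicator φ) (2 * Real.pi) := fun θ => by
    by_cases hθ : θ ∈ sideAngles T l
    · rw [Set.indicator_of_mem hθ, Set.indicator_of_mem (mem_sideAngles_add_iff.2 hθ), hφ]
    · rw [Set.indicator_of_notMem hθ,
        Set.indicator_of_notMem fun h => hθ (mem_sideAngles_add_iff.1 h)]
  have := lintegral_periodic hper 0 (β - Real.pi)
  rwa [zero_add, setLIntegral_indicator hm, setLIntegral_indicator hm, sideAngles_inter_Ioc hT h]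
    at this

lemma volume_sideAngles (hT : Tangential T) (l : Fin 3) :
    volume (sideAngles T l ∩ Set.Ioc 0 (2 * Real.pi)) = ENNReal.ofReal (2 * halfAngle T l) := by
  obtain ⟨β, h⟩ := exists_isMidAngle T l
  have := setLIntegral_sideAngles hT h (φ := fun _ => 1) fun _ => rfl
  rw [setLIntegral_one, setLIntegral_one, Real.volume_Ioo] at this
  rw [this]
  congr 1; ring

/-! ### The arcs and their sides -/

lemma closure_idealTriangle_subset (hT : Tangential T) :
    closure (idealTriangle T) ⊆ closedDualBall T :=
  closure_minimal (fun _ hx => Metric.ball_subset_closedBall ((mem_idealTriangle_iff hT).1 hx).1)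
    Metric.isClosed_closedBall

/-- The vertex is approached along the inner normal of the incircle: at distance t, the squared
distance to either touching centre is r² + t². -/
lemma q_mem_closure_idealTriangle (hT : Tangential T) (j : Fin 3) :
    q T j ∈ closure (idealTriangle T) := by
  have hρ := inradius_pos T
  set d := Complex.I * dir T j with hd
  have hdn : ‖d‖ = 1 := norm_I_mul_dir hT j
  have hcont : Tendsto (fun t : ℝ => q T j + t * d) (𝓝[>] 0) (𝓝 (q T j)) := by
    refine Tendsto.mono_left ?_ nhdsWithin_le_nhds
    have : Continuous fun t : ℝ => q T j + t * d := by fun_prop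
    simpa using this.tendsto 0
  refine mem_closure_of_tendsto hcont ?_
  have h1 : ∀ᶠ t : ℝ in 𝓝[>] 0, q T j + t * d ∉ Metric.closedBall (T j).center (T j).radius :=
    hcont.eventually (Metric.isClosed_closedBall.isOpen_compl.mem_nhds (q_notMem_closedBall hT j))
  have h2 : ∀ᶠ t : ℝ in 𝓝[>] 0, t < inradius T :=
    (eventually_lt_nhds hρ).filter_mono nhdsWithin_le_nhds
  filter_upwards [h1, h2, self_mem_nhdsWithin] with t h1 h2 h3
  have h3 : 0 < t := h3
  have side : ∀ (r : ℝ) (e : ℂ), 0 < r → e = dir T j ∨ e = -dir T j →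
      r < ‖q T j + t * d - (q T j + r * e)‖ := fun r e hr he => by
    rw [← pow_lt_pow_iff_left₀ hr.le (norm_nonneg _) two_ne_zero, norm_sq_eq_dot]
    have h4 := norm_sq_eq_dot (dir T j)
    rw [norm_dir hT] at h4
    have : dot (q T j + t * d - (q T j + r * e)) (q T j + t * d - (q T j + r * e)) =
        r ^ 2 + t ^ 2 := by
      simp only [dot] at h4
      rcases he with rfl | rfl <;> simp [dot, hd] <;>
        linear_combination (-(r ^ 2 + t ^ 2)) * h4
    rw [this]
    linarith [pow_pos h3 2]
  refine (mem_idealTriangle_iff hT).2 ⟨?_, fun k => ?_⟩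
  · rw [mem_ball_iff_norm, incenter_eq hT j, ← hd]
    have : q T j + t * d - (q T j + inradius T * d) = ((t - inradius T : ℝ) : ℂ) * d := by
      push_cast; ring
    rw [this, norm_mul, hdn, mul_one, Complex.norm_real, Real.norm_eq_abs, abs_of_neg (by linarith)]
    linarith
  · rcases fin_three_cases j k with rfl | rfl | rfl
    · rw [center_succ, sub_eq_add_neg (q T j), ← mul_neg]
      exact side _ _ (T _).radius_pos (Or.inr rfl)
    · rw [center_succ_succ]
      exact side _ _ (T _).radius_pos (Or.inl rfl)
    · rw [mem_closedBall_iff_norm, not_le] at h1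
      exact h1

/-- A point of the open side is approached radially from outside disk `l`; the other two closed
disks stay away because they meet disk `l` only in vertices. -/
lemma mem_closure_idealTriangle (hT : Tangential T) {l : Fin 3} {x : ℂ}
    (hx : x ∈ Metric.sphere (T l).center (T l).radius) (hB : x ∈ closedDualBall T) :
    x ∈ closure (idealTriangle T) := by
  have hr := (T l).radius_pos
  by_cases hxB : x ∈ dualBall T
  · have hcont : Tendsto (fun t : ℝ => x + t * (x - (T l).center)) (𝓝[>] 0) (𝓝 x) := by
      refine Tendsto.mono_left ?_ nhdsWithin_le_nhds
      have : Continuous fun t : ℝ => x + t * (x - (T l).center) := by fun_prop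
      simpa using this.tendsto 0
    refine mem_closure_of_tendsto hcont ?_
    have h1 : ∀ᶠ t : ℝ in 𝓝[>] 0, x + t * (x - (T l).center) ∈ dualBall T :=
      hcont.eventually (Metric.isOpen_ball.mem_nhds hxB)
    have h2 : ∀ᶠ t : ℝ in 𝓝[>] 0, ∀ j, j ≠ l →
        x + t * (x - (T l).center) ∉ Metric.closedBall (T j).center (T j).radius := by
      rw [eventually_all]
      intro j
      by_cases hj : j = l
      · exact Eventually.of_forall fun _ h => absurd hj h
      · refine (hcont.eventually (Metric.isClosed_closedBall.isOpen_compl.mem_nhds ?_)).mono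
          fun _ h _ => h
        intro h
        obtain ⟨k, -, -, rfl⟩ := eq_q_of_mem_of_mem hT hj h (Metric.sphere_subset_closedBall hx)
        exact q_notMem_dualBall hT k hxB
    filter_upwards [h1, h2, self_mem_nhdsWithin] with t h1 h2 h3
    have h3 : 0 < t := h3
    refine (mem_idealTriangle_iff hT).2 ⟨h1, fun j => ?_⟩
    by_cases hj : j = l
    · subst hj
      rw [mem_sphere_iff_norm] at hx
      have : x + t * (x - (T j).center) - (T j).center =
          ((1 + t : ℝ) : ℂ) * (x - (T j).center) := by push_cast; ring
      rw [this, norm_mul, hx, Complex.norm_real, Real.norm_of_nonneg (by linarith)]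
      nlinarith
    · have := h2 j hj
      rwa [mem_closedBall_iff_norm, not_le] at this
  · obtain ⟨j, -, rfl⟩ := eq_q_of_mem_sphere_of_notMem_dualBall hT hx hB hxB
    exact q_mem_closure_idealTriangle hT j

/-- Side `l` of a triple, including its end points. -/
def side (T : Fin 3 → Disk) (l : Fin 3) : Set ℂ :=
  Metric.sphere (T l).center (T l).radius ∩ closedDualBall T

lemma arc_inl (hT : Tangential T) (l : Fin 3) : arc T (Sum.inl l) = side T l := by
  ext x
  simp only [arc, side, Disk.frontier_toSet, Set.mem_inter_iff]
  exact ⟨fun h => ⟨h.2, closure_idealTriangle_subset hT h.1⟩,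
    fun h => ⟨mem_closure_idealTriangle hT h.1 h.2, h.1⟩⟩

lemma arc_inr (T : Fin 3 → Disk) (w : List (Fin 3)) : arc T (Sum.inr w) =
    Metric.sphere (inDisk (cell T w)).center (inDisk (cell T w)).radius := by
  rw [arc, Disk.frontier_toSet]

lemma arc_subset_sphere (hT : Tangential T) (i : ArcIndex) :
    arc T i ⊆ Metric.sphere (arcDisk T i).center (arcDisk T i).radius := by
  cases i with
  | inl l => rw [arc_inl hT]; exact Set.inter_subset_left
  | inr w => rw [arc_inr]; exact subset_rfl

/-- The arc containing a side, for a word written backwards. -/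
def arcOfReverse : List (Fin 3) → Fin 3 → ArcIndex
  | [], l => Sum.inl l
  | k :: w, l => if l = k then Sum.inr w.reverse else arcOfReverse w l

/-- The index of the arc containing side `l` of the cell of `w`. -/
def arcOf (w : List (Fin 3)) (l : Fin 3) : ArcIndex := arcOfReverse w.reverse l

lemma arcOf_nil (l : Fin 3) : arcOf [] l = Sum.inl l := rfl

lemma arcOf_concat (w : List (Fin 3)) (k l : Fin 3) :
    arcOf (w ++ [k]) l = if l = k then Sum.inr w else arcOf w l := by
  simp [arcOf, arcOfReverse]

lemma arcOf_concat_self (w : List (Fin 3)) (k : Fin 3) : arcOf (w ++ [k]) k = Sum.inr w := by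
  rw [arcOf_concat, if_pos rfl]

lemma arcOf_concat_of_ne (w : List (Fin 3)) {k l : Fin 3} (h : l ≠ k) :
    arcOf (w ++ [k]) l = arcOf w l := by
  rw [arcOf_concat, if_neg h]

lemma length_lt_of_arcOf_eq {w v : List (Fin 3)} {l : Fin 3} (h : arcOf w l = Sum.inr v) :
    v.length < w.length := by
  induction w using List.reverseRecOn with
  | nil => simp [arcOf_nil] at h
  | append_singleton w k ih =>
    rw [arcOf_concat] at h
    split_ifs at h with h1
    · rw [← Sum.inr_injective h]; simp
    · have := ih h
      simp
      omega

/-- The newest side lies on the circle indexed by the parent word, while inherited sides have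
indices of smaller length or outer indices. -/
lemma arcOf_injective (w : List (Fin 3)) : Function.Injective (arcOf w) := by
  induction w using List.reverseRecOn with
  | nil => exact Sum.inl_injective
  | append_singleton w k ih =>
    intro l l' h
    by_cases h1 : l = k
    · by_cases h2 : l' = k
      · rw [h1, h2]
      · subst h1
        rw [arcOf_concat_self, arcOf_concat_of_ne _ h2] at h
        exact absurd (length_lt_of_arcOf_eq h.symm) (lt_irrefl _)
    · by_cases h2 : l' = k
      · subst h2
        rw [arcOf_concat_self, arcOf_concat_of_ne _ h1] at h
        exact absurd (length_lt_of_arcOf_eq h) (lt_irrefl _)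
      · rw [arcOf_concat_of_ne _ h1, arcOf_concat_of_ne _ h2] at h
        exact ih h

lemma arcDisk_arcOf (T : Fin 3 → Disk) (w : List (Fin 3)) (l : Fin 3) :
    arcDisk T (arcOf w l) = cell T w l := by
  induction w using List.reverseRecOn with
  | nil => rfl
  | append_singleton w k ih =>
    rw [cell_concat]
    by_cases h : l = k
    · subst h
      rw [arcOf_concat_self, Phi_self]; rfl
    · rw [arcOf_concat_of_ne _ h, Phi_of_ne _ h, ih]

lemma side_Phi_subset (hT : Tangential T) {k l : Fin 3} (h : l ≠ k) :
    side (Phi T k) l ⊆ side T l := by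
  rintro x ⟨h1, h2⟩
  rw [Phi_of_ne T h] at h1
  exact ⟨h1, closedDualBall_Phi_subset hT k h2⟩

lemma side_subset_arc (hT : Tangential T) (w : List (Fin 3)) (l : Fin 3) :
    side (cell T w) l ⊆ arc T (arcOf w l) := by
  induction w using List.reverseRecOn with
  | nil => rw [arcOf_nil, arc_inl hT]; exact subset_rfl
  | append_singleton w k ih =>
    rw [cell_concat]
    by_cases h : l = k
    · subst h
      rw [arcOf_concat_self, arc_inr]
      rintro x ⟨h1, -⟩
      rwa [Phi_self] at h1
    · rw [arcOf_concat_of_ne _ h]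
      exact (side_Phi_subset (hT.cell w) h).trans ih

lemma exists_side_succ (hT : Tangential T) {w : List (Fin 3)} {l : Fin 3} {x : ℂ}
    (hx : x ∈ side (cell T w) l) : ∃ k, k ≠ l ∧ x ∈ side (cell T (w ++ [k])) l := by
  obtain ⟨k, hk, hxk⟩ : ∃ k, k ≠ l ∧ x ∈ closedDualBall (Phi (cell T w) k) := by
    rcases mem_Phi_of_mem_side (hT.cell w) (mem_sphere_iff_norm.1 hx.1) hx.2 with h | h
    · exact ⟨_, (fin_three_ne_one l).symm, h⟩
    · exact ⟨_, (fin_three_ne_two l).symm, h⟩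
  refine ⟨k, hk, ?_⟩
  rw [cell_concat]
  refine ⟨?_, hxk⟩
  rw [Phi_of_ne _ hk.symm]
  exact hx.1

lemma exists_side_of_le (hT : Tangential T) {w : List (Fin 3)} {l : Fin 3} {x : ℂ}
    (hx : x ∈ side (cell T w) l) {n : ℕ} (hn : w.length ≤ n) :
    ∃ w' ∈ words n, arcOf w' l = arcOf w l ∧ x ∈ side (cell T w') l := by
  induction n, hn using Nat.le_induction with
  | base => exact ⟨w, mem_words.2 rfl, rfl, hx⟩
  | succ n hn ih =>
    obtain ⟨w', h1, h2, h3⟩ := ih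
    obtain ⟨k, hk, h4⟩ := exists_side_succ hT h3
    refine ⟨w' ++ [k], ?_, ?_, h4⟩
    · rw [mem_words] at *; simp [h1]
    · rw [arcOf_concat_of_ne _ hk.symm, h2]

/-- The level from which on an arc is a union of sides. -/
def arcLevel : ArcIndex → ℕ
  | Sum.inl _ => 0
  | Sum.inr w => w.length + 1

lemma exists_side_of_mem_arc (hT : Tangential T) {i : ArcIndex} {x : ℂ} (hx : x ∈ arc T i) {n : ℕ}
    (hn : arcLevel i ≤ n) : ∃ w ∈ words n, ∃ l, arcOf w l = i ∧ x ∈ side (cell T w) l := by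
  cases i with
  | inl l =>
    rw [arc_inl hT] at hx
    obtain ⟨w, h1, h2, h3⟩ := exists_side_of_le hT (w := []) hx hn
    exact ⟨w, h1, l, h2, h3⟩
  | inr v =>
    rw [arc_inr] at hx
    obtain ⟨k, hk⟩ := exists_mem_Phi_of_mem_inDisk (hT.cell v) (mem_sphere_iff_norm.1 hx)
    have hx' : x ∈ side (cell T (v ++ [k])) k := by
      rw [cell_concat]
      refine ⟨?_, hk⟩
      rw [Phi_self]
      exact hx
    obtain ⟨w, h1, h2, h3⟩ := exists_side_of_le hT hx' (n := n) (by simpa [arcLevel] using hn)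
    exact ⟨w, h1, k, h2.trans (arcOf_concat_self v k), h3⟩

lemma q_mem_side (hT : Tangential T) {j l : Fin 3} (h : j ≠ l) : q T j ∈ side T l :=
  ⟨(q_mem_sphere_iff hT).2 h, q_mem_closedDualBall hT j⟩

lemma VStar_subset_K0 (hT : Tangential T) : VStar T ⊆ K0 T := by
  intro x hx
  obtain ⟨n, w, -, j, rfl⟩ := Set.mem_iUnion.1 hx
  exact Set.mem_iUnion.2 ⟨_, side_subset_arc hT w (j + 1)
    (q_mem_side (hT.cell w) (fin_three_ne_one j))⟩

lemma q_cell_mem_VStar (T : Fin 3 → Disk) (w : List (Fin 3)) (j : Fin 3) :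
    q (cell T w) j ∈ VStar T := Set.mem_iUnion.2 ⟨_, w, rfl, j, rfl⟩

/-- A vertex on an arc is an end point of one of its sides. -/
lemma exists_endpoint_of_mem_arc (hT : Tangential T) {i : ArcIndex} {x : ℂ} (hx : x ∈ arc T i)
    (hV : x ∈ VStar T) : ∃ w l j, arcOf w l = i ∧ arcLevel i ≤ w.length ∧ j ≠ l ∧
      x = q (cell T w) j := by
  obtain ⟨n, hn⟩ := Set.mem_iUnion.1 hV
  obtain ⟨w, hw, l, h1, h2⟩ := exists_side_of_mem_arc hT hx (le_max_left (arcLevel i) n)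
  rw [mem_words] at hw
  have hmono : Monotone (V T) := monotone_nat_of_le_succ (V_subset_succ T)
  obtain ⟨j, hj⟩ := mem_V0_of_mem_V hT (w := w) (hw ▸ hmono (le_max_right _ _) hn) h2.2
  refine ⟨w, l, j, h1, hw ▸ le_max_left _ _, ?_, hj.symm⟩
  rw [← q_mem_sphere_iff (hT.cell w), hj]
  exact h2.1

/-- Different arcs meet in vertices only. -/
lemma mem_VStar_of_mem_arc_of_mem_arc (hT : Tangential T) {i i' : ArcIndex} (hne : i ≠ i') {x : ℂ}
    (hx : x ∈ arc T i) (hx' : x ∈ arc T i') : x ∈ VStar T := by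
  obtain ⟨w, hw, l, h1, h2⟩ := exists_side_of_mem_arc hT hx
    (le_max_left (arcLevel i) (arcLevel i'))
  obtain ⟨w', hw', l', h1', h2'⟩ := exists_side_of_mem_arc hT hx'
    (le_max_right (arcLevel i) (arcLevel i'))
  rw [mem_words] at hw hw'
  by_cases h : w = w'
  · subst h
    have hl : l ≠ l' := by rintro rfl; exact hne (h1.symm.trans h1')
    obtain ⟨j, -, -, rfl⟩ := eq_q_of_mem_of_mem (hT.cell w) hl
      (Metric.sphere_subset_closedBall h2.1) (Metric.sphere_subset_closedBall h2'.1)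
    exact q_cell_mem_VStar T w j
  · obtain ⟨j, rfl⟩ := mem_V0_of_mem_closedDualBall hT (hw.trans hw'.symm) h h2.2 h2'.2
    exact q_cell_mem_VStar T w j

/-! ### Lower bounds for the arc energies -/

/-- The function `f` along the circle containing the arc `i`, as a function of the angle. -/
def along (T : Fin 3 → Disk) (i : ArcIndex) (f : ℂ → ℝ) : ℝ → ℝ :=
  fun θ => f (circleMap (arcDisk T i).center (arcDisk T i).radius θ)

/-- The angles of the points of the arc `i`. -/
def arcAngles (T : Fin 3 → Disk) (i : ArcIndex) : Set ℝ :=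
  {θ | circleMap (arcDisk T i).center (arcDisk T i).radius θ ∈ arc T i}

lemma along_periodic (T : Fin 3 → Disk) (i : ArcIndex) (f : ℂ → ℝ) :
    Function.Periodic (along T i f) (2 * Real.pi) := fun θ => by
  rw [along, along, periodic_circleMap _ _ θ]

lemma deriv_periodic {f : ℝ → ℝ} {c : ℝ} (hf : Function.Periodic f c) :
    Function.Periodic (deriv f) c := fun θ => by
  rw [← deriv_comp_add_const]
  congr 1
  exact funext hf

lemma enorm_sq_eq_ofReal (x : ℝ) : ‖x‖ₑ ^ 2 = ENNReal.ofReal (x ^ 2) := by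
  rw [Real.enorm_eq_ofReal_abs, ← ENNReal.ofReal_pow (abs_nonneg _), sq_abs]

/-- The weight and the length element contribute one radius each, the squared gradient removes two:
in the angle the energy is scale-free. -/
lemma arcEnergy_eq (T : Fin 3 → Disk) (u : K0 T → ℝ) (i : ArcIndex) : arcEnergy T u i =
    ∫⁻ θ in interior (arcAngles T i) ∩ Set.Ioc 0 (2 * Real.pi),
      ENNReal.ofReal (deriv (along T i (extend u)) θ ^ 2) := by
  have hr := (arcDisk T i).radius_pos
  rw [arcEnergy, len, arcLength, lintegral_smul_measure, smul_eq_mul,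
    ← lintegral_const_mul' _ _ ENNReal.ofReal_ne_top]
  refine lintegral_congr fun θ => ?_
  have h1 : ‖Complex.exp (θ * Complex.I) * Complex.I‖ₑ = 1 := by
    rw [← ofReal_norm, norm_mul, Complex.norm_exp_ofReal_mul_I, Complex.norm_I]; simp
  rw [grad, arcGrad, enorm_smul, h1, mul_one, enorm_sq_eq_ofReal,
    ← ENNReal.ofReal_mul (sq_nonneg _), ← ENNReal.ofReal_mul hr.le]
  congr 1
  unfold along
  field_simp

lemma ofReal_integral_le_lintegral {α : Type*} [MeasurableSpace α] {μ : Measure α} {f : α → ℝ}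
    (hf : Integrable f μ) : ENNReal.ofReal (∫ x, f x ∂μ) ≤ ∫⁻ x, ENNReal.ofReal (f x) ∂μ := by
  rw [integral_eq_lintegral_pos_part_sub_lintegral_neg_part hf]
  exact (ENNReal.ofReal_le_ofReal (sub_le_self _ ENNReal.toReal_nonneg)).trans
    ENNReal.ofReal_toReal_le

/-- Integrating (f' − c)² ≥ 0 with c the mean slope; square integrability of the derivative is not
needed. -/
lemma sq_sub_div_le_lintegral {f : ℝ → ℝ} {a b : ℝ} (hab : a < b)
    (hf : AbsolutelyContinuousOnInterval f a b) :
    ENNReal.ofReal ((f b - f a) ^ 2 / (b - a)) ≤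
      ∫⁻ θ in Set.Ioo a b, ENNReal.ofReal (deriv f θ ^ 2) := by
  have hint := hf.intervalIntegrable_deriv
  set c := (f b - f a) / (b - a) with hc
  have hba : b - a ≠ 0 := (sub_pos.2 hab).ne'
  have h1 : ∫ θ in a..b, (2 * c * deriv f θ - c ^ 2) = (f b - f a) ^ 2 / (b - a) := by
    rw [intervalIntegral.integral_sub (hint.const_mul _) intervalIntegrable_const,
      intervalIntegral.integral_const_mul, hf.integral_deriv_eq_sub, intervalIntegral.integral_const,
      smul_eq_mul, hc]
    field_simp
    ring
  have h2 : IntervalIntegrable (fun θ => 2 * c * deriv f θ - c ^ 2) volume a b :=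
    (hint.const_mul _).sub intervalIntegrable_const
  rw [← h1, intervalIntegral.integral_of_le hab.le, integral_Ioc_eq_integral_Ioo]
  refine (ofReal_integral_le_lintegral ((intervalIntegrable_iff_integrableOn_Ioo_of_le hab.le).1
    h2)).trans (lintegral_mono fun θ => ENNReal.ofReal_le_ofReal ?_)
  nlinarith [sq_nonneg (deriv f θ - c)]

lemma image_Icc_subset_side (hT : Tangential T) {l : Fin 3} {β : ℝ} (h : IsMidAngle T l β) :
    circleMap (T l).center (T l).radius '' Set.Icc (β - halfAngle T l) (β + halfAngle T l) ⊆
      side T l := by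
  have h1 := halfAngle_lt T l
  rintro _ ⟨θ, hθ, rfl⟩
  refine ⟨circleMap_mem_sphere _ (T l).radius_pos.le _, ?_⟩
  refine (h.mem_Icc_of_mem_closedDualBall hT ?_).2 hθ
  rw [abs_le]
  constructor <;> linarith [hθ.1, hθ.2]

lemma absolutelyContinuousOnInterval_along (hT : Tangential T) {f : ℂ → ℝ} {w : List (Fin 3)}
    {l : Fin 3} (hf : IsACOn (arcDisk T (arcOf w l)) (arc T (arcOf w l)) f) {β : ℝ}
    (h : IsMidAngle (cell T w) l β) :
    AbsolutelyContinuousOnInterval (along T (arcOf w l) f)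
      (β - halfAngle (cell T w) l) (β + halfAngle (cell T w) l) := by
  refine hf _ _ (by linarith [halfAngle_pos (cell T w) l]) ?_
  rw [arcDisk_arcOf]
  exact (image_Icc_subset_side (hT.cell w) h).trans (side_subset_arc hT w l)

lemma sideDiff_sq_div_le (hT : Tangential T) {f : ℂ → ℝ} {w : List (Fin 3)}
    {l : Fin 3} (hf : IsACOn (arcDisk T (arcOf w l)) (arc T (arcOf w l)) f) :
    ENNReal.ofReal (sideDiff (cell T w) l f ^ 2 / (2 * halfAngle (cell T w) l)) ≤
      ∫⁻ θ in sideAngles (cell T w) l ∩ Set.Ioc 0 (2 * Real.pi),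
        ENNReal.ofReal (deriv (along T (arcOf w l) f) θ ^ 2) := by
  obtain ⟨β, h⟩ := exists_isMidAngle (cell T w) l
  have hη := halfAngle_pos (cell T w) l
  have h1 := sq_sub_div_le_lintegral (by linarith) (absolutelyContinuousOnInterval_along hT hf h)
  have h2 : Function.Periodic (fun θ => ENNReal.ofReal (deriv (along T (arcOf w l) f) θ ^ 2))
      (2 * Real.pi) := fun θ => by
    simp only [deriv_periodic (along_periodic T (arcOf w l) f) θ]
  rw [setLIntegral_sideAngles (hT.cell w) h h2]
  convert h1 using 3
  · rw [sideDiff_apply, along, along, arcDisk_arcOf, h.circleMap_right (hT.cell w),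
      h.circleMap_left (hT.cell w)]
  · ring

lemma sideAngles_subset_arcAngles (hT : Tangential T) (w : List (Fin 3)) (l : Fin 3) :
    sideAngles (cell T w) l ⊆ interior (arcAngles T (arcOf w l)) := by
  refine interior_maximal ?_ (isOpen_sideAngles _ _)
  intro θ hθ
  rw [arcAngles, Set.mem_ofPred_eq, arcDisk_arcOf]
  exact side_subset_arc hT w l ⟨circleMap_mem_sphere _ (cell T w l).radius_pos.le _,
    dualBall_subset _ hθ⟩

lemma disjoint_sideAngles (hT : Tangential T) {n : ℕ} {w w' : List (Fin 3)} {l l' : Fin 3}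
    (hw : w ∈ words n) (hw' : w' ∈ words n) (hne : (w, l) ≠ (w', l'))
    (h : arcOf w l = arcOf w' l') : Disjoint (sideAngles (cell T w) l) (sideAngles (cell T w') l') := by
  rw [mem_words] at hw hw'
  have hww : w ≠ w' := by
    rintro rfl
    exact hne (by rw [arcOf_injective w h])
  rw [Set.disjoint_left]
  intro θ h1 h2
  rw [sideAngles, Set.mem_ofPred_eq, ← arcDisk_arcOf] at h1 h2
  rw [← h] at h2
  exact disjoint_dualBall_cell hT (hw.trans hw'.symm) hww h1 (dualBall_subset _ h2)

lemma sum_setLIntegral_sideAngles_le (hT : Tangential T) (n : ℕ) (i : ArcIndex)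
    (φ : ℝ → ENNReal) :
    ∑ p ∈ (words n ×ˢ (Finset.univ : Finset (Fin 3))) with arcOf p.1 p.2 = i,
      ∫⁻ θ in sideAngles (cell T p.1) p.2 ∩ Set.Ioc 0 (2 * Real.pi), φ θ ≤
    ∫⁻ θ in interior (arcAngles T i) ∩ Set.Ioc 0 (2 * Real.pi), φ θ := by
  rw [← lintegral_biUnion_finset]
  · refine lintegral_mono_set ?_
    refine Set.iUnion₂_subset fun p hp => Set.inter_subset_inter_left _ ?_
    rw [← (Finset.mem_filter.1 hp).2]
    exact sideAngles_subset_arcAngles hT _ _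
  · intro p hp p' hp' hne
    simp only [Finset.coe_filter, Finset.mem_product, Finset.mem_univ, and_true,
      Set.mem_ofPred_eq] at hp hp'
    exact (disjoint_sideAngles hT hp.1 hp'.1 hne (hp.2.trans hp'.2.symm)).mono
      Set.inter_subset_left Set.inter_subset_left
  · exact fun p _ => (isOpen_sideAngles _ _).measurableSet.inter measurableSet_Ioc

/-- The sides of one level are grouped by arcs; on each arc they are disjoint, so their energies add
up to at most that of the arc. -/
lemma ofReal_arcSum_le (hT : Tangential T) {u : K0 T → ℝ} (hu : u ∈ domain T) (n : ℕ) :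
    ENNReal.ofReal (arcSum T n (extend u)) ≤ ∑' i, arcEnergy T u i := by
  set S := words n ×ˢ (Finset.univ : Finset (Fin 3))
  set A : List (Fin 3) × Fin 3 → ENNReal := fun p =>
    ∫⁻ θ in sideAngles (cell T p.1) p.2 ∩ Set.Ioc 0 (2 * Real.pi),
        ENNReal.ofReal (deriv (along T (arcOf p.1 p.2) (extend u)) θ ^ 2)
  have h1 : ENNReal.ofReal (arcSum T n (extend u)) ≤ ∑ p ∈ S, A p := by
    rw [arcSum, ← Finset.sum_product', ENNReal.ofReal_sum_of_nonneg]
    · exact Finset.sum_le_sum fun p _ => sideDiff_sq_div_le hT (hu.1 _).1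
    · intro p _
      have := halfAngle_pos (cell T p.1) p.2
      positivity
  refine h1.trans ?_
  classical
  rw [← Finset.sum_fiberwise_of_maps_to (t := S.image fun p => arcOf p.1 p.2)
    (g := fun p => arcOf p.1 p.2) fun p hp => Finset.mem_image_of_mem _ hp]
  refine (Finset.sum_le_sum fun i _ => ?_).trans (ENNReal.sum_le_tsum _)
  rw [arcEnergy_eq]
  refine le_trans (le_of_eq ?_) (sum_setLIntegral_sideAngles_le hT n i _)
  refine Finset.sum_congr rfl fun p hp => ?_
  simp only [A, (Finset.mem_filter.1 hp).2]

/-! ### Uniqueness of the extension -/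

/-- Sides of high level around a point that is not a vertex have small angle and end in vertices;
continuity transfers the zero values. -/
lemma along_eq_zero (hT : Tangential T) {f : ℂ → ℝ} {i : ArcIndex}
    (hf : IsACOn (arcDisk T i) (arc T i) f) (h0 : ∀ x ∈ VStar T, f x = 0) {x : ℂ}
    (hx : x ∈ arc T i) : f x = 0 := by
  by_cases hxV : x ∈ VStar T
  · exact h0 x hxV
  have hr := (arcDisk T i).radius_pos
  obtain ⟨θ, hθ⟩ : x ∈ Set.range (circleMap (arcDisk T i).center (arcDisk T i).radius) := by
    rw [range_circleMap, abs_of_pos hr]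
    exact arc_subset_sphere hT i hx
  -- the angle lies in the interior of sides of arbitrarily high levels
  have key : ∀ n, arcLevel i ≤ n → ∃ w l β, w ∈ words n ∧ arcOf w l = i ∧
      IsMidAngle (cell T w) l β ∧
        θ ∈ Set.Ioo (β - halfAngle (cell T w) l) (β + halfAngle (cell T w) l) := by
    intro n hn
    obtain ⟨w, hw, l, rfl, h2⟩ := exists_side_of_mem_arc hT hx hn
    obtain ⟨β, hβ, hβ'⟩ := exists_isMidAngle_abs_sub_le (cell T w) l θ
    refine ⟨w, l, β, hw, rfl, hβ, ?_⟩
    rw [← hβ.mem_Ioo_of_mem_sideAngles (hT.cell w) hβ']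
    rw [arcDisk_arcOf] at hθ
    rcases mem_side_cases (hT.cell w) (l := l) (θ := θ) (hθ ▸ h2.2) with h | h | h
    · exact h
    · exact absurd (hθ ▸ h ▸ q_cell_mem_VStar T w _) hxV
    · exact absurd (hθ ▸ h ▸ q_cell_mem_VStar T w _) hxV
  have hcont : ContinuousAt (along T i f) θ := by
    obtain ⟨w, l, β, -, rfl, hβ, hmem⟩ := key _ le_rfl
    have h1 := (absolutelyContinuousOnInterval_along hT hf hβ).continuousOn
    rw [Set.uIcc_of_le (by linarith [halfAngle_pos (cell T w) l])] at h1
    exact h1.continuousAt (Icc_mem_nhds hmem.1 hmem.2)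
  have hval : along T i f θ = f x := by rw [along, hθ]
  by_contra hne
  rw [← hval] at hne
  obtain ⟨ε, hε, hball⟩ := Metric.eventually_nhds_iff.1 (hcont.eventually_ne hne)
  -- This makes `halfAngle` smaller than `ε / 2`, hence the whole side narrower than `ε`.
  obtain ⟨N, hN⟩ := exists_inradius_lt hT (ε := ε * (arcDisk T i).radius / 2) (by positivity)
  obtain ⟨w, l, β, hw, rfl, hβ, hmem⟩ := key (max N (arcLevel i)) (le_max_right _ _)
  rw [arcDisk_arcOf] at hr hN
  have h1 := hN w (by rw [mem_words.1 hw]; exact le_max_left _ _)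
  have h2 := halfAngle_le (cell T w) l
  have h3 : inradius (cell T w) / (cell T w l).radius < ε / 2 := by
    rw [div_lt_iff₀ hr]; linarith
  refine hball (y := β + halfAngle (cell T w) l) ?_ ?_
  · rw [Real.dist_eq, abs_lt]
    constructor <;> linarith [hmem.1, hmem.2]
  · rw [along, arcDisk_arcOf, hβ.circleMap_right (hT.cell w)]
    exact h0 _ (q_cell_mem_VStar T w _)

lemma eq_zero_of_restr_eq_zero (hT : Tangential T) {u : K0 T → ℝ} (hu : u ∈ domain T)
    (h0 : ∀ x ∈ VStar T, extend u x = 0) : u = 0 := by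
  funext x
  obtain ⟨i, hi⟩ := Set.mem_iUnion.1 x.2
  have := along_eq_zero hT (hu.1 i).1 h0 hi
  rwa [extend_of_mem _ x.2] at this

/-! ### A weak compactness argument -/

/-- Banach–Alaoglu: the solutions of the constraints of each stage within the ball form nested
nonempty weak-* compact sets, so all constraints can be met at once. -/
lemma exists_inner_eq_of_forall {H ι : Type*} [NormedAddCommGroup H] [InnerProductSpace ℝ H]
    [CompleteSpace H] (e : ι → H) (d : ι → ℝ) (S : ℕ → Set ι) (R : ℝ)
    (hex : ∀ n, ∃ g : H, ‖g‖ ≤ R ∧ ∀ s ∈ S n, inner ℝ g (e s) = d s)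
    (hmono : ∀ n (g : H), (∀ s ∈ S (n + 1), inner ℝ g (e s) = d s) →
      ∀ s ∈ S n, inner ℝ g (e s) = d s) :
    ∃ g : H, ‖g‖ ≤ R ∧ ∀ n, ∀ s ∈ S n, inner ℝ g (e s) = d s := by
  set C : ℕ → Set (WeakDual ℝ H) := fun n =>
    (WeakDual.toStrongDual ⁻¹' Metric.closedBall 0 R) ∩ ⋂ s ∈ S n, {φ | φ (e s) = d s} with hC
  have hmem : ∀ n (g : H), StrongDual.toWeakDual (InnerProductSpace.toDual ℝ H g) ∈ C n ↔
      ‖g‖ ≤ R ∧ ∀ s ∈ S n, inner ℝ g (e s) = d s := fun n g => by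
    simp only [hC, Set.mem_inter_iff, Set.mem_preimage, Set.mem_iInter, Set.mem_ofPred_eq]
    refine and_congr ?_ Iff.rfl
    rw [mem_closedBall_zero_iff]
    exact iff_of_eq (congrArg (· ≤ R) ((InnerProductSpace.toDual ℝ H).norm_map g))
  have hsurj : ∀ φ : WeakDual ℝ H, ∃ g, StrongDual.toWeakDual (InnerProductSpace.toDual ℝ H g) = φ :=
    fun φ => ⟨(InnerProductSpace.toDual ℝ H).symm (WeakDual.toStrongDual φ), by simp⟩
  have hclosed : ∀ n, IsClosed (⋂ s ∈ S n, {φ : WeakDual ℝ H | φ (e s) = d s}) := fun n =>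
    isClosed_biInter fun s _ => isClosed_eq (WeakDual.eval_continuous (e s)) continuous_const
  obtain ⟨φ, hφ⟩ := IsCompact.nonempty_iInter_of_sequence_nonempty_isCompact_isClosed C
    (fun n φ hφ => by
      obtain ⟨g, rfl⟩ := hsurj φ
      rw [hmem] at *
      exact ⟨hφ.1, hmono n g hφ.2⟩)
    (fun n => by
      obtain ⟨g, hg⟩ := hex n
      exact ⟨_, (hmem n g).2 hg⟩)
    ((WeakDual.isCompact_closedBall 0 R).inter_right (hclosed 0))
    (fun n => (WeakDual.isClosed_closedBall 0 R).inter (hclosed n))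
  obtain ⟨g, rfl⟩ := hsurj φ
  have h := fun n => (hmem n g).1 (Set.mem_iInter.1 hφ n)
  exact ⟨g, (h 0).1, fun n => (h n).2⟩

/-! ### Subdivision of sides -/

lemma ae_circleMap_notMem (D : Disk) {s : Set ℂ} (hs : s.Countable) :
    ∀ᵐ θ : ℝ, circleMap D.center D.radius θ ∉ s :=
  measure_eq_zero_iff_ae_notMem.1
    ((hs.preimage_circleMap D.center D.radius_pos.ne').measure_zero volume)

lemma countable_V0 (T : Fin 3 → Disk) : (V0 T).Countable := Set.countable_range _

lemma mem_sideAngles_of_notMem_V0 (hT : Tangential T) {l : Fin 3} {θ : ℝ}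
    (h : circleMap (T l).center (T l).radius θ ∈ closedDualBall T)
    (h0 : circleMap (T l).center (T l).radius θ ∉ V0 T) : θ ∈ sideAngles T l := by
  rcases mem_side_cases hT h with h1 | h1 | h1
  · exact h1
  · exact absurd ⟨_, h1.symm⟩ h0
  · exact absurd ⟨_, h1.symm⟩ h0

lemma sideAngles_Phi_subset (hT : Tangential T) {k l : Fin 3} (h : l ≠ k) :
    sideAngles (Phi T k) l ⊆ sideAngles T l := by
  intro θ hθ
  rw [sideAngles, Phi_of_ne T h] at hθ
  exact dualBall_Phi_subset hT k hθ

/-- The only exceptions are angles of vertices of the subcells. -/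
lemma ae_mem_sideAngles_iff (hT : Tangential T) (l : Fin 3) : ∀ᵐ θ : ℝ, θ ∈ sideAngles T l ↔
    θ ∈ sideAngles (Phi T (l + 1)) l ∨ θ ∈ sideAngles (Phi T (l + 2)) l := by
  filter_upwards [ae_circleMap_notMem (T l) (countable_V0 (Phi T (l + 1))),
    ae_circleMap_notMem (T l) (countable_V0 (Phi T (l + 2)))] with θ h1 h2
  refine ⟨fun h => ?_, fun h => ?_⟩
  · have h3 : ‖circleMap (T l).center (T l).radius θ - (T l).center‖ = (T l).radius := by
      simpa using (T l).radius_pos.le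
    refine (mem_Phi_of_mem_side hT h3 (dualBall_subset _ h)).imp (fun h4 => ?_) fun h4 => ?_
    · refine mem_sideAngles_of_notMem_V0 (hT.Phi _) ?_ ?_ <;>
        rwa [Phi_of_ne T (fin_three_ne_one l)]
    · refine mem_sideAngles_of_notMem_V0 (hT.Phi _) ?_ ?_ <;>
        rwa [Phi_of_ne T (fin_three_ne_two l)]
  · exact h.elim (fun h => sideAngles_Phi_subset hT (fin_three_ne_one l) h)
      fun h => sideAngles_Phi_subset hT (fin_three_ne_two l) h

lemma sideDiff_eq_add (T : Fin 3 → Disk) (l : Fin 3) (f : ℂ → ℝ) : sideDiff T l f =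
    sideDiff (Phi T (l + 1)) l f + sideDiff (Phi T (l + 2)) l f := by
  have h := q_Phi_comm T (k := l + 1) (l := l + 2) (fin_three_one_ne_two l)
  rw [sideDiff_apply, sideDiff_apply, sideDiff_apply, q_Phi, q_Phi, h]
  ring

/-! ### The limit density -/

/-- The length measure on a circle of radius one. -/
abbrev circleMeasure : Measure ℝ := volume.restrict (Set.Ioc 0 (2 * Real.pi))

/-- The indicator function of a side, as an element of `L²`. -/
def sideVector (T : Fin 3 → Disk) (l : Fin 3) : Lp ℝ 2 circleMeasure :=
  indicatorConstLp 2 (isOpen_sideAngles T l).measurableSet (measure_ne_top _ _) 1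

/-- The Hilbert space of square integrable densities on all arcs. -/
abbrev Density : Type := lp (fun _ : ArcIndex => Lp ℝ 2 circleMeasure) 2

/-- The indicator function of side `l` of the cell of `w`, on the arc containing this side. -/
def sideDensity (T : Fin 3 → Disk) (p : List (Fin 3) × Fin 3) : Density :=
  lp.single 2 (arcOf p.1 p.2) (sideVector (cell T p.1) p.2)

lemma inner_sideDensity (g : Density) (p : List (Fin 3) × Fin 3) :
    inner ℝ g (sideDensity T p) =
      ∫ θ in sideAngles (cell T p.1) p.2 ∩ Set.Ioc 0 (2 * Real.pi), g (arcOf p.1 p.2) θ := by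
  rw [sideDensity, lp.inner_single_right, real_inner_comm, sideVector,
    L2.inner_indicatorConstLp_one, Measure.restrict_restrict (isOpen_sideAngles _ _).measurableSet]

lemma inner_sideDensity_of_ne (hT : Tangential T) {n : ℕ} {p p' : List (Fin 3) × Fin 3}
    (hp : p.1 ∈ words n) (hp' : p'.1 ∈ words n) (hne : p ≠ p') :
    inner ℝ (sideDensity T p) (sideDensity T p') = 0 := by
  rw [sideDensity, sideDensity, lp.inner_single_left, lp.single_apply]
  by_cases h : arcOf p.1 p.2 = arcOf p'.1 p'.2
  · rw [h, Pi.single_eq_same, sideVector, sideVector,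
      L2.real_inner_indicatorConstLp_one_indicatorConstLp_one,
      (disjoint_sideAngles hT hp hp' hne h).inter_eq]
    simp
  · rw [Pi.single_eq_of_ne h, inner_zero_right]

lemma inner_sideDensity_self (hT : Tangential T) (p : List (Fin 3) × Fin 3) :
    inner ℝ (sideDensity T p) (sideDensity T p) = 2 * halfAngle (cell T p.1) p.2 := by
  have hη := halfAngle_pos (cell T p.1) p.2
  rw [sideDensity, lp.inner_single_left, lp.single_apply_self, sideVector,
    L2.real_inner_indicatorConstLp_one_indicatorConstLp_one, Set.inter_self, Measure.real,
    Measure.restrict_apply (isOpen_sideAngles _ _).measurableSet, volume_sideAngles (hT.cell p.1),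
    ENNReal.toReal_ofReal (by positivity)]

lemma sideVector_eq_add (hT : Tangential T) (l : Fin 3) :
    sideVector T l = sideVector (Phi T (l + 1)) l + sideVector (Phi T (l + 2)) l := by
  have h1 := ae_restrict_of_ae (s := Set.Ioc 0 (2 * Real.pi)) (ae_mem_sideAngles_iff hT l)
  have hd : Disjoint (sideAngles (Phi T (l + 1)) l) (sideAngles (Phi T (l + 2)) l) := by
    rw [Set.disjoint_left]
    intro θ h2 h3
    rw [sideAngles, Phi_of_ne T (fin_three_ne_one l)] at h2
    rw [sideAngles, Phi_of_ne T (fin_three_ne_two l)] at h3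
    exact disjoint_dualBall_cell hT (w := [l + 1]) (w' := [l + 2]) rfl
      (by simp) h2 (dualBall_subset _ h3)
  apply Lp.ext
  unfold sideVector
  filter_upwards [h1, indicatorConstLp_coeFn (p := 2) (μ := circleMeasure) (c := (1 : ℝ))
      (hs := (isOpen_sideAngles T l).measurableSet) (hμs := measure_ne_top _ _),
    indicatorConstLp_coeFn (p := 2) (μ := circleMeasure) (c := (1 : ℝ))
      (hs := (isOpen_sideAngles (Phi T (l + 1)) l).measurableSet) (hμs := measure_ne_top _ _),
    indicatorConstLp_coeFn (p := 2) (μ := circleMeasure) (c := (1 : ℝ))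
      (hs := (isOpen_sideAngles (Phi T (l + 2)) l).measurableSet) (hμs := measure_ne_top _ _),
    Lp.coeFn_add (indicatorConstLp 2 (isOpen_sideAngles (Phi T (l + 1)) l).measurableSet
      (measure_ne_top circleMeasure _) (1 : ℝ))
      (indicatorConstLp 2 (isOpen_sideAngles (Phi T (l + 2)) l).measurableSet
        (measure_ne_top circleMeasure _) (1 : ℝ))] with θ h1 h2 h3 h4 h5
  rw [h2, h5, Pi.add_apply, h3, h4]
  by_cases h6 : θ ∈ sideAngles (Phi T (l + 1)) l
  · rw [Set.indicator_of_mem (h1.2 (Or.inl h6)), Set.indicator_of_mem h6,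
      Set.indicator_of_notMem (Set.disjoint_left.1 hd h6), add_zero]
  · by_cases h7 : θ ∈ sideAngles (Phi T (l + 2)) l
    · rw [Set.indicator_of_mem (h1.2 (Or.inr h7)), Set.indicator_of_notMem h6,
        Set.indicator_of_mem h7, zero_add]
    · rw [Set.indicator_of_notMem fun h => (h1.1 h).elim h6 h7, Set.indicator_of_notMem h6,
        Set.indicator_of_notMem h7, add_zero]

lemma sideDensity_eq_add (hT : Tangential T) (w : List (Fin 3)) (l : Fin 3) :
    sideDensity T (w, l) = sideDensity T (w ++ [l + 1], l) + sideDensity T (w ++ [l + 2], l) := by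
  simp only [sideDensity, cell_concat]
  rw [arcOf_concat_of_ne _ (fin_three_ne_one l), arcOf_concat_of_ne _ (fin_three_ne_two l),
    ← lp.single_add, ← sideVector_eq_add (hT.cell w)]

/-- On each side of level `n` take the constant slope with the right increment. The sides of one
level are orthogonal, so the squared norm is `arcSum`. -/
lemma exists_density_level (hT : Tangential T) {f : ℂ → ℝ} {M : ℝ} (n : ℕ)
    (hM : arcSum T n f ≤ M) : ∃ g : Density, ‖g‖ ≤ √M ∧
      ∀ p ∈ {p : List (Fin 3) × Fin 3 | p.1 ∈ words n},
        inner ℝ g (sideDensity T p) = sideDiff (cell T p.1) p.2 f := by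
  set c : List (Fin 3) × Fin 3 → ℝ := fun p =>
    sideDiff (cell T p.1) p.2 f / (2 * halfAngle (cell T p.1) p.2)
  set S := words n ×ˢ (Finset.univ : Finset (Fin 3))
  have hη : ∀ p : List (Fin 3) × Fin 3, 0 < halfAngle (cell T p.1) p.2 := fun p => halfAngle_pos _ _
  set g : Density := ∑ p ∈ S, c p • sideDensity T p with hg
  have h1 : ∀ p, p.1 ∈ words n → inner ℝ g (sideDensity T p) = sideDiff (cell T p.1) p.2 f := by
    intro p hp
    rw [hg, sum_inner, Finset.sum_eq_single p]
    · rw [real_inner_smul_left, inner_sideDensity_self hT]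
      have := hη p
      simp only [c]
      field_simp
    · intro p' hp' hne
      rw [real_inner_smul_left,
        inner_sideDensity_of_ne hT (Finset.mem_product.1 hp').1 hp hne, mul_zero]
    · intro h
      exact absurd (Finset.mem_product.2 ⟨hp, Finset.mem_univ _⟩) h
  refine ⟨g, ?_, h1⟩
  refine Real.le_sqrt_of_sq_le (le_trans (le_of_eq ?_) hM)
  rw [← real_inner_self_eq_norm_sq]
  conv_lhs => rw [hg, inner_sum]
  rw [arcSum, ← Finset.sum_product']
  refine Finset.sum_congr rfl fun p hp => ?_
  rw [real_inner_smul_right, h1 p (Finset.mem_product.1 hp).1]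
  simp only [c]
  ring

/-- Indicators and increments of a side are both sums over its two halves, so the constraints of
level n + 1 imply those of level n. -/
lemma exists_density (hT : Tangential T) {f : ℂ → ℝ} {M : ℝ} (hM : ∀ n, arcSum T n f ≤ M) :
    ∃ g : Density, ‖g‖ ≤ √M ∧ ∀ w l, inner ℝ g (sideDensity T (w, l)) = sideDiff (cell T w) l f := by
  obtain ⟨g, h1, h2⟩ := exists_inner_eq_of_forall (sideDensity T)
    (fun p => sideDiff (cell T p.1) p.2 f) (fun n => {p | p.1 ∈ words n}) (√M)
    (fun n => exists_density_level hT n (hM n)) (by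
      rintro n g h ⟨w, l⟩ hp
      have hw : ∀ k, w ++ [k] ∈ words (n + 1) := fun k => by
        have := mem_words.1 hp
        simp only at this
        rw [mem_words]
        simp [this]
      rw [sideDensity_eq_add hT, inner_add_right, h _ (hw _), h _ (hw _), cell_concat, cell_concat]
      exact (sideDiff_eq_add (cell T w) l f).symm)
  exact ⟨g, h1, fun w l => h2 w.length (w, l) (mem_words.2 rfl)⟩

lemma ofReal_norm_sq_eq_lintegral (g : Lp ℝ 2 circleMeasure) :
    ENNReal.ofReal (‖g‖ ^ 2) = ∫⁻ θ in Set.Ioc 0 (2 * Real.pi), ENNReal.ofReal (g θ ^ 2) := by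
  have h1 : Integrable (fun θ => g θ ^ 2) circleMeasure := by
    have := L2.integrable_inner (𝕜 := ℝ) g g
    simpa only [real_inner_self_eq_norm_sq, Real.norm_eq_abs, sq_abs] using this
  rw [← real_inner_self_eq_norm_sq, L2.inner_def,
    ← ofReal_integral_eq_lintegral_ofReal h1 (Eventually.of_forall fun θ => sq_nonneg _)]
  simp only [real_inner_self_eq_norm_sq, Real.norm_eq_abs, sq_abs]

/-- Bounded energies are the energies of the increments of a square integrable density. -/
lemma exists_forall_setIntegral_eq (hT : Tangential T) {f : ℂ → ℝ} {M : ℝ} (h0 : 0 ≤ M)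
    (hM : ∀ n, arcSum T n f ≤ M) : ∃ g : ArcIndex → ℝ → ℝ,
      (∀ i, IntegrableOn (g i) (Set.Ioc 0 (2 * Real.pi))) ∧
      ∑' i, ∫⁻ θ in Set.Ioc 0 (2 * Real.pi), ENNReal.ofReal (g i θ ^ 2) ≤ ENNReal.ofReal M ∧
      ∀ w l, ∫ θ in sideAngles (cell T w) l ∩ Set.Ioc 0 (2 * Real.pi), g (arcOf w l) θ =
        sideDiff (cell T w) l f := by
  obtain ⟨g, h1, h2⟩ := exists_density hT hM
  refine ⟨fun i => g i, fun i => (Lp.memLp (g i)).integrable one_le_two, ?_, fun w l => ?_⟩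
  · have h3 := lp.hasSum_norm (p := 2) (by simp) g
    simp only [ENNReal.toReal_ofNat, Real.rpow_ofNat] at h3
    simp only [← ofReal_norm_sq_eq_lintegral]
    rw [← ENNReal.ofReal_tsum_of_nonneg (fun _ => sq_nonneg _) h3.summable, h3.tsum_eq]
    refine ENNReal.ofReal_le_ofReal ?_
    have := pow_le_pow_left₀ (norm_nonneg g) h1 2
    rwa [Real.sq_sqrt h0] at this
  · rw [← h2, inner_sideDensity]

/-! ### Primitives along circles -/

lemma setIntegral_sideAngles (hT : Tangential T) {l : Fin 3} {β : ℝ} (h : IsMidAngle T l β)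
    {φ : ℝ → ℝ} (hφ : Function.Periodic φ (2 * Real.pi)) :
    ∫ θ in sideAngles T l ∩ Set.Ioc 0 (2 * Real.pi), φ θ =
      ∫ θ in (β - halfAngle T l)..(β + halfAngle T l), φ θ := by
  have hm := (isOpen_sideAngles T l).measurableSet
  have hper : Function.Periodic ((sideAngles T l).indicator φ) (2 * Real.pi) := fun θ => by
    by_cases hθ : θ ∈ sideAngles T l
    · rw [Set.indicator_of_mem hθ, Set.indicator_of_mem (mem_sideAngles_add_iff.2 hθ), hφ]
    · rw [Set.indicator_of_notMem hθ,
        Set.indicator_of_notMem fun h => hθ (mem_sideAngles_add_iff.1 h)]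
  have h1 := hper.intervalIntegral_add_eq 0 (β - Real.pi)
  have h2 := halfAngle_pos T l
  rw [zero_add, intervalIntegral.integral_of_le (by linarith [Real.two_pi_pos]),
    intervalIntegral.integral_of_le (by linarith [Real.two_pi_pos]), setIntegral_indicator hm,
    setIntegral_indicator hm, Set.inter_comm, Set.inter_comm _ (sideAngles T l),
    sideAngles_inter_Ioc hT h] at h1
  rw [h1, intervalIntegral.integral_of_le (by linarith), integral_Ioc_eq_integral_Ioo]

/-- A density with integral zero has a primitive on the circle. -/
lemma exists_primitive (D : Disk) {g : ℝ → ℝ} (hg : IntegrableOn g (Set.Ioc 0 (2 * Real.pi)))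
    (h0 : ∫ θ in Set.Ioc 0 (2 * Real.pi), g θ = 0) : ∃ u : ℂ → ℝ,
      (∀ a b, AbsolutelyContinuousOnInterval (fun θ => u (circleMap D.center D.radius θ)) a b) ∧
      (∀ᵐ θ : ℝ, θ ∈ Set.Ioc 0 (2 * Real.pi) →
        deriv (fun θ => u (circleMap D.center D.radius θ)) θ = g θ) ∧
      ∀ U l, Tangential U → U l = D →
        ∫ θ in sideAngles U l ∩ Set.Ioc 0 (2 * Real.pi), g θ = sideDiff U l u := by
  have h2π := Real.two_pi_pos
  -- The periodic continuation of the values of `g` on (0, 2π].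
  set G : ℝ → ℝ := fun θ => g (toIocMod h2π 0 θ) with hG
  have hGper : Function.Periodic G (2 * Real.pi) := fun θ => by
    simp only [hG, toIocMod_periodic h2π 0 θ]
  have hGg : ∀ θ ∈ Set.Ioc 0 (2 * Real.pi), G θ = g θ := fun θ hθ => by
    have : toIocMod h2π 0 θ = θ := (toIocMod_eq_self h2π).2 (by rwa [zero_add])
    simp only [hG, this]
  have hGint : IntegrableOn G (Set.Ioc 0 (2 * Real.pi)) :=
    (integrableOn_congr_fun hGg measurableSet_Ioc).2 hg
  have hGI : ∀ a b, IntervalIntegrable G volume a b :=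
    hGper.intervalIntegrable h2π.ne' (t := 0) (by
      rwa [zero_add, intervalIntegrable_iff_integrableOn_Ioc_of_le h2π.le])
  have hG0 : ∫ θ in (0 : ℝ)..(0 + 2 * Real.pi), G θ = 0 := by
    rw [zero_add, intervalIntegral.integral_of_le h2π.le,
      setIntegral_congr_fun measurableSet_Ioc hGg, h0]
  set F : ℝ → ℝ := fun θ => ∫ t in (0 : ℝ)..θ, G t with hF
  have hFper : Function.Periodic F (2 * Real.pi) := fun θ => by
    have h1 := intervalIntegral.integral_add_adjacent_intervals (hGI 0 θ) (hGI θ (θ + 2 * Real.pi))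
    rw [hGper.intervalIntegral_add_eq θ 0, hG0, add_zero] at h1
    exact h1.symm
  -- The primitive is periodic because the total integral is zero, so it defines a function on the
  -- circle.
  have hfac : Function.FactorsThrough F (circleMap D.center D.radius) := by
    intro a b hab
    obtain ⟨n, hn⟩ := (circleMap_eq_circleMap_iff D.center D.radius_pos.ne').1 hab
    have h1 : (a : ℂ) = ((b + n * (2 * Real.pi) : ℝ) : ℂ) := by
      refine mul_right_cancel₀ Complex.I_ne_zero ?_
      rw [hn]; push_cast; ring
    have h2 : a = b + n * (2 * Real.pi) := by exact_mod_cast h1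
    rw [h2, ← zsmul_eq_mul]
    exact hFper.zsmul n b
  refine ⟨Function.extend (circleMap D.center D.radius) F 0, ?_, ?_, ?_⟩
  · intro a b
    simp only [hfac.extend_apply]
    have h1 : AbsolutelyContinuousOnInterval F (min (min a b) 0) (max (max a b) 0) :=
      (hGI _ _).absolutelyContinuousOnInterval_intervalIntegral
        (by rw [Set.uIcc_of_le (by simp)]; simp)
    refine h1.mono ?_
    rw [Set.uIcc_of_le (by simp : min (min a b) 0 ≤ max (max a b) 0), Set.uIcc]
    exact Set.Icc_subset_Icc (min_le_left _ _) (le_max_left _ _)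
  · simp only [hfac.extend_apply]
    have h1 : LocallyIntegrable G volume := by
      intro x
      refine ⟨Set.Ioc (x - 1) (x + 1), Ioc_mem_nhds (by linarith) (by linarith), ?_⟩
      exact (intervalIntegrable_iff_integrableOn_Ioc_of_le (by linarith)).1 (hGI _ _)
    filter_upwards [LocallyIntegrable.ae_hasDerivAt_integral h1] with θ hθ hθ'
    rw [(hθ 0).deriv, hGg θ hθ']
  · rintro U l hU rfl
    obtain ⟨β, h⟩ := exists_isMidAngle U l
    have h1 := setIntegral_sideAngles hU h hGper
    rw [sideDiff_apply, ← h.circleMap_right hU, ← h.circleMap_left hU, hfac.extend_apply,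
      hfac.extend_apply, intervalIntegral.integral_interval_sub_left (hGI _ _) (hGI _ _), ← h1]
    exact setIntegral_congr_fun
      ((isOpen_sideAngles U l).measurableSet.inter measurableSet_Ioc) fun θ hθ => (hGg θ hθ.2).symm

/-! ### Functions without increments along the sides of an arc -/

/-- The sides on an arc are linked: passing to a subcell, an inherited side keeps one end point of
its parent side. On a full circle the three sides to start from share the points where the inscribed
disk touches. -/
lemma eq_of_sideDiff_eq_zero (T : Fin 3 → Disk) (i : ArcIndex) {h : ℂ → ℝ}
    (h0 : ∀ w l, arcOf w l = i → sideDiff (cell T w) l h = 0) :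
    ∃ c, ∀ w l j, arcOf w l = i → j ≠ l → h (q (cell T w) j) = c := by
  have key : ∀ w l, arcOf w l = i → h (q (cell T w) (l + 1)) = h (q (cell T w) (l + 2)) :=
    fun w l hi => sub_eq_zero.1 (h0 w l hi)
  suffices hs : ∃ c, ∀ w l, arcOf w l = i → h (q (cell T w) (l + 1)) = c by
    obtain ⟨c, hc⟩ := hs
    refine ⟨c, fun w l j hi hj => ?_⟩
    rcases fin_three_cases_of_ne hj with rfl | rfl
    · exact hc w l hi
    · rw [← key w l hi, hc w l hi]
  have step : ∀ c, (∀ v, i = Sum.inr v → ∀ k, h (q (cell T (v ++ [k])) (k + 1)) = c) →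
      (∀ l, i = Sum.inl l → h (q T (l + 1)) = c) →
      ∀ w l, arcOf w l = i → h (q (cell T w) (l + 1)) = c := by
    intro c h1 h2 w
    induction w using List.reverseRecOn with
    | nil => exact fun l hl => h2 l hl.symm
    | append_singleton w k ih =>
      intro l hl
      by_cases hlk : l = k
      · subst hlk
        rw [arcOf_concat_self] at hl
        exact h1 w hl.symm l
      · have hl' := hl
        rw [arcOf_concat_of_ne _ hlk] at hl'
        rcases fin_three_cases_of_ne (Ne.symm hlk) with rfl | rfl
        · rw [cell_concat, q_Phi, ih l hl']
        · rw [key _ l hl, cell_concat, q_Phi, ← key w l hl', ih l hl']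
  cases i with
  | inl l =>
    refine ⟨h (q T (l + 1)), step _ (fun v hv => by cases hv) fun l' hl' => ?_⟩
    rw [Sum.inl_injective hl']
  | inr v =>
    refine ⟨h (q (cell T (v ++ [0])) 1), step _ (fun v' hv' k => ?_) fun l hl => by cases hl⟩
    obtain rfl := Sum.inr_injective hv'
    have h1 := key (v ++ [0]) 0 (arcOf_concat_self _ _)
    have h2 := key (v ++ [1]) 1 (arcOf_concat_self _ _)
    simp only [cell_concat, Fin.isValue, zero_add, Fin.reduceAdd] at h1 h2 ⊢
    fin_cases k
    · rfl
    · simp only [Fin.mk_one, Fin.isValue, Fin.reduceAdd]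
      rw [h2, q_Phi_comm _ (show (1 : Fin 3) ≠ 0 by decide)]
    · simp only [Fin.reduceFinMk, Fin.isValue, Fin.reduceAdd]
      rw [h1, q_Phi_comm _ (show (2 : Fin 3) ≠ 0 by decide)]

/-! ### The extension to one arc -/

lemma ae_exists_mem_sideAngles (hT : Tangential T) (w : List (Fin 3)) :
    ∀ᵐ θ : ℝ, ∃ k, θ ∈ sideAngles (cell T (w ++ [k])) k := by
  have h : ∀ k, ∀ᵐ θ : ℝ, circleMap (inDisk (cell T w)).center (inDisk (cell T w)).radius θ ∉
      V0 (cell T (w ++ [k])) := fun k => ae_circleMap_notMem _ (countable_V0 _)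
  filter_upwards [ae_all_iff.2 h] with θ hθ
  obtain ⟨k, hk⟩ := exists_mem_Phi_of_mem_inDisk (hT.cell w)
    (x := circleMap (inDisk (cell T w)).center (inDisk (cell T w)).radius θ)
    (by simpa using (inDisk (cell T w)).radius_pos.le)
  refine ⟨k, ?_⟩
  have h1 := hθ k
  rw [cell_concat] at h1 ⊢
  refine mem_sideAngles_of_notMem_V0 ((hT.cell w).Phi k) ?_ ?_ <;> rwa [Phi_self]

lemma sum_sideDiff_concat (T : Fin 3 → Disk) (w : List (Fin 3)) (f : ℂ → ℝ) :
    ∑ k, sideDiff (cell T (w ++ [k])) k f = 0 := by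
  simp only [Fin.sum_univ_three, sideDiff_apply, cell_concat, Fin.isValue, zero_add, Fin.reduceAdd]
  rw [q_Phi_comm (cell T w) (show (1 : Fin 3) ≠ 0 by decide),
    q_Phi_comm (cell T w) (show (2 : Fin 3) ≠ 0 by decide),
    q_Phi_comm (cell T w) (show (2 : Fin 3) ≠ 1 by decide)]
  ring

/-- A density on an arc, changed outside of the arc so that the total integral is zero. -/
lemma exists_density_integral_eq_zero (hT : Tangential T) (i : ArcIndex) {f : ℂ → ℝ} {g : ℝ → ℝ}
    (hg : IntegrableOn g (Set.Ioc 0 (2 * Real.pi)))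
    (hgf : ∀ w l, arcOf w l = i →
      ∫ θ in sideAngles (cell T w) l ∩ Set.Ioc 0 (2 * Real.pi), g θ = sideDiff (cell T w) l f) :
    ∃ g' : ℝ → ℝ, Set.EqOn g' g (arcAngles T i) ∧ IntegrableOn g' (Set.Ioc 0 (2 * Real.pi)) ∧
      ∫ θ in Set.Ioc 0 (2 * Real.pi), g' θ = 0 := by
  classical
  cases i with
  | inr v =>
    -- Almost every angle of a full circle lies in one of its first three sides, and the increments
    -- around the circle cancel.
    refine ⟨g, fun _ _ => rfl, hg, ?_⟩
    have h1 : Set.Ioc 0 (2 * Real.pi) =ᵐ[volume] ⋃ k ∈ (Finset.univ : Finset (Fin 3)),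
        sideAngles (cell T (v ++ [k])) k ∩ Set.Ioc 0 (2 * Real.pi) := by
      filter_upwards [ae_exists_mem_sideAngles hT v] with θ hθ
      obtain ⟨k, hk⟩ := hθ
      refine propext ⟨fun h => ?_, fun h => ?_⟩
      · exact Set.mem_biUnion (Finset.mem_univ k) ⟨hk, h⟩
      · obtain ⟨k', -, h'⟩ := Set.mem_iUnion₂.1 h
        exact h'.2
    rw [setIntegral_congr_set h1, integral_biUnion_finset]
    · refine Eq.trans ?_ (sum_sideDiff_concat T v f)
      exact Finset.sum_congr rfl fun k _ => hgf _ _ (arcOf_concat_self v k)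
    · exact fun k _ => (isOpen_sideAngles _ _).measurableSet.inter measurableSet_Ioc
    · intro k _ k' _ hne
      refine (disjoint_sideAngles hT (n := v.length + 1) (w := v ++ [k]) (w' := v ++ [k'])
        (mem_words.2 (by simp)) (mem_words.2 (by simp)) ?_ ?_).mono Set.inter_subset_left
        Set.inter_subset_left
      · simpa using hne
      · rw [arcOf_concat_self, arcOf_concat_self]
    · exact fun k _ => hg.mono_set Set.inter_subset_right
  | inl l =>
    have hη := halfAngle_lt T l
    have hm := (isOpen_sideAngles T l).measurableSet
    set A := sideAngles T l
    set s := ∫ θ in A ∩ Set.Ioc 0 (2 * Real.pi), g θ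
    -- The missing amount is spread evenly over the rest of the circle, whose angle is positive
    -- since `halfAngle` is less than π / 2.
    set c := -s / (2 * Real.pi - 2 * halfAngle T l) with hc
    have hsub : A ⊆ arcAngles T (Sum.inl l) :=
      (sideAngles_subset_arcAngles hT [] l).trans interior_subset
    have hA : ∀ᵐ θ : ℝ, θ ∈ arcAngles T (Sum.inl l) ↔ θ ∈ A := by
      filter_upwards [ae_circleMap_notMem (T l) (countable_V0 T)] with θ hθ
      refine ⟨fun h => ?_, fun h => hsub h⟩
      rw [arcAngles, Set.mem_ofPred_eq, arc_inl hT] at h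
      exact mem_sideAngles_of_notMem_V0 hT h.2 hθ
    have hae : (fun θ => if θ ∈ arcAngles T (Sum.inl l) then g θ else c) =ᵐ[volume]
        fun θ => A.indicator (fun θ => g θ - c) θ + c := by
      filter_upwards [hA] with θ hθ
      by_cases h : θ ∈ A
      · rw [if_pos (hθ.2 h), Set.indicator_of_mem h, sub_add_cancel]
      · rw [if_neg fun h' => h (hθ.1 h'), Set.indicator_of_notMem h, zero_add]
    have hci : ∀ S : Set ℝ, S ⊆ Set.Ioc 0 (2 * Real.pi) → IntegrableOn (fun _ : ℝ => c) S :=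
      fun S hS => (integrableOn_const (measure_Ioc_lt_top.ne)).mono_set hS
    have hint : IntegrableOn (A.indicator fun θ => g θ - c) (Set.Ioc 0 (2 * Real.pi)) :=
      (hg.sub (hci _ subset_rfl)).indicator hm
    refine ⟨fun θ => if θ ∈ arcAngles T (Sum.inl l) then g θ else c,
      fun θ hθ => if_pos hθ, ?_, ?_⟩
    · exact (hint.add (hci _ subset_rfl)).congr (ae_restrict_of_ae hae.symm)
    · rw [integral_congr_ae (ae_restrict_of_ae hae), integral_add hint (hci _ subset_rfl),
        setIntegral_indicator hm, Set.inter_comm, integral_sub (hg.mono_set Set.inter_subset_right)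
          (hci _ Set.inter_subset_right), setIntegral_const, setIntegral_const, Measure.real,
        volume_sideAngles hT, Measure.real, Real.volume_Ioc, ENNReal.toReal_ofReal, ENNReal.toReal_ofReal,
        smul_eq_mul, smul_eq_mul]
      · have : 2 * Real.pi - 2 * halfAngle T l ≠ 0 := by linarith [Real.pi_pos]
        have hc' : c * (2 * Real.pi - 2 * halfAngle T l) = -s := div_mul_cancel₀ _ this
        change s - _ + _ = 0
        linear_combination hc'
      · linarith [Real.pi_pos]
      · linarith [halfAngle_pos T l]

/-- A primitive of the density has the increments of `f` on all sides of the arc, so on its vertices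
it differs from `f` by a constant, which is subtracted. -/
lemma exists_extension_arc (hT : Tangential T) (i : ArcIndex) {f : ℂ → ℝ} {g : ℝ → ℝ}
    (hg : IntegrableOn g (Set.Ioc 0 (2 * Real.pi)))
    (hgf : ∀ w l, arcOf w l = i →
      ∫ θ in sideAngles (cell T w) l ∩ Set.Ioc 0 (2 * Real.pi), g θ = sideDiff (cell T w) l f) :
    ∃ u : ℂ → ℝ, (∀ a b, AbsolutelyContinuousOnInterval (along T i u) a b) ∧
      (∀ᵐ θ : ℝ, θ ∈ arcAngles T i ∩ Set.Ioc 0 (2 * Real.pi) → deriv (along T i u) θ = g θ) ∧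
      ∀ x ∈ arc T i, x ∈ VStar T → u x = f x := by
  obtain ⟨g', h1, h2, h3⟩ := exists_density_integral_eq_zero hT i hg hgf
  obtain ⟨u, h4, h5, h6⟩ := exists_primitive (arcDisk T i) h2 h3
  have h7 : ∀ w l, arcOf w l = i → sideDiff (cell T w) l (u - f) = 0 := by
    intro w l hi
    rw [map_sub, sub_eq_zero, ← hgf w l hi, ← h6 _ l (hT.cell w) (by rw [← arcDisk_arcOf, hi])]
    refine setIntegral_congr_fun
      ((isOpen_sideAngles _ _).measurableSet.inter measurableSet_Ioc) fun θ hθ => h1 ?_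
    rw [← hi]
    exact interior_subset (sideAngles_subset_arcAngles hT w l hθ.1)
  obtain ⟨c, hc⟩ := eq_of_sideDiff_eq_zero T i h7
  refine ⟨fun x => u x - c, fun a b => ?_, ?_, fun x hx hxV => ?_⟩
  · exact (h4 a b).sub
      (LipschitzWith.const c).lipschitzOnWith.absolutelyContinuousOnInterval
  · filter_upwards [h5] with θ hθ hθ'
    unfold along
    rw [deriv_sub_const, hθ hθ'.2, h1 hθ'.1]
  · obtain ⟨w, l, j, hi, -, hj, rfl⟩ := exists_endpoint_of_mem_arc hT hx hxV
    have := hc w l j hi hj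
    rw [Pi.sub_apply] at this
    linarith

/-! ### The extension of functions of bounded energy -/

lemma AbsolutelyContinuousOnInterval.congr {f g : ℝ → ℝ} {a b : ℝ}
    (hf : AbsolutelyContinuousOnInterval f a b) (h : Set.EqOn g f (Set.uIcc a b)) :
    AbsolutelyContinuousOnInterval g a b := by
  rw [absolutelyContinuousOnInterval_iff] at *
  intro ε hε
  obtain ⟨δ, hδ, hfδ⟩ := hf ε hε
  refine ⟨δ, hδ, fun E hE hlt => lt_of_eq_of_lt ?_ (hfδ E hE hlt)⟩
  refine Finset.sum_congr rfl fun i hi => ?_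
  rw [h (hE.1 i hi).1, h (hE.1 i hi).2]

lemma memLp_grad_of_arcEnergy_lt_top {u : K0 T → ℝ} {i : ArcIndex} (h : arcEnergy T u i < ⊤) :
    MemLp (grad T u i) 2 (len T i) := by
  have hr := (arcDisk T i).radius_pos
  have hm : AEStronglyMeasurable (grad T u i) (len T i) := by
    have h1 : Measurable (grad T u i) := by
      have h2 : Continuous fun θ : ℝ => Complex.exp (θ * Complex.I) * Complex.I := by fun_prop
      exact ((measurable_deriv fun t => extend u (circleMap (arcDisk T i).center
        (arcDisk T i).radius t)).div_const _).smul h2.measurable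
    exact h1.aestronglyMeasurable
  refine ⟨hm, ?_⟩
  rw [eLpNorm_lt_top_iff_lintegral_rpow_enorm_lt_top (by norm_num) (by norm_num)]
  rw [arcEnergy, lintegral_mul_const' _ _ ENNReal.ofReal_ne_top] at h
  have h2 : ENNReal.ofReal (arcDisk T i).radius ≠ 0 := by simpa using hr
  have h3 := ENNReal.lt_top_of_mul_ne_top_left h.ne h2
  simpa using h3

lemma exists_extension (hT : Tangential T) {f : ℂ → ℝ} {M : ℝ} (h0 : 0 ≤ M)
    (hM : ∀ n, arcSum T n f ≤ M) : ∃ u ∈ domain T, (∀ x ∈ VStar T, extend u x = f x) ∧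
      ∑' i, arcEnergy T u i ≤ ENNReal.ofReal M := by
  obtain ⟨g, hg1, hg2, hg3⟩ := exists_forall_setIntegral_eq hT h0 hM
  choose U hU1 hU2 hU3 using fun i => exists_extension_arc hT i (hg1 i)
    (f := f) fun w l hi => by rw [← hg3 w l, hi]
  -- The choice of arc is immaterial: two arcs meet in vertices only, and there both extensions
  -- equal `f`.
  choose idx hidx using fun x : K0 T => Set.mem_iUnion.1 x.2
  set u : K0 T → ℝ := fun x => U (idx x) x with hu
  have hK : ∀ i, arc T i ⊆ K0 T := Set.subset_iUnion (arc T)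
  have huU : ∀ i, ∀ x ∈ arc T i, extend u x = U i x := fun i x hx => by
    rw [extend_of_mem _ (hK i hx), hu]
    simp only
    by_cases h : idx ⟨x, hK i hx⟩ = i
    · rw [h]
    · have hV := mem_VStar_of_mem_arc_of_mem_arc hT h (hidx ⟨x, hK i hx⟩) hx
      rw [hU3 _ x (hidx ⟨x, hK i hx⟩) hV, hU3 _ x hx hV]
  have hval : ∀ x ∈ VStar T, extend u x = f x := fun x hx => by
    obtain ⟨i, hi⟩ := Set.mem_iUnion.1 (VStar_subset_K0 hT hx)
    rw [huU i x hi, hU3 i x hi hx]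
  have henergy : ∀ i, arcEnergy T u i ≤
      ∫⁻ θ in Set.Ioc 0 (2 * Real.pi), ENNReal.ofReal (g i θ ^ 2) := fun i => by
    rw [arcEnergy_eq]
    refine le_trans (le_of_eq ?_) (lintegral_mono_set (Set.inter_subset_right (s := interior (arcAngles T i))))
    refine setLIntegral_congr_fun_ae (isOpen_interior.measurableSet.inter measurableSet_Ioc) ?_
    filter_upwards [hU2 i] with θ hθ hθ'
    rw [← hθ ⟨interior_subset hθ'.1, hθ'.2⟩]
    congr 2
    -- Equal derivatives need agreement near the angle, which holds at interior angles of the arc.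
    refine EventuallyEq.deriv_eq ?_
    filter_upwards [isOpen_interior.mem_nhds hθ'.1] with t ht
    have ht' : t ∈ arcAngles T i := interior_subset ht
    exact huU i _ ht'
  have htot : ∑' i, arcEnergy T u i ≤ ENNReal.ofReal M :=
    (ENNReal.tsum_le_tsum henergy).trans hg2
  refine ⟨u, ⟨fun i => ⟨fun a b hab hC => ?_, ?_⟩, htot.trans_lt ENNReal.ofReal_lt_top⟩, hval, htot⟩
  · refine AbsolutelyContinuousOnInterval.congr (hU1 i a b) fun θ hθ => ?_
    rw [Set.uIcc_of_le hab] at hθ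
    exact huU i _ (hC ⟨θ, hθ, rfl⟩)
  · exact memLp_grad_of_arcEnergy_lt_top
      ((ENNReal.le_tsum i).trans_lt (htot.trans_lt ENNReal.ofReal_lt_top))

/-! ### The arc-energy form -/

lemma arcForm_self {u : K0 T → ℝ} (hu : u ∈ domain T) (i : ArcIndex) :
    arcForm T u u i = (arcEnergy T u i).toReal := by
  have hr := (arcDisk T i).radius_pos
  have hm := (hu.1 i).2.1
  rw [arcForm, integral_eq_lintegral_of_nonneg_ae, arcEnergy]
  · congr 1
    refine lintegral_congr fun θ => ?_
    rw [real_inner_self_eq_norm_sq, ENNReal.ofReal_mul (sq_nonneg _), ← ofReal_norm,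
      ENNReal.ofReal_pow (norm_nonneg _)]
  · exact Eventually.of_forall fun θ => mul_nonneg real_inner_self_nonneg hr.le
  · exact (hm.inner hm).mul_const _

lemma integrable_inner_grad {u v : K0 T → ℝ} (hu : u ∈ domain T) (hv : v ∈ domain T)
    (i : ArcIndex) : Integrable (fun θ => inner ℝ (grad T u i θ) (grad T v i θ)) (len T i) := by
  have h1 := (hu.1 i).2.norm.integrable_sq
  have h2 := (hv.1 i).2.norm.integrable_sq
  refine (h1.add h2).mono' ((hu.1 i).2.1.inner (hv.1 i).2.1) (Eventually.of_forall fun θ => ?_)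
  refine (norm_inner_le_norm _ _).trans ?_
  simp only [Pi.add_apply]
  nlinarith [sq_nonneg (‖grad T u i θ‖ - ‖grad T v i θ‖), norm_nonneg (grad T u i θ),
    norm_nonneg (grad T v i θ)]

lemma arcForm_add_self {u v : K0 T → ℝ} (hu : u ∈ domain T) (hv : v ∈ domain T) (i : ArcIndex) :
    arcForm T (u + v) (u + v) i = arcForm T u u i + 2 * arcForm T u v i + arcForm T v v i := by
  have h : ∀ {a b : K0 T → ℝ}, a ∈ domain T → b ∈ domain T →
      Integrable (fun θ => inner ℝ (grad T a i θ) (grad T b i θ) * (arcDisk T i).radius) (len T i) :=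
    fun ha hb => (integrable_inner_grad ha hb i).mul_const _
  have e1 := integral_add ((h hu hu).add ((h hu hv).const_mul 2)) (h hv hv)
  have e2 := integral_add (h hu hu) ((h hu hv).const_mul 2)
  simp only [Pi.add_apply] at e1
  unfold arcForm
  rw [← integral_const_mul, ← e2, ← e1]
  refine integral_congr_ae ?_
  filter_upwards [grad_add (hu.1 i) (hv.1 i)] with θ hθ
  simp only [hθ, Pi.add_apply, real_inner_add_add_self]
  ring

lemma hasSum_arcForm_self {u : K0 T → ℝ} (hu : u ∈ domain T) :
    HasSum (arcForm T u u) (∑' i, arcEnergy T u i).toReal := by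
  have h : arcForm T u u = fun i => (arcEnergy T u i).toReal := funext (arcForm_self hu)
  rw [h, ENNReal.tsum_toReal_eq fun i => (ENNReal.le_tsum i).trans_lt hu.2 |>.ne]
  exact (ENNReal.summable_toReal hu.2.ne).hasSum

/-- Polarization reduces this to three convergent series of energies. -/
lemma hasSum_arcForm {u v : K0 T → ℝ} (hu : u ∈ domain T) (hv : v ∈ domain T) :
    HasSum (arcForm T u v) ((energy T (u + v) (u + v) - energy T u u - energy T v v) / 2) := by
  have h : arcForm T u v = fun i =>
      (arcForm T (u + v) (u + v) i - arcForm T u u i - arcForm T v v i) / 2 := funext fun i => by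
    rw [arcForm_add_self hu hv]; ring
  have hs : ∀ {a : K0 T → ℝ}, a ∈ domain T → HasSum (arcForm T a a) (energy T a a) :=
    fun ha => (hasSum_arcForm_self ha).summable.hasSum
  rw [h]
  exact (((hs (add_mem hu hv)).sub (hs hu)).sub (hs hv)).div_const 2

/-! ### The limit of the discrete energies -/

lemma arcSum_nonneg (T : Fin 3 → Disk) (n : ℕ) (f : ℂ → ℝ) : 0 ≤ arcSum T n f :=
  Finset.sum_nonneg fun _ _ => Finset.sum_nonneg fun l _ =>
    div_nonneg (sq_nonneg _) (mul_pos two_pos (halfAngle_pos _ l)).le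

lemma exists_extension_of_levelForm_le (hT : Tangential T) {f : ℂ → ℝ} {M : ℝ}
    (hM : ∀ n, levelForm T n f f ≤ M) : ∃ u ∈ domain T, (∀ x ∈ VStar T, extend u x = f x) ∧
      energy T u u ≤ M := by
  have h1 : ∀ n, arcSum T n f ≤ M := fun n => (arcSum_le_levelForm T n f).trans (hM n)
  have h0 : 0 ≤ M := (arcSum_nonneg T 0 f).trans (h1 0)
  obtain ⟨u, hu, h2, h3⟩ := exists_extension hT h0 h1
  refine ⟨u, hu, h2, ?_⟩
  rw [energy, (hasSum_arcForm_self hu).tsum_eq]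
  exact ENNReal.toReal_le_of_le_ofReal h0 h3

lemma eq_of_eqOn_VStar (hT : Tangential T) {u v : K0 T → ℝ} (hu : u ∈ domain T)
    (hv : v ∈ domain T) (h : ∀ x ∈ VStar T, extend u x = extend v x) : u = v := by
  refine sub_eq_zero.1 (eq_zero_of_restr_eq_zero hT (sub_mem hu hv) fun x hx => ?_)
  have : extend (u - v) = extend u - extend v := map_sub (extendLin (K0 T)) u v
  rw [this, Pi.sub_apply, h x hx, sub_self]

/-- The bound by the arc energy comes from `levelForm_le_of_arcSum_le`. For the reverse bound, the
values of `u` on the vertices have an extension with energy at most the supremum of the discrete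
energies, and by uniqueness this extension is `u`. -/
lemma tendsto_levelForm_self (hT : Tangential T) {u : K0 T → ℝ} (hu : u ∈ domain T) :
    Tendsto (fun n => levelForm T n (extend u) (extend u)) atTop (𝓝 (energy T u u)) := by
  have hle : ∀ n, levelForm T n (extend u) (extend u) ≤ energy T u u := by
    refine levelForm_le_of_arcSum_le hT fun n => ?_
    rw [energy, (hasSum_arcForm_self hu).tsum_eq]
    exact (ENNReal.ofReal_le_iff_le_toReal hu.2.ne).1 (ofReal_arcSum_le hT hu n)
  have hbdd : BddAbove (Set.range fun n => levelForm T n (extend u) (extend u)) :=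
    ⟨_, by rintro _ ⟨n, rfl⟩; exact hle n⟩
  have hlim := tendsto_atTop_ciSup (levelForm_mono hT (extend u)) hbdd
  obtain ⟨v, hv, h1, h2⟩ := exists_extension_of_levelForm_le hT fun n => le_ciSup hbdd n
  obtain rfl := eq_of_eqOn_VStar hT hv hu h1
  convert hlim using 2
  exact le_antisymm h2 (ciSup_le hle)

lemma tendsto_levelForm (hT : Tangential T) {u v : K0 T → ℝ} (hu : u ∈ domain T)
    (hv : v ∈ domain T) :
    Tendsto (fun n => levelForm T n (extend u) (extend v)) atTop (𝓝 (energy T u v)) := by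
  have h1 := ((tendsto_levelForm_self hT (add_mem hu hv)).sub (tendsto_levelForm_self hT hu)).sub
    (tendsto_levelForm_self hT hv) |>.div_const 2
  have h2 : energy T u v = _ := (hasSum_arcForm hu hv).tsum_eq
  rw [h2]
  refine h1.congr fun n => ?_
  rw [extend_add]
  simp only [map_add, LinearMap.add_apply]
  rw [levelForm_comm T n (extend v) (extend u)]
  ring

lemma level_discreteForm (T : Fin 3 → Disk) (u v : VStar T → ℝ) (m : ℕ) :
    level T (discreteForm T) u v m = levelForm T m (extend u) (extend v) :=
  levelForm_congr (extend_restr _ u) (extend_restr _ v)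

lemma level_restr (hV : VStar T ⊆ K0 T) (u v : K0 T → ℝ) (m : ℕ) :
    level T (discreteForm T) (restr hV u) (restr hV v) m = levelForm T m (extend u) (extend v) :=
  levelForm_congr (extend_restr ((V_subset_VStar T m).trans hV) u)
    (extend_restr ((V_subset_VStar T m).trans hV) v)

lemma tendsto_level (hT : Tangential T) (hV : VStar T ⊆ K0 T) {u v : K0 T → ℝ}
    (hu : u ∈ domain T) (hv : v ∈ domain T) :
    Tendsto (level T (discreteForm T) (restr hV u) (restr hV v)) atTop (𝓝 (energy T u v)) :=
  (tendsto_levelForm hT hu hv).congr fun m => (level_restr hV u v m).symm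

lemma limitDomain_eq_map (hT : Tangential T) (hV : VStar T ⊆ K0 T)
    (hE : IsDiscreteForms T (discreteForm T)) :
    limitDomain T (discreteForm T) hE = Submodule.map (restr hV) (domain T) := by
  apply le_antisymm
  · rintro w ⟨L, hL⟩
    have h1 : ∀ n, levelForm T n (extend w) (extend w) ≤ L := fun n => by
      rw [← level_discreteForm]
      exact (hE.level_mono w).ge_of_tendsto hL n
    obtain ⟨u, hu, h2, -⟩ := exists_extension_of_levelForm_le hT h1
    refine ⟨u, hu, funext fun x => ?_⟩
    have h3 := h2 x x.2
    rw [extend_of_mem _ (hV x.2), extend_of_mem _ x.2] at h3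
    exact h3
  · rintro _ ⟨u, hu, rfl⟩
    exact ⟨_, tendsto_level hT hV hu hu⟩

lemma restr_injOn_domain (hT : Tangential T) (hV : VStar T ⊆ K0 T) {u v : K0 T → ℝ}
    (hu : u ∈ domain T) (hv : v ∈ domain T) (h : restr hV u = restr hV v) : u = v := by
  refine eq_of_eqOn_VStar hT hu hv fun x hx => ?_
  rw [extend_of_mem _ (hV hx), extend_of_mem _ (hV hx)]
  exact congrFun h ⟨x, hx⟩

end Apollonian

end

/-! ### The theorem. -/

theorem mainTheorem7 (T : Fin 3 → Apollonian.Disk) (hT : Apollonian.IsTDT T) :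
    (∃! E : (m : ℕ) → LinearMap.BilinForm ℝ (Apollonian.V T m → ℝ),
      Apollonian.IsDiscreteForms T E) ∧
    ∃ hV : Apollonian.VStar T ⊆ Apollonian.K0 T,
      ∀ (E : (m : ℕ) → LinearMap.BilinForm ℝ (Apollonian.V T m → ℝ))
        (hE : Apollonian.IsDiscreteForms T E),
        (∀ u ∈ Apollonian.limitDomain T E hE, ∀ v ∈ Apollonian.limitDomain T E hE,
          Tendsto (Apollonian.level T E u v) atTop (𝓝 (Apollonian.limitForm T E u v))) ∧
        Apollonian.limitDomain T E hE =
          Submodule.map (Apollonian.restr hV) (Apollonian.domain T) ∧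
        (∃ φ : Apollonian.domain T ≃ₗ[ℝ] Apollonian.limitDomain T E hE,
          ∀ u : Apollonian.domain T,
            (φ u : Apollonian.VStar T → ℝ) = Apollonian.restr hV u) ∧
        ∀ u ∈ Apollonian.domain T, ∀ v ∈ Apollonian.domain T,
          Summable (Apollonian.arcForm T u v) ∧
          Apollonian.limitForm T E (Apollonian.restr hV u) (Apollonian.restr hV v) =
            Apollonian.energy T u v := by
  have hT' := hT.tangential
  have hD := Apollonian.isDiscreteForms_discreteForm hT'
  refine ⟨⟨_, hD, fun E hE => hE.unique hT' hD⟩, Apollonian.VStar_subset_K0 hT', ?_⟩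
  intro E hE
  -- By uniqueness only the explicit forms have to be considered.
  obtain rfl := hE.unique hT' hD
  set hV := Apollonian.VStar_subset_K0 hT'
  have hmap := Apollonian.limitDomain_eq_map hT' hV hE
  have hmem : ∀ u ∈ Apollonian.domain T,
      Apollonian.restr hV u ∈ Apollonian.limitDomain T (Apollonian.discreteForm T) hE :=
    fun u hu => hmap ▸ Submodule.mem_map_of_mem hu
  refine ⟨?_, hmap, ?_, fun u hu v hv => ⟨(Apollonian.hasSum_arcForm hu hv).summable,
    (Apollonian.tendsto_level hT' hV hu hv).limUnder_eq⟩⟩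
  · intro u hu v hv
    rw [hmap] at hu hv
    obtain ⟨u, hu, rfl⟩ := hu
    obtain ⟨v, hv, rfl⟩ := hv
    exact tendsto_nhds_limUnder ⟨_, Apollonian.tendsto_level hT' hV hu hv⟩
  · refine ⟨LinearEquiv.ofBijective ((Apollonian.restr hV).restrict hmem) ⟨?_, ?_⟩, fun u => rfl⟩
    · intro u v h
      exact Subtype.ext (Apollonian.restr_injOn_domain hT' hV u.2 v.2 (congrArg Subtype.val h))
    · rintro ⟨w, hw⟩
      have hw' := hw
      rw [hmap] at hw'
      obtain ⟨u, hu, rfl⟩ := hw'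
      exact ⟨⟨u, hu⟩, rfl⟩
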